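/- \textbf{Notation.} Here $\mathbb N$ is the set of positive integers. For $m\in\mathbb N$, $\pi(m)$ is the set of primes dividing $m$, $m_p$ is the largest power of the prime $p$ dividing $m$, and $m_\pi=\prod_{p\in\pi}m_p$ for a finite set $\pi$ of primes; $m_{2'}=m/m_2$. $\mathcal U_m$ is the group of units of $\mathbb Z/m\mathbb Z$, $\mathrm{Res}_q:\mathcal U_m\to\mathcal U_q$ is the natural map for $q\mid m$, and for a finite abelian group $T$ and a set of primes $\nu$, $T_{\nu'}$ is the Hall $\nu'$-subgroup of $T$ (the elements of order coprime to all primes of $\nu$). For a subgroup $T\le\mathcal U_m$ put $\mathrm{inv}(T)=(r,\epsilon,o)$, where $r$ is the greatest divisor of $m$ such that $\mathrm{Res}_{r_{2'}}(T)=1$ and $\mathrm{Res}_{r_2}(T)\subseteq\langle -1\rangle$; $\epsilon=-1$ if $\mathrm{Res}_{r_2}(T)\neq1$ and $\epsilon=1$ otherwise; and $o=|\mathrm{Res}_{m_\nu}(T_{\nu'})|$ with $\nu=\pi(m)\setminus\pi(r)$. For $n,s\in\mathbb N$ put $[T,n,s]=m_\nu\prod_{p\in\pi(r)}m'_p$,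 where $$m'_p=\min\Big(m_p,\;o_pr_p,\;\max\big(r_p,\;s_p,\;r_p\tfrac{s_po_p}{n_p}\big)\Big)\quad\text{if }\epsilon^{p-1}=1,$$ and, if $\epsilon=-1$, $m'_2=r_2$ when $o_2\le2$ or $m_2\le2r_2$; otherwise $m'_2=\frac{m_2}{2}$ when $4\le o_2<n_2$, $4r_2\le m$, and ($s_2\le n_2r_2$ implies $s_2=m_2<n_2r_2$); and $m'_2=m_2$ in all other cases. The integer $[T,n,s]$ divides $m$. A metacyclic factorization of a finite group $G$ is an expression $G=AB$ with $A$ a cyclic normal subgroup and $B$ a cyclic subgroup of $G$; $G$ is metacyclic if it has one. $T_G(A)\le\mathcal U_{|A|}$ is the group of the classes $u$ such that $a\mapsto a^u$ is the restriction to $A$ of an inner automorphism of $G$, and $r_G(A)$ is the first entry of $\mathrm{inv}(T_G(A))$. The factorization is minimal if $(|A|,r_G(A),[G:B])$ is lexicographically minimal among all metacyclic factorizations of $G$. For a finite metacyclic group $G$, $$\mathrm{IN}(G)=(|A|,[G:A],[G:B],r,\epsilon,o),\qquad (r,\epsilon,o)=\mathrm{inv}\big(\mathrm{Res}_{[T,n,s]}(T)\big),$$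 where $G=AB$ is a minimal metacyclic factorization, $T=T_G(A)$, $n=[G:A]$ and $s=[G:B]$; this tuple does not depend on the minimal factorization (the meaning of ``$\mathrm{IN}(G)=x$'' includes that all minimal factorizations of $G$ give $x$). \textbf{Lemma.} Let $m,n,s,r,o\in\mathbb N$ and $\epsilon\in\{1,-1\}$, and let $\pi'=\pi(m)\setminus\pi(r)$ and $\pi=\pi(mn)\setminus\pi'$. Then $\mathrm{IN}(G)=(m,n,s,r,\epsilon,o)$ for some finite metacyclic group $G$ if and only if the following conditions hold: \begin{enumerate} \item[(A)] $s\mid m$, $r\mid m$, $o\mid n_\pi$, $m_\pi\mid rn$, $m_\pi\mid rs$, $s_{\pi'}=m_{\pi'}$, and if $4\mid m$ then $4\mid r$. \item[(B)] If $p\in\pi(r)$ and $\epsilon^{p-1}=1$, then $s_p\mid n$ and either $r_p\mid s$ or $s_po_p\nmid n$. \item[(C)] If $\epsilon=-1$, then $2\mid n$, $4\mid m$, $m_2\mid2s$ and $s_2\ne n_2r_2$. If moreover $4\mid n$, $8\mid m$ and $o_2<n_2$, then $r_2\mid s$. \item[(D)] $o\mid\mathrm{lcm}\{q-1:q\in\pi'\}$,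 and for every $q\in\pi'$ with $\gcd(o,q-1)=1$ there is $p\in\pi'\cap\pi(n)$ with $p\mid q-1$. \end{enumerate} -/

import Mathlib

namespace Metacyclic

/-! ### Arithmetic notation: `ordProj[p] m` is the `p`-part `m_p` of `m`. -/

/-- The part `m_π = ∏_{p ∈ π} m_p` of `m` at a finite set of primes `π`. -/
def piPart (π : Finset ℕ) (m : ℕ) : ℕ := ∏ p ∈ π, ordProj[p] m

theorem piPart_dvd (π : Finset ℕ) (m : ℕ) : piPart π m ∣ m := by
  rcases eq_or_ne m 0 with rfl | hm
  · exact dvd_zero _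
  · have h1 : piPart π m = ∏ p ∈ π ∩ m.primeFactors, ordProj[p] m := by
      refine (Finset.prod_subset Finset.inter_subset_left fun p hp hp' => ?_).symm
      have : p ∉ m.primeFactors := fun h => hp' (Finset.mem_inter.2 ⟨hp, h⟩)
      rw [Finsupp.notMem_support_iff.1 (by rwa [Nat.support_factorization]), pow_zero]
    rw [h1]
    refine (Finset.prod_dvd_prod_of_subset _ _ _ Finset.inter_subset_right).trans ?_
    exact dvd_of_eq (Nat.prod_factorization_pow_eq_self hm)

/-! ### The invariants `(r, ε, o)` of a subgroup `T` of `(ℤ/m)ˣ` -/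

/-- `Res_q(T)`, the image of `T ≤ (ℤ/m)ˣ` in `(ℤ/q)ˣ`, for `q ∣ m`. -/
def Res {m q : ℕ} (h : q ∣ m) (T : Subgroup (ZMod m)ˣ) : Subgroup (ZMod q)ˣ :=
  T.map (ZMod.unitsMap h)

/-- `Res_{d_{2'}}(T) = 1` and `Res_{d_2}(T) ⊆ ⟨-1⟩`, for a divisor `d` of `m`. -/
def RCond {m : ℕ} (T : Subgroup (ZMod m)ˣ) (d : ℕ) : Prop :=
  ∃ hd : d ∣ m, Res ((Nat.ordCompl_dvd d 2).trans hd) T = ⊥ ∧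
    Res ((Nat.ordProj_dvd d 2).trans hd) T ≤ Subgroup.zpowers (-1)

open Classical in
/-- The greatest divisor `r` of `m` with `Res_{r_{2'}}(T) = 1` and `Res_{r_2}(T) ⊆ ⟨-1⟩`. -/
noncomputable def rInv {m : ℕ} (T : Subgroup (ZMod m)ˣ) : ℕ := Nat.findGreatest (RCond T) m

theorem rCond_one {m : ℕ} (T : Subgroup (ZMod m)ˣ) : RCond T 1 := by
  have h1 : ∀ k : ℕ, k = 1 → Subsingleton (Subgroup (ZMod k)ˣ) := by
    rintro k rfl
    infer_instance
  refine ⟨one_dvd m, ?_, ?_⟩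
  · exact (h1 _ (by simp)).elim _ _
  · exact le_of_eq ((h1 _ (by simp)).elim _ _)

theorem rCond_rInv {m : ℕ} (T : Subgroup (ZMod m)ˣ) (hm : m ≠ 0) : RCond T (rInv T) := by
  classical
  exact Nat.findGreatest_spec (P := RCond T) (Nat.one_le_iff_ne_zero.2 hm) (rCond_one T)

theorem rInv_dvd {m : ℕ} (T : Subgroup (ZMod m)ˣ) : rInv T ∣ m := by
  rcases eq_or_ne m 0 with rfl | hm
  · exact dvd_zero _
  · exact (rCond_rInv T hm).choose

open Classical in
/-- `ε = -1` if `Res_{r_2}(T) ≠ 1`, and `ε = 1` otherwise. -/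
noncomputable def epsInv {m : ℕ} (T : Subgroup (ZMod m)ˣ) : ℤ :=
  if Res ((Nat.ordProj_dvd (rInv T) 2).trans (rInv_dvd T)) T ≠ ⊥ then -1 else 1

/-- The Hall `ν'`-subgroup `T_{ν'}` of a subgroup `T` of an abelian group: the elements of `T`
whose order is coprime to every `p ∈ ν`. -/
def hallCompl {A : Type*} [CommGroup A] (T : Subgroup A) (ν : Finset ℕ) : Subgroup A where
  carrier := {x | x ∈ T ∧ ∀ p ∈ ν, (orderOf x).Coprime p}
  one_mem' := ⟨T.one_mem, fun p _ => by simp⟩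
  mul_mem' := fun {x y} hx hy => ⟨T.mul_mem hx.1 hy.1, fun p hp =>
    Nat.Coprime.coprime_dvd_left (Commute.all x y).orderOf_mul_dvd_mul_orderOf
      ((hx.2 p hp).mul_left (hy.2 p hp))⟩
  inv_mem' := fun {x} hx => ⟨T.inv_mem hx.1, fun p hp => by
    rw [orderOf_inv]; exact hx.2 p hp⟩

/-- `ν = π(m) \ π(r)`. -/
def nu (m r : ℕ) : Finset ℕ := m.primeFactors \ r.primeFactors

/-- `o = |Res_{m_ν}(T_{ν'})|` with `ν = π(m) \ π(r)`. -/
noncomputable def oInv {m : ℕ} (T : Subgroup (ZMod m)ˣ) : ℕ :=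
  Nat.card (Res (piPart_dvd (nu m (rInv T)) m) (hallCompl T (nu m (rInv T))))

/-- `inv(T) = (r, ε, o)`. -/
noncomputable def inv {m : ℕ} (T : Subgroup (ZMod m)ˣ) : ℕ × ℤ × ℕ := (rInv T, epsInv T, oInv T)

/-! ### The modulus `[T, n, s]` -/

open Classical in
/-- The factor `m'_p` of `[T, n, s]`, for `p ∣ r`. In the first case the natural number quotient
is exact if `n_p ∣ r_p s_p o_p`, and otherwise it is `0` while the exact quotient is less than `1`,
so that neither affects the maximum with `r_p`. -/
noncomputable def mPrimePart (m n s r : ℕ) (ε : ℤ) (o p : ℕ) : ℕ :=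
  if ε ^ (p - 1) = 1 then
    min (ordProj[p] m) (min (ordProj[p] o * ordProj[p] r)
      (max (ordProj[p] r) (max (ordProj[p] s)
        (ordProj[p] r * (ordProj[p] s * ordProj[p] o) / ordProj[p] n))))
  else if ordProj[2] o ≤ 2 ∨ ordProj[2] m ≤ 2 * ordProj[2] r then ordProj[2] r
  else if 4 ≤ ordProj[2] o ∧ ordProj[2] o < ordProj[2] n ∧ 4 * ordProj[2] r ≤ m ∧
      (ordProj[2] s ≤ ordProj[2] n * ordProj[2] r →
        ordProj[2] s = ordProj[2] m ∧ ordProj[2] m < ordProj[2] n * ordProj[2] r) then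
    ordProj[2] m / 2
  else ordProj[2] m

/-- `[T, n, s] = m_ν ∏_{p ∈ π(r)} m'_p`. -/
noncomputable def modulus {m : ℕ} (T : Subgroup (ZMod m)ˣ) (n s : ℕ) : ℕ :=
  piPart (nu m (rInv T)) m *
    ∏ p ∈ (rInv T).primeFactors, mPrimePart m n s (rInv T) (epsInv T) (oInv T) p

theorem epsInv_eq {m : ℕ} (T : Subgroup (ZMod m)ˣ) : epsInv T = 1 ∨ epsInv T = -1 := by
  unfold epsInv; split_ifs <;> simp

theorem mPrimePart_dvd {m n s r : ℕ} {ε : ℤ} {o p : ℕ} (hε : ε = 1 ∨ ε = -1) (hp : p.Prime)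
    (hr : r ∣ m) (hm : m ≠ 0) : mPrimePart m n s r ε o p ∣ ordProj[p] m := by
  have key : ∀ x : ℕ, (∃ k, x = p ^ k) → x ≤ ordProj[p] m → x ∣ ordProj[p] m := by
    rintro x ⟨k, rfl⟩ hx
    exact pow_dvd_pow p ((Nat.pow_le_pow_iff_right hp.one_lt).1 hx)
  have hmin : ∀ x y : ℕ, (∃ k, x = p ^ k) → (∃ k, y = p ^ k) → ∃ k, min x y = p ^ k := by
    intro x y hx hy
    rcases min_choice x y with h | h <;> rw [h] <;> assumption
  have hmax : ∀ x y : ℕ, (∃ k, x = p ^ k) → (∃ k, y = p ^ k) → ∃ k, max x y = p ^ k := by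
    intro x y hx hy
    rcases max_choice x y with h | h <;> rw [h] <;> assumption
  have hrm : ordProj[p] r ∣ ordProj[p] m :=
    pow_dvd_pow p ((Nat.factorization_le_iff_dvd (ne_zero_of_dvd_ne_zero hm hr) hm).2 hr p)
  unfold mPrimePart
  by_cases h1 : ε ^ (p - 1) = 1
  · rw [if_pos h1]
    refine key _ ?_ (min_le_left _ _)
    refine hmin _ _ ⟨_, rfl⟩ (hmin _ _ ⟨o.factorization p + r.factorization p, by rw [pow_add]⟩ ?_)
    rw [← pow_add, ← pow_add]
    rcases le_or_gt (n.factorization p)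
      (r.factorization p + (s.factorization p + o.factorization p)) with h | h
    · rw [Nat.pow_div h hp.pos]
      exact hmax _ _ ⟨_, rfl⟩ (hmax _ _ ⟨_, rfl⟩ ⟨_, rfl⟩)
    · rw [Nat.div_eq_of_lt (Nat.pow_lt_pow_right hp.one_lt h)]
      refine hmax _ _ ⟨_, rfl⟩ ?_
      rw [Nat.max_zero]
      exact ⟨_, rfl⟩
  · have hp2 : p = 2 := by
      by_contra hne
      rcases hε with rfl | rfl
      · exact h1 (one_pow _)
      · exact h1 ((hp.even_sub_one hne).neg_one_pow)
    subst hp2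
    rw [if_neg h1]
    by_cases h2 : ordProj[2] o ≤ 2 ∨ ordProj[2] m ≤ 2 * ordProj[2] r
    · rw [if_pos h2]; exact hrm
    · rw [if_neg h2]
      split_ifs with h3
      · have h4 : 2 ∣ ordProj[2] m := by
          push Not at h2
          have h5 := h2.2
          have h6 : 0 < ordProj[2] r := Nat.ordProj_pos r 2
          refine dvd_pow_self 2 fun h0 => ?_
          rw [h0] at h5
          omega
        exact Nat.div_dvd_of_dvd h4
      · exact dvd_rfl

theorem modulus_dvd {m : ℕ} (T : Subgroup (ZMod m)ˣ) (n s : ℕ) : modulus T n s ∣ m := by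
  rcases eq_or_ne m 0 with rfl | hm
  · exact dvd_zero _
  · have hsub : (rInv T).primeFactors ⊆ m.primeFactors :=
      Nat.primeFactors_mono (rInv_dvd T) hm
    have h1 : modulus T n s ∣
        (∏ p ∈ nu m (rInv T), ordProj[p] m) * ∏ p ∈ (rInv T).primeFactors, ordProj[p] m :=
      mul_dvd_mul dvd_rfl (Finset.prod_dvd_prod_of_dvd _ _ fun p hp =>
        mPrimePart_dvd (epsInv_eq T) (Nat.prime_of_mem_primeFactors hp) (rInv_dvd T) hm)
    rw [nu, Finset.prod_sdiff hsub] at h1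
    exact h1.trans (dvd_of_eq (Nat.prod_factorization_pow_eq_self hm))

/-! ### Metacyclic factorizations -/

/-- A metacyclic factorization `G = AB`: `A` is a normal cyclic subgroup of `G` and `B` is a cyclic
subgroup of `G`. -/
structure Factorization (G : Type*) [Group G] where
  A : Subgroup G
  B : Subgroup G
  normal : A.Normal
  cyclicA : IsCyclic A
  cyclicB : IsCyclic B
  eq_mul : ∀ g : G, ∃ a ∈ A, ∃ b ∈ B, g = a * b

/-- `T_G(A)`, for a normal cyclic subgroup `A` of a finite group `G`: the classes `u` in
`(ℤ/|A|)ˣ` such that `a ↦ a ^ u` is the restriction to `A` of an inner automorphism of `G`. -/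
def TG {G : Type*} [Group G] [Finite G] (A : Subgroup G) :
    Subgroup (ZMod (Nat.card A))ˣ where
  carrier := {u | ∃ g : G, ∀ a ∈ A, g * a * g⁻¹ = a ^ (u : ZMod (Nat.card A)).val}
  one_mem' := ⟨1, fun a ha => by
    have h : a ^ Nat.card A = 1 :=
      orderOf_dvd_iff_pow_eq_one.1 (Subgroup.orderOf_dvd_natCard A ha)
    rw [Units.val_one, ZMod.val_one_eq_one_mod, ← pow_eq_pow_mod 1 h]
    simp⟩
  mul_mem' := by
    rintro u v ⟨g, hg⟩ ⟨k, hk⟩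
    refine ⟨g * k, fun a ha => ?_⟩
    have h : a ^ Nat.card A = 1 :=
      orderOf_dvd_iff_pow_eq_one.1 (Subgroup.orderOf_dvd_natCard A ha)
    rw [Units.val_mul, ZMod.val_mul, ← pow_eq_pow_mod _ h, pow_mul, ← hk _ (A.pow_mem ha _),
      ← hg a ha]
    have h2 : k * (g * a * g⁻¹) * k⁻¹ = (g * a * g⁻¹) ^ (v : ZMod (Nat.card A)).val := by
      rw [hg a ha]; exact hk _ (A.pow_mem ha _)
    rw [h2, conj_pow, ← hk a ha]
    group
  inv_mem' := by
    rintro u ⟨g, hg⟩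
    refine ⟨g⁻¹, fun a ha => ?_⟩
    have h : a ^ Nat.card A = 1 :=
      orderOf_dvd_iff_pow_eq_one.1 (Subgroup.orderOf_dvd_natCard A ha)
    have h1 : g * a ^ ((u⁻¹ : (ZMod (Nat.card A))ˣ) : ZMod (Nat.card A)).val * g⁻¹ = a := by
      rw [hg _ (A.pow_mem ha _), ← pow_mul, pow_eq_pow_mod _ h, ← ZMod.val_mul, ← Units.val_mul,
        inv_mul_cancel, Units.val_one, ZMod.val_one_eq_one_mod, ← pow_eq_pow_mod _ h, pow_one]
    nth_rewrite 1 [← h1]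
    group

namespace Factorization

variable {G : Type*} [Group G]

/-- `m = |A|`. -/
noncomputable def m (F : Factorization G) : ℕ := Nat.card F.A

/-- `n = [G : A]`. -/
noncomputable def n (F : Factorization G) : ℕ := F.A.index

/-- `s = [G : B]`. -/
noncomputable def s (F : Factorization G) : ℕ := F.B.index

variable [Finite G]

/-- `T = T_G(A)`. -/
def T (F : Factorization G) : Subgroup (ZMod F.m)ˣ := TG F.A

/-- `G = AB` is minimal: `(|A|, r_G(A), [G : B])` is lexicographically minimal among all the
metacyclic factorizations of `G`. -/
def IsMinimal (F : Factorization G) : Prop :=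
  ∀ F' : Factorization G,
    toLex (F.m, toLex (rInv F.T, F.s)) ≤ toLex (F'.m, toLex (rInv F'.T, F'.s))

/-- `Δ(AB) = Res_{[T, n, s]}(T)`. -/
noncomputable def Delta (F : Factorization G) : Subgroup (ZMod (modulus F.T F.n F.s))ˣ :=
  Res (modulus_dvd F.T F.n F.s) F.T

/-- The tuple `(|A|, [G : A], [G : B], inv(Δ(AB)))`. -/
noncomputable def data (F : Factorization G) : ℕ × ℕ × ℕ × ℕ × ℤ × ℕ :=
  (F.m, F.n, F.s, inv F.Delta)

end Factorization

/-- `IN(G) = x`, for a finite group `G`: `G` is metacyclic and `x` is the tuple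
`(|A|, [G : A], [G : B], inv(Δ(AB)))` for the minimal metacyclic factorizations `G = AB` of `G`.
That this tuple does not depend on the minimal factorization is part of the meaning. -/
def HasIN (G : Type*) [Group G] [Finite G] (x : ℕ × ℕ × ℕ × ℕ × ℤ × ℕ) : Prop :=
  (∃ F : Factorization G, F.IsMinimal) ∧ ∀ F : Factorization G, F.IsMinimal → F.data = x

end Metacyclic

/-! Choose generators: `A = ⟨a⟩`, `B = ⟨b⟩`, `b a b⁻¹ = a ^ t` and `b ^ n = a ^ c` with `gcd(c, m) =
s`. The class of `t` generates `T`, so `r`, `ε` and `o` become arithmetic of `t`. The `p`-part of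
`r` is that of `gcd(t - 1, m)`, or of `gcd(t + 1, m)` if `p = 2` and `ε = -1`; `o` is the `ν'`-part
of the order of `t` modulo `m_ν`. As `[T, n, s]` is a multiple of `r` and of `m_ν`, reduction modulo
it changes none of these (`inv_res_modulus`), and `IN(G)` can be read off `T` itself.

The conditions collected in `Admissible` hold for every factorization: they follow from `t ^ n ≡ 1`
and `(t - 1) * s ≡ 0` modulo `m` by lifting the exponent (`Gen.admissible`). Conversely, they allow
a suitable `t` to be chosen prime by prime (`exists_local`) and glued by Chinese remainders, and a
quotient of `ℤ/m ⋊ ℤ` realizes the parameters (`exists_group`).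

The remaining conditions, `Reduced`, characterize minimality. Two factorizations of `G` are compared
through the derived subgroup `G' = ⟨a ^ (t - 1)⟩`, which lies in both normal factors. This shows
that `ν` and `o` depend on `G` only. If one factorization is reduced, its `m` has the smaller part
at each prime, and where the parts of `m` agree so do `r` and `s` (`factorization_le_of_reduced`);
hence it is minimal. If a condition of `Reduced` fails, a generator can be changed: replacing `b` by
`a ^ K * b` lowers `s`, and replacing `a` by `a ^ η * b ^ z` lowers `m`, or keeps `m` and lowers
`r`. -/

namespace Metacyclic

/-! ### Geometric sums and lifting the exponent -/

open Finset in
theorem pow_dvd_geom_sum_iff {p : ℕ} (hp : p.Prime) {t : ℤ} (h1 : (p : ℤ) ∣ t - 1)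
    (h2 : p = 2 → 4 ∣ t - 1) (n k : ℕ) :
    (p : ℤ) ^ k ∣ ∑ l ∈ range n, t ^ l ↔ p ^ k ∣ n := by
  -- For `t = 1` the factor `t - 1` vanishes and cannot be cancelled, but the sum is `n` itself.
  rcases eq_or_ne t 1 with rfl | ht
  · simp only [one_pow, sum_const, card_range, nsmul_eq_mul, mul_one]
    exact_mod_cast Iff.rfl
  have hpi : Prime (p : ℤ) := Nat.prime_iff_prime_int.1 hp
  have hpt : ¬ (p : ℤ) ∣ t := fun h => hpi.not_dvd_one (by simpa using dvd_sub h h1)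
  have key : emultiplicity (p : ℤ) (t ^ n - 1) =
      emultiplicity (p : ℤ) (t - 1) + emultiplicity p n := by
    rcases hp.eq_two_or_odd' with rfl | hodd
    · have := Int.two_pow_sub_pow' (x := t) (y := 1) n (h2 rfl) (by exact_mod_cast hpt)
      rw [one_pow] at this
      rw [← Int.natCast_emultiplicity 2 n]
      exact_mod_cast this
    · have := Int.emultiplicity_pow_sub_pow hp hodd (x := t) (y := 1) h1 hpt n
      rwa [one_pow] at this
  have hfin : FiniteMultiplicity (p : ℤ) (t - 1) :=
    Int.finiteMultiplicity_iff.2 ⟨by simpa using hp.ne_one, sub_ne_zero.2 ht⟩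
  rw [← geom_sum_mul, emultiplicity_mul hpi, add_comm] at key
  have hne : emultiplicity (p : ℤ) (t - 1) ≠ ⊤ := finiteMultiplicity_iff_emultiplicity_ne_top.1 hfin
  have key2 := (ENat.addLECancellable_of_ne_top hne).inj.1 key
  rw [pow_dvd_iff_le_emultiplicity, pow_dvd_iff_le_emultiplicity, key2]

open Finset in
theorem geom_sum_two_mul (t : ℤ) (n : ℕ) :
    ∑ l ∈ range (2 * n), t ^ l = (t + 1) * ∑ l ∈ range n, (t ^ 2) ^ l := by
  induction n with
  | zero => simp
  | succ n ih =>
    rw [Nat.mul_succ, sum_range_succ, sum_range_succ, ih, sum_range_succ]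
    ring

-- Pairing consecutive terms leaves the factor `t + 1` and a geometric sum with ratio `t ^ 2 ≡ 1`
-- mod 4, to which the previous criterion applies. This is the case `t ≡ -1` mod 4 excluded there.
open Finset in
theorem two_pow_dvd_geom_sum_iff {t : ℤ} (h : 4 ∣ t + 1) (n k : ℕ) :
    (2 : ℤ) ^ k ∣ ∑ l ∈ range (2 * n), t ^ l ↔ (2 : ℤ) ^ k ∣ (t + 1) * n := by
  have h4 : (4 : ℤ) ∣ t ^ 2 - 1 := by
    have : t ^ 2 - 1 = (t + 1) * (t - 1) := by ring
    rw [this]; exact h.mul_right _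
  have h2 : ((2 : ℕ) : ℤ) ∣ t ^ 2 - 1 := by
    push_cast; exact dvd_trans (by norm_num) h4
  have hi := pow_dvd_geom_sum_iff Nat.prime_two h2 (fun _ => h4) n
  rw [geom_sum_two_mul]
  have hpi : Prime (2 : ℤ) := Int.prime_two
  have he : emultiplicity (2 : ℤ) (∑ l ∈ range n, (t ^ 2) ^ l) = emultiplicity (2 : ℤ) (n : ℤ) := by
    rw [emultiplicity_eq_emultiplicity_iff]
    intro k
    have := hi k
    push_cast at this
    rw [this]
    exact_mod_cast Iff.rfl
  rw [pow_dvd_iff_le_emultiplicity, pow_dvd_iff_le_emultiplicity, emultiplicity_mul hpi,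
    emultiplicity_mul hpi, he]

-- One direction needs no hypothesis at 2: if `t ≡ -1` mod 4, the even factor `t + 1` makes up for
-- the halving of `n` in the pairing.
open Finset in
theorem pow_dvd_geom_sum {p : ℕ} (hp : p.Prime) {t : ℤ} (h1 : (p : ℤ) ∣ t - 1) {n k : ℕ}
    (hn : p ^ k ∣ n) : (p : ℤ) ^ k ∣ ∑ l ∈ range n, t ^ l := by
  by_cases h2 : p = 2 → 4 ∣ t - 1
  · exact (pow_dvd_geom_sum_iff hp h1 h2 n k).2 hn
  · push Not at h2
    obtain ⟨rfl, h3⟩ := h2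
    rcases k with _ | k
    · simp
    obtain ⟨q, rfl⟩ := hn
    push_cast at h1
    rw [show 2 ^ (k + 1) * q = 2 * (2 ^ k * q) by ring]
    have h4 : (4 : ℤ) ∣ t + 1 := by omega
    refine (two_pow_dvd_geom_sum_iff h4 _ _).2 ?_
    push_cast
    rw [pow_succ, mul_comm ((2 : ℤ) ^ k) 2, ]
    exact mul_dvd_mul (dvd_trans (by norm_num) h4) (dvd_mul_right _ _)

theorem pow_dvd_pow_sub_one {p : ℕ} (hp : p.Prime) {t : ℤ} {k j n : ℕ} (hk : k ≠ 0)
    (h1 : (p : ℤ) ^ k ∣ t - 1) (hn : p ^ j ∣ n) : (p : ℤ) ^ (k + j) ∣ t ^ n - 1 := by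
  rw [← geom_sum_mul, mul_comm, pow_add]
  exact mul_dvd_mul h1 (pow_dvd_geom_sum hp ((dvd_pow_self _ hk).trans h1) hn)

/-! ### Parts of integers at sets of primes -/

theorem eq_of_prime_pow_dvd_iff {a b : ℕ} (h : ∀ p k : ℕ, p.Prime → (p ^ k ∣ a ↔ p ^ k ∣ b)) :
    a = b :=
  Nat.dvd_antisymm ((Nat.dvd_iff_prime_pow_dvd_dvd _ _).2 fun p k hp hd => (h p k hp).1 hd)
    ((Nat.dvd_iff_prime_pow_dvd_dvd _ _).2 fun p k hp hd => (h p k hp).2 hd)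

theorem factorization_piPart {π : Finset ℕ} {m p : ℕ} (hπ : ∀ q ∈ π, q.Prime) :
    (piPart π m).factorization p = if p ∈ π then m.factorization p else 0 := by
  unfold piPart
  rw [Nat.factorization_prod fun q hq => pow_ne_zero _ (hπ q hq).ne_zero, Finsupp.finsetSum_apply]
  have : ∀ q ∈ π, (q ^ m.factorization q).factorization p =
      if p = q then m.factorization q else 0 := by
    intro q hq
    rw [(hπ q hq).factorization_pow, Finsupp.single_apply]
    simp [eq_comm]
  rw [Finset.sum_congr rfl this, Finset.sum_ite_eq]

theorem piPart_ne_zero {π : Finset ℕ} {m : ℕ} (hπ : ∀ q ∈ π, q.Prime) : piPart π m ≠ 0 :=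
  Finset.prod_ne_zero_iff.2 fun q hq => pow_ne_zero _ (hπ q hq).ne_zero

theorem piPart_dvd_iff {π : Finset ℕ} {m x : ℕ} (hπ : ∀ q ∈ π, q.Prime) (hx : x ≠ 0) :
    piPart π m ∣ x ↔ ∀ p ∈ π, m.factorization p ≤ x.factorization p := by
  rw [← Nat.factorization_prime_le_iff_dvd (piPart_ne_zero hπ) hx]
  constructor
  · intro h p hp
    have := h p (hπ p hp)
    rwa [factorization_piPart hπ, if_pos hp] at this
  · intro h p hp
    rw [factorization_piPart hπ]
    split_ifs with h1
    · exact h p h1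
    · exact Nat.zero_le _

theorem dvd_piPart_iff {π : Finset ℕ} {m x : ℕ} (hπ : ∀ q ∈ π, q.Prime) (hx : x ≠ 0) :
    x ∣ piPart π m ↔ ∀ p, p.Prime →
      x.factorization p ≤ if p ∈ π then m.factorization p else 0 := by
  rw [← Nat.factorization_prime_le_iff_dvd hx (piPart_ne_zero hπ)]
  refine forall₂_congr fun p hp => ?_
  rw [factorization_piPart hπ]

theorem piPart_eq_iff {π : Finset ℕ} {m x : ℕ} (hπ : ∀ q ∈ π, q.Prime) :
    piPart π x = piPart π m ↔ ∀ p ∈ π, x.factorization p = m.factorization p := by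
  constructor
  · intro h p hp
    have := congrArg (fun y => y.factorization p) h
    simpa only [factorization_piPart hπ, if_pos hp] using this
  · intro h
    exact Finset.prod_congr rfl fun p hp => by rw [h p hp]

theorem prime_of_mem_nu {m r p : ℕ} (h : p ∈ nu m r) : p.Prime :=
  Nat.prime_of_mem_primeFactors (Finset.mem_sdiff.1 h).1

theorem mem_nu {m r p : ℕ} (hm : m ≠ 0) (hr : r ≠ 0) : p ∈ nu m r ↔ p.Prime ∧ p ∣ m ∧ ¬ p ∣ r := by
  rw [nu, Finset.mem_sdiff, Nat.mem_primeFactors, Nat.mem_primeFactors]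
  tauto

/-! ### The invariants of the cyclic subgroup generated by the class of `t` -/

theorem unitsMap_eq_intCast {m q : ℕ} (h : q ∣ m) {u : (ZMod m)ˣ} {t : ℤ}
    (hu : (u : ZMod m) = t) : ((ZMod.unitsMap h u : (ZMod q)ˣ) : ZMod q) = t := by
  rw [ZMod.unitsMap_def, Units.coe_map, hu]
  simp

theorem unit_eq_one_iff {q : ℕ} {u : (ZMod q)ˣ} {t : ℤ} (hu : (u : ZMod q) = t) :
    u = 1 ↔ (q : ℤ) ∣ t - 1 := by
  rw [← Units.val_inj, hu, Units.val_one, ← ZMod.intCast_zmod_eq_zero_iff_dvd, Int.cast_sub,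
    Int.cast_one, sub_eq_zero]

theorem unit_eq_neg_one_iff {q : ℕ} {u : (ZMod q)ˣ} {t : ℤ} (hu : (u : ZMod q) = t) :
    u = -1 ↔ (q : ℤ) ∣ t + 1 := by
  rw [← Units.val_inj, hu, Units.val_neg, Units.val_one, ← ZMod.intCast_zmod_eq_zero_iff_dvd,
    Int.cast_add, Int.cast_one, eq_neg_iff_add_eq_zero]

theorem mem_zpowers_neg_one {R : Type*} [Ring R] {u : Rˣ} :
    u ∈ Subgroup.zpowers (-1 : Rˣ) ↔ u = 1 ∨ u = -1 := by
  rw [Subgroup.mem_zpowers_iff]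
  constructor
  · rintro ⟨k, rfl⟩
    rcases Int.even_or_odd k with h | h
    · exact Or.inl h.neg_one_zpow
    · exact Or.inr h.neg_one_zpow
  · rintro (rfl | rfl)
    · exact ⟨0, by simp⟩
    · exact ⟨1, by simp⟩

theorem res_zpowers {m q : ℕ} (h : q ∣ m) (u : (ZMod m)ˣ) :
    Res h (Subgroup.zpowers u) = Subgroup.zpowers (ZMod.unitsMap h u) :=
  MonoidHom.map_zpowers _ _

theorem res_zpowers_eq_bot {m q : ℕ} (h : q ∣ m) {u : (ZMod m)ˣ} {t : ℤ}
    (hu : (u : ZMod m) = t) : Res h (Subgroup.zpowers u) = ⊥ ↔ (q : ℤ) ∣ t - 1 := by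
  rw [res_zpowers, Subgroup.zpowers_eq_bot, unit_eq_one_iff (unitsMap_eq_intCast h hu)]

theorem rCond_zpowers_iff {m d : ℕ} {u : (ZMod m)ˣ} {t : ℤ} (hu : (u : ZMod m) = t) :
    RCond (Subgroup.zpowers u) d ↔ d ∣ m ∧ ((ordCompl[2] d : ℕ) : ℤ) ∣ t - 1 ∧
      (((ordProj[2] d : ℕ) : ℤ) ∣ t - 1 ∨ ((ordProj[2] d : ℕ) : ℤ) ∣ t + 1) := by
  have key : ∀ hd : d ∣ m, (Res ((Nat.ordProj_dvd d 2).trans hd) (Subgroup.zpowers u) ≤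
      Subgroup.zpowers (-1) ↔
      (((ordProj[2] d : ℕ) : ℤ) ∣ t - 1 ∨ ((ordProj[2] d : ℕ) : ℤ) ∣ t + 1)) := by
    intro hd
    have h1 := unitsMap_eq_intCast ((Nat.ordProj_dvd d 2).trans hd) hu
    rw [res_zpowers, Subgroup.zpowers_le, mem_zpowers_neg_one, unit_eq_one_iff h1,
      unit_eq_neg_one_iff h1]
  constructor
  · rintro ⟨hd, h1, h2⟩
    exact ⟨hd, (res_zpowers_eq_bot _ hu).1 h1, (key hd).1 h2⟩
  · rintro ⟨hd, h1, h2⟩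
    exact ⟨hd, (res_zpowers_eq_bot _ hu).2 h1, (key hd).2 h2⟩

theorem int_dvd_iff_prime_pow_dvd {d : ℕ} {x : ℤ} :
    (d : ℤ) ∣ x ↔ ∀ p k : ℕ, p.Prime → p ^ k ∣ d → (p : ℤ) ^ k ∣ x := by
  rw [Int.natCast_dvd, Nat.dvd_iff_prime_pow_dvd_dvd]
  simp only [← Int.natCast_dvd, Nat.cast_pow]

/-- The condition on prime powers that describes the first entry of `inv ⟨t⟩`. -/
def PowCond (t : ℤ) (p k : ℕ) : Prop := (p : ℤ) ^ k ∣ t - 1 ∨ p = 2 ∧ (p : ℤ) ^ k ∣ t + 1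

theorem rCond_zpowers_iff_powCond {m d : ℕ} (hm : m ≠ 0) {u : (ZMod m)ˣ} {t : ℤ}
    (hu : (u : ZMod m) = t) :
    RCond (Subgroup.zpowers u) d ↔ d ∣ m ∧ ∀ p k : ℕ, p.Prime → p ^ k ∣ d → PowCond t p k := by
  rw [rCond_zpowers_iff hu]
  refine and_congr_right fun hd => ?_
  have hd0 : d ≠ 0 := ne_zero_of_dvd_ne_zero hm hd
  have hpow : ∀ {p k : ℕ}, p.Prime → p ≠ 2 → (p ^ k ∣ ordCompl[2] d ↔ p ^ k ∣ d) := by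
    intro p k hp h2
    rw [hp.pow_dvd_iff_le_factorization hd0,
      hp.pow_dvd_iff_le_factorization (Nat.ordCompl_pos 2 hd0).ne', Nat.factorization_ordCompl,
      Finsupp.erase_ne h2]
  constructor
  · rintro ⟨h1, h2⟩ p k hp hk
    by_cases hp2 : p = 2
    · subst hp2
      have h3 : 2 ^ k ∣ ordProj[2] d :=
        pow_dvd_pow 2 ((hp.pow_dvd_iff_le_factorization hd0).1 hk)
      have h4 : ((2 : ℕ) : ℤ) ^ k ∣ ((ordProj[2] d : ℕ) : ℤ) := by exact_mod_cast h3
      rcases h2 with h | h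
      · exact Or.inl (h4.trans h)
      · exact Or.inr ⟨rfl, h4.trans h⟩
    · left
      exact int_dvd_iff_prime_pow_dvd.1 h1 p k hp ((hpow hp hp2).2 hk)
  · intro h
    refine ⟨?_, ?_⟩
    · refine int_dvd_iff_prime_pow_dvd.2 fun p k hp hk => ?_
      by_cases hp2 : p = 2
      · subst hp2
        rcases eq_or_ne k 0 with rfl | hk0
        · simp
        · exact absurd ((dvd_pow_self 2 hk0).trans hk) (Nat.not_dvd_ordCompl hp hd0)
      · rcases h p k hp ((hpow hp hp2).1 hk) with h | h
        · exact h
        · exact absurd h.1 hp2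
    · rcases h 2 (d.factorization 2) Nat.prime_two (Nat.ordProj_dvd d 2) with h | h
      · left; exact_mod_cast h
      · right; exact_mod_cast h.2

theorem prime_pow_dvd_lcm {a b p k : ℕ} (hp : p.Prime) (h : p ^ k ∣ Nat.lcm a b) :
    p ^ k ∣ a ∨ p ^ k ∣ b := by
  rcases eq_or_ne a 0 with rfl | ha
  · exact Or.inl (dvd_zero _)
  rcases eq_or_ne b 0 with rfl | hb
  · exact Or.inr (dvd_zero _)
  rw [hp.pow_dvd_iff_le_factorization (Nat.lcm_ne_zero ha hb), Nat.factorization_lcm ha hb,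
    Finsupp.sup_apply, le_sup_iff] at h
  rwa [hp.pow_dvd_iff_le_factorization ha, hp.pow_dvd_iff_le_factorization hb]

theorem rInv_ne_zero {m : ℕ} (hm : m ≠ 0) (T : Subgroup (ZMod m)ˣ) : rInv T ≠ 0 :=
  ne_zero_of_dvd_ne_zero hm (rInv_dvd T)

/-- A prime power dividing an lcm divides one of the two numbers, so the condition defining `r` is
closed under lcm. The numerically greatest divisor is therefore greatest for divisibility, and can
be read off one prime at a time. -/
theorem prime_pow_dvd_rInv_iff {m : ℕ} (hm : m ≠ 0) {u : (ZMod m)ˣ} {t : ℤ}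
    (hu : (u : ZMod m) = t) {p : ℕ} (hp : p.Prime) (k : ℕ) :
    p ^ k ∣ rInv (Subgroup.zpowers u) ↔ p ^ k ∣ m ∧ PowCond t p k := by
  classical
  set r := rInv (Subgroup.zpowers u) with hr
  have hr0 : r ≠ 0 := rInv_ne_zero hm _
  have hc := (rCond_zpowers_iff_powCond hm hu).1 (rCond_rInv (Subgroup.zpowers u) hm)
  constructor
  · intro h
    exact ⟨h.trans hc.1, hc.2 p k hp h⟩
  · rintro ⟨h1, h2⟩
    have hl : RCond (Subgroup.zpowers u) (Nat.lcm r (p ^ k)) := by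
      refine (rCond_zpowers_iff_powCond hm hu).2 ⟨Nat.lcm_dvd hc.1 h1, fun q j hq hj => ?_⟩
      rcases prime_pow_dvd_lcm hq hj with h | h
      · exact hc.2 q j hq h
      · rcases eq_or_ne j 0 with rfl | hj0
        · left; simp
        have : q = p := (Nat.prime_dvd_prime_iff_eq hq hp).1
          (hq.dvd_of_dvd_pow ((dvd_pow_self q hj0).trans h))
        subst this
        have h3 : (q : ℤ) ^ j ∣ (q : ℤ) ^ k :=
          pow_dvd_pow _ ((Nat.pow_dvd_pow_iff_le_right hq.one_lt).1 h)
        exact h2.imp (fun h => h3.trans h) fun h => ⟨h.1, h3.trans h.2⟩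
    have hle : Nat.lcm r (p ^ k) ≤ r :=
      Nat.le_findGreatest (P := RCond (Subgroup.zpowers u))
        (Nat.le_of_dvd (Nat.pos_of_ne_zero hm) (Nat.lcm_dvd hc.1 h1)) hl
    have heq : Nat.lcm r (p ^ k) = r :=
      le_antisymm hle (Nat.le_of_dvd (Nat.lcm_pos (Nat.pos_of_ne_zero hr0) (pow_pos hp.pos _))
        (Nat.dvd_lcm_left _ _))
    rw [← heq]
    exact Nat.dvd_lcm_right _ _

theorem not_dvd_of_isCoprime {m p : ℕ} {t : ℤ} (hp : p.Prime) (ht : IsCoprime t m) (h : p ∣ m) :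
    ¬ (p : ℤ) ∣ t := fun h1 =>
  (Nat.prime_iff_prime_int.1 hp).not_isUnit (ht.isUnit_of_dvd' h1 (by exact_mod_cast h))

theorem odd_of_isCoprime {m : ℕ} {t : ℤ} (ht : IsCoprime t m) (h : 2 ∣ m) : ¬ (2 : ℤ) ∣ t := by
  exact_mod_cast not_dvd_of_isCoprime Nat.prime_two ht h

theorem four_dvd_rInv {m : ℕ} (hm : m ≠ 0) {u : (ZMod m)ˣ} {t : ℤ} (hu : (u : ZMod m) = t)
    (ht : IsCoprime t m) (h4 : 4 ∣ m) : 4 ∣ rInv (Subgroup.zpowers u) := by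
  have h2 := odd_of_isCoprime ht (dvd_trans (by norm_num) h4)
  have := prime_pow_dvd_rInv_iff hm hu Nat.prime_two 2
  refine this.2 ⟨h4, ?_⟩
  unfold PowCond
  norm_num
  omega

/-- No power of 2 beyond 2 itself divides both `t - 1` and `t + 1`, and `4 ∣ m` forces `4 ∣ r`; so
the sign is decided modulo 4. -/
theorem epsInv_zpowers_eq_neg_one_iff {m : ℕ} (hm : m ≠ 0) {u : (ZMod m)ˣ} {t : ℤ}
    (hu : (u : ZMod m) = t) (ht : IsCoprime t m) :
    epsInv (Subgroup.zpowers u) = -1 ↔ 4 ∣ m ∧ (4 : ℤ) ∣ t + 1 := by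
  set r := rInv (Subgroup.zpowers u) with hr
  have h1 : epsInv (Subgroup.zpowers u) = -1 ↔ ¬ ((ordProj[2] r : ℕ) : ℤ) ∣ t - 1 := by
    unfold epsInv
    have h2 := res_zpowers_eq_bot ((Nat.ordProj_dvd r 2).trans (rInv_dvd (Subgroup.zpowers u))) hu
    rw [← h2]
    split_ifs with h <;> simpa using h
  have hr0 : r ≠ 0 := rInv_ne_zero hm _
  have hspec := prime_pow_dvd_rInv_iff hm hu Nat.prime_two
  rw [h1]
  constructor
  · intro h
    have h3 := ((hspec (r.factorization 2)).1 (Nat.ordProj_dvd r 2))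
    have h4 : ((2 : ℕ) : ℤ) ^ (r.factorization 2) ∣ t + 1 := by
      rcases h3.2 with h4 | h4
      · exact absurd (by exact_mod_cast h4) h
      · exact h4.2
    have h5 : 2 ≤ r.factorization 2 := by
      by_contra! h5
      have h6 : 2 ^ r.factorization 2 ∣ 2 := by
        simpa using pow_dvd_pow 2 (Nat.lt_succ_iff.1 h5)
      refine h ?_
      rw [show t - 1 = t + 1 - 2 by ring]
      exact dvd_sub (by exact_mod_cast h4) (by exact_mod_cast h6)
    have h6 : 2 ^ 2 ∣ 2 ^ r.factorization 2 := pow_dvd_pow 2 h5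
    refine ⟨dvd_trans h6 h3.1, ?_⟩
    exact dvd_trans (by exact_mod_cast h6) h4
  · rintro ⟨h4, ht4⟩ h
    have h5 : 2 ^ 2 ∣ 2 ^ r.factorization 2 :=
      pow_dvd_pow 2 ((Nat.prime_two.pow_dvd_iff_le_factorization hr0).1
        (four_dvd_rInv hm hu ht h4))
    have h6 : (4 : ℤ) ∣ t - 1 := dvd_trans (by exact_mod_cast h5) h
    omega

theorem hallCompl_zpowers {A : Type*} [CommGroup A] [Finite A] (u : A) {ν : Finset ℕ}
    (hν : ∀ p ∈ ν, p.Prime) :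
    hallCompl (Subgroup.zpowers u) ν = Subgroup.zpowers (u ^ piPart ν (orderOf u)) := by
  set N := orderOf u with hN
  have hN0 : N ≠ 0 := (orderOf_pos u).ne'
  set e := piPart ν N with he
  obtain ⟨f, hf⟩ := piPart_dvd ν N
  rw [← he] at hf
  have he0 : e ≠ 0 := piPart_ne_zero hν
  ext x
  constructor
  · rintro ⟨hx, hc⟩
    obtain ⟨j, rfl⟩ := Subgroup.mem_zpowers_iff.1 hx
    have hcop : (orderOf (u ^ j)).Coprime e :=
      Nat.Coprime.prod_right fun p hp => Nat.Coprime.pow_right _ (hc p hp)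
    -- Bézout: the order of `u ^ j` is coprime to `e`, so `u ^ j` is a power of its own `e`-th
    -- power.
    have h1 := Int.gcd_eq_gcd_ab (orderOf (u ^ j)) e
    rw [Int.gcd_natCast_natCast, hcop, Nat.cast_one] at h1
    refine Subgroup.mem_zpowers_iff.2 ⟨j * Int.gcdB (orderOf (u ^ j)) e, ?_⟩
    have h2 : (u ^ j) ^ ((orderOf (u ^ j) : ℤ) * Int.gcdA (orderOf (u ^ j)) e) = 1 := by
      rw [zpow_mul, zpow_natCast, pow_orderOf_eq_one, one_zpow]
    calc (u ^ e) ^ (j * Int.gcdB (orderOf (u ^ j)) e)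
        = (u ^ j) ^ ((e : ℤ) * Int.gcdB (orderOf (u ^ j)) e) := by
          rw [← zpow_natCast, ← zpow_mul, ← zpow_mul]; congr 1; ring
      _ = (u ^ j) ^ (1 : ℤ) := by rw [h1, zpow_add, h2, one_mul]
      _ = u ^ j := zpow_one _
  · intro hx
    refine ⟨?_, fun p hp => ?_⟩
    · exact (Subgroup.zpowers_le.2 (Subgroup.pow_mem _ (Subgroup.mem_zpowers u) e)) hx
    · have hp' := hν p hp
      have h1 : orderOf x ∣ f := by
        have : orderOf (u ^ e) ∣ f := by
          refine orderOf_dvd_of_pow_eq_one ?_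
          rw [← pow_mul, ← hf, hN, pow_orderOf_eq_one]
        exact (orderOf_dvd_of_mem_zpowers hx).trans this
      refine Nat.Coprime.coprime_dvd_left h1 ?_
      rw [Nat.coprime_comm, hp'.coprime_iff_not_dvd]
      intro h2
      have h3 : N.factorization p = e.factorization p + f.factorization p := by
        rw [hf, Nat.factorization_mul he0 (right_ne_zero_of_mul (hf ▸ hN0)), Finsupp.add_apply]
      have h4 : e.factorization p = N.factorization p := by
        rw [he, factorization_piPart hν, if_pos hp]
      have h5 := hp'.factorization_pos_of_dvd (right_ne_zero_of_mul (hf ▸ hN0)) h2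
      omega

/-- Here `k` is the order of `t` modulo `m_ν`, and `o` is its `ν'`-part. These properties determine
`o`, so later arguments never return to Hall subgroups. -/
theorem oInv_zpowers_spec {m : ℕ} (hm : m ≠ 0) {u : (ZMod m)ˣ} {t : ℤ} (hu : (u : ZMod m) = t)
    {ν : Finset ℕ} (hν : nu m (rInv (Subgroup.zpowers u)) = ν) :
    oInv (Subgroup.zpowers u) ≠ 0 ∧ ∃ k : ℕ, k ≠ 0 ∧
      (∀ j : ℕ, (piPart ν m : ℤ) ∣ t ^ j - 1 ↔ k ∣ j) ∧
      ∀ p,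
        (oInv (Subgroup.zpowers u)).factorization p = if p ∈ ν then 0 else k.factorization p := by
  have : NeZero m := ⟨hm⟩
  subst hν
  set ν := nu m (rInv (Subgroup.zpowers u)) with hν
  have hνp : ∀ p ∈ ν, p.Prime := fun p hp => prime_of_mem_nu hp
  have hM : NeZero (piPart ν m) := ⟨piPart_ne_zero hνp⟩
  set w := ZMod.unitsMap (piPart_dvd ν m) u with hw
  have hwt : (w : ZMod (piPart ν m)) = t := unitsMap_eq_intCast _ hu
  set k := orderOf w with hk
  have hk0 : k ≠ 0 := (orderOf_pos w).ne'
  set e := piPart ν (orderOf u) with he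
  have he0 : e ≠ 0 := piPart_ne_zero hνp
  have ho : oInv (Subgroup.zpowers u) = k / Nat.gcd k e := by
    change Nat.card (Res (piPart_dvd ν m) (hallCompl (Subgroup.zpowers u) ν)) = _
    rw [hallCompl_zpowers u hνp, res_zpowers, Nat.card_zpowers, map_pow, orderOf_pow]
  have hg0 : Nat.gcd k e ≠ 0 := Nat.gcd_ne_zero_left hk0
  refine ⟨?_, k, hk0, fun j => ?_, fun p => ?_⟩
  · rw [ho]
    exact (Nat.div_pos (Nat.le_of_dvd (Nat.pos_of_ne_zero hk0) (Nat.gcd_dvd_left _ _))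
      (Nat.pos_of_ne_zero hg0)).ne'
  · rw [hk, orderOf_dvd_iff_pow_eq_one]
    refine (unit_eq_one_iff ?_).symm
    rw [Units.val_pow_eq_pow_val, hwt, Int.cast_pow]
  · rw [ho, Nat.factorization_div (Nat.gcd_dvd_left _ _), Nat.factorization_gcd hk0 he0,
      Finsupp.tsub_apply, Finsupp.inf_apply, he, factorization_piPart hνp]
    split_ifs with h
    -- At `p ∈ ν` the exponent `e` contains the whole `p`-part of the order of `u`, hence that of
    -- `k`.
    · have h1 : k ∣ orderOf u := orderOf_map_dvd _ u
      have h2 := (Nat.factorization_le_iff_dvd hk0 (orderOf_pos u).ne').2 h1 p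
      rw [inf_of_le_left h2, Nat.sub_self]
    · simp

/-- The invariant `r` is seen modulo `r`, the sign modulo 4 (and `4 ∣ m` gives `4 ∣ r`), and `o`
modulo `m_ν`. All this survives reduction modulo a common multiple of `r` and `m_ν`. -/
theorem inv_res_eq {m q : ℕ} (hm : m ≠ 0) (h : q ∣ m) {u : (ZMod m)ˣ} {t : ℤ}
    (hu : (u : ZMod m) = t) (ht : IsCoprime t m) (hr : rInv (Subgroup.zpowers u) ∣ q)
    (hν : piPart (nu m (rInv (Subgroup.zpowers u))) m ∣ q) :
    inv (Res h (Subgroup.zpowers u)) = inv (Subgroup.zpowers u) := by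
  have hq0 : q ≠ 0 := ne_zero_of_dvd_ne_zero hm h
  rw [res_zpowers]
  set w := ZMod.unitsMap h u with hw
  have hwt : (w : ZMod q) = t := unitsMap_eq_intCast h hu
  have htq : IsCoprime t q := ht.of_isCoprime_of_dvd_right (by exact_mod_cast h)
  have e1 : rInv (Subgroup.zpowers w) = rInv (Subgroup.zpowers u) := by
    refine eq_of_prime_pow_dvd_iff fun p k hp => ?_
    rw [prime_pow_dvd_rInv_iff hq0 hwt hp]
    constructor
    · rintro ⟨h1, h2⟩
      exact (prime_pow_dvd_rInv_iff hm hu hp k).2 ⟨h1.trans h, h2⟩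
    · intro h1
      exact ⟨h1.trans hr, ((prime_pow_dvd_rInv_iff hm hu hp k).1 h1).2⟩
  have e2 : epsInv (Subgroup.zpowers w) = epsInv (Subgroup.zpowers u) := by
    have h1 : epsInv (Subgroup.zpowers w) = -1 ↔ epsInv (Subgroup.zpowers u) = -1 := by
      rw [epsInv_zpowers_eq_neg_one_iff hq0 hwt htq, epsInv_zpowers_eq_neg_one_iff hm hu ht]
      exact ⟨fun h1 => ⟨h1.1.trans h, h1.2⟩,
        fun h1 => ⟨(four_dvd_rInv hm hu ht h1.1).trans hr, h1.2⟩⟩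
    rcases epsInv_eq (Subgroup.zpowers w) with h2 | h2 <;>
      rcases epsInv_eq (Subgroup.zpowers u) with h3 | h3 <;> simp_all
  have hr0 := rInv_ne_zero hm (Subgroup.zpowers u)
  set ν := nu m (rInv (Subgroup.zpowers u)) with hνd
  have hνp : ∀ p ∈ ν, p.Prime := fun p hp => prime_of_mem_nu hp
  have eν : nu q (rInv (Subgroup.zpowers w)) = ν := by
    ext p
    rw [e1, mem_nu hq0 hr0, hνd, mem_nu hm hr0]
    constructor
    · rintro ⟨h1, h2, h3⟩
      exact ⟨h1, h2.trans h, h3⟩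
    · intro h1
      refine ⟨h1.1, ?_, h1.2.2⟩
      have hmem : p ∈ ν := (mem_nu hm hr0).2 h1
      exact ((Nat.dvd_ordProj_of_dvd hm h1.1 h1.2.1).trans
        (Finset.dvd_prod_of_mem (fun p => ordProj[p] m) hmem)).trans hν
  have eM : piPart ν q = piPart ν m := by
    refine (piPart_eq_iff hνp).2 fun p hp => le_antisymm ?_ ?_
    · exact (Nat.factorization_le_iff_dvd hq0 hm).2 h p
    · exact (piPart_dvd_iff hνp hq0).1 hν p hp
  have e3 : oInv (Subgroup.zpowers w) = oInv (Subgroup.zpowers u) := by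
    obtain ⟨ho1, k1, hk1, hj1, hf1⟩ := oInv_zpowers_spec hq0 hwt eν
    obtain ⟨ho2, k2, hk2, hj2, hf2⟩ := oInv_zpowers_spec hm hu hνd.symm
    have hk : k1 = k2 := by
      refine Nat.dvd_antisymm ?_ ?_
      · rw [← hj1, eM, hj2]
      · rw [← hj2, ← eM, hj1]
    refine Nat.eq_of_factorization_eq ho1 ho2 fun p => ?_
    rw [hf1, hf2, hk]
  unfold inv
  rw [e1, e2, e3]

theorem ordProj_dvd_mPrimePart {m n s r : ℕ} {ε : ℤ} {o p : ℕ} (hε : ε = 1 ∨ ε = -1)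
    (hp : p.Prime) (hr : r ∣ m) (hm : m ≠ 0) : ordProj[p] r ∣ mPrimePart m n s r ε o p := by
  obtain ⟨k, -, hk⟩ := (Nat.dvd_prime_pow hp).1
    (mPrimePart_dvd (n := n) (s := s) (o := o) hε hp hr hm)
  have hle : ordProj[p] r ≤ mPrimePart m n s r ε o p := by
    have hrm : ∀ q, ordProj[q] r ≤ ordProj[q] m := fun q =>
      Nat.le_of_dvd (Nat.ordProj_pos m q) (Nat.ordProj_dvd_ordProj_of_dvd hm hr q)
    unfold mPrimePart
    split_ifs with h1 h2 h3
    · refine le_min (hrm p) (le_min ?_ (le_max_left _ _))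
      exact Nat.le_mul_of_pos_left _ (Nat.ordProj_pos o p)
    all_goals
      have hp2 : p = 2 := by
        by_contra hne
        rcases hε with rfl | rfl
        · exact h1 (one_pow _)
        · exact h1 ((hp.even_sub_one hne).neg_one_pow)
      subst hp2
    · exact le_rfl
    · rw [Nat.le_div_iff_mul_le two_pos]
      push Not at h2
      omega
    · exact hrm 2
  rw [hk] at hle ⊢
  exact pow_dvd_pow p ((Nat.pow_le_pow_iff_right hp.one_lt).1 hle)

/-- Each case in the definition of `m'_p` gives a multiple of `r_p`, so `r` and `m_ν` divide `[T, n,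
s]`. Beyond this, the shape of `[T, n, s]` has no influence on `IN(G)`. -/
theorem inv_res_modulus {m : ℕ} (hm : m ≠ 0) {u : (ZMod m)ˣ} {t : ℤ} (hu : (u : ZMod m) = t)
    (ht : IsCoprime t m) (n s : ℕ) :
    inv (Res (modulus_dvd (Subgroup.zpowers u) n s) (Subgroup.zpowers u)) =
      inv (Subgroup.zpowers u) := by
  refine inv_res_eq hm _ hu ht ?_ (dvd_mul_right _ _)
  refine Dvd.dvd.mul_left ?_ _
  have hr0 := rInv_ne_zero hm (Subgroup.zpowers u)
  conv_lhs => rw [← Nat.prod_factorization_pow_eq_self hr0]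
  exact Finset.prod_dvd_prod_of_dvd _ _ fun p hp => ordProj_dvd_mPrimePart (epsInv_eq _)
    (Nat.prime_of_mem_primeFactors hp) (rInv_dvd _) hm

/-! ### Generators of a factorization and the derived subgroup -/

open scoped commutatorElement

/-- Generators `a`, `b` of the factors `A`, `B` of a metacyclic factorization, and an exponent `t`
that describes the action of `b` on `A`. -/
structure Gen {G : Type*} [Group G] (F : Factorization G) where
  a : G
  b : G
  t : ℤ
  hA : F.A = Subgroup.zpowers a
  hB : F.B = Subgroup.zpowers b
  conj : b * a * b⁻¹ = a ^ t

theorem zpow_eq_zpow_iff_dvd {G : Type*} [Group G] (a : G) (i j : ℤ) :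
    a ^ i = a ^ j ↔ (orderOf a : ℤ) ∣ i - j := by
  rw [orderOf_dvd_iff_zpow_eq_one, zpow_sub, mul_inv_eq_one]

theorem orderOf_zpow_mul_gcd {G : Type*} [Group G] [Finite G] (a : G) (z : ℤ) :
    orderOf (a ^ z) * Int.gcd z (orderOf a) = orderOf a := by
  have h : orderOf (a ^ z) = orderOf (a ^ z.natAbs) := by
    rcases Int.natAbs_eq z with h | h
    · conv_lhs => rw [h, zpow_natCast]
    · conv_lhs => rw [h, zpow_neg, zpow_natCast, orderOf_inv]
  rw [h, orderOf_pow, Int.gcd, Int.natAbs_natCast, Nat.gcd_comm z.natAbs]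
  exact Nat.div_mul_cancel (Nat.gcd_dvd_left _ _)

namespace Factorization

variable {G : Type*} [Group G] (F : Factorization G)

theorem exists_gen : Nonempty (Gen F) := by
  obtain ⟨⟨a, ha⟩, ha'⟩ := F.cyclicA.exists_generator
  obtain ⟨⟨b, hb⟩, hb'⟩ := F.cyclicB.exists_generator
  have hA : F.A = Subgroup.zpowers a := by
    refine le_antisymm (fun x hx => ?_) (Subgroup.zpowers_le.2 ha)
    obtain ⟨k, hk⟩ := Subgroup.mem_zpowers_iff.1 (ha' ⟨x, hx⟩)
    exact Subgroup.mem_zpowers_iff.2 ⟨k, by simpa using congrArg Subtype.val hk⟩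
  have hB : F.B = Subgroup.zpowers b := by
    refine le_antisymm (fun x hx => ?_) (Subgroup.zpowers_le.2 hb)
    obtain ⟨k, hk⟩ := Subgroup.mem_zpowers_iff.1 (hb' ⟨x, hx⟩)
    exact Subgroup.mem_zpowers_iff.2 ⟨k, by simpa using congrArg Subtype.val hk⟩
  have h1 : b * a * b⁻¹ ∈ F.A := F.normal.conj_mem a ha b
  rw [hA] at h1
  obtain ⟨t, ht⟩ := Subgroup.mem_zpowers_iff.1 h1
  exact ⟨⟨a, b, t, hA, hB, ht.symm⟩⟩

theorem m_mul_n : F.m * F.n = Nat.card G := Subgroup.card_mul_index _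

variable [Finite G]

theorem m_ne_zero : F.m ≠ 0 := Nat.card_pos.ne'

theorem n_ne_zero : F.n ≠ 0 := Subgroup.index_ne_zero_of_finite

theorem s_ne_zero : F.s ≠ 0 := Subgroup.index_ne_zero_of_finite

end Factorization

namespace Gen

variable {G : Type*} [Group G] {F : Factorization G} (g : Gen F)

theorem orderOf_a : orderOf g.a = F.m := by
  rw [Factorization.m, g.hA, Nat.card_zpowers]

theorem zpow_eq_one_iff (i : ℤ) : g.a ^ i = 1 ↔ (F.m : ℤ) ∣ i := by
  rw [← g.orderOf_a, orderOf_dvd_iff_zpow_eq_one]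

theorem zpow_eq_iff (i j : ℤ) : g.a ^ i = g.a ^ j ↔ (F.m : ℤ) ∣ i - j := by
  rw [← g.orderOf_a, zpow_eq_zpow_iff_dvd]

theorem mem_A (x : G) : x ∈ F.A ↔ ∃ i : ℤ, g.a ^ i = x := by
  rw [g.hA, Subgroup.mem_zpowers_iff]

theorem a_mem : g.a ∈ F.A := by rw [g.hA]; exact Subgroup.mem_zpowers _

theorem conj_zpow (i : ℤ) : g.b * g.a ^ i * g.b⁻¹ = g.a ^ (i * g.t) := by
  rw [← _root_.conj_zpow, g.conj, ← zpow_mul, mul_comm]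

theorem pow_conj_zpow (j : ℕ) (i : ℤ) :
    g.b ^ j * g.a ^ i * (g.b ^ j)⁻¹ = g.a ^ (i * g.t ^ j) := by
  induction j generalizing i with
  | zero => simp
  | succ j ih =>
    rw [pow_succ' g.b, mul_inv_rev]
    calc g.b * g.b ^ j * g.a ^ i * ((g.b ^ j)⁻¹ * g.b⁻¹)
        = g.b * (g.b ^ j * g.a ^ i * (g.b ^ j)⁻¹) * g.b⁻¹ := by group
      _ = g.a ^ (i * g.t ^ (j + 1)) := by rw [ih, g.conj_zpow, pow_succ, mul_assoc]

theorem pow_mul_zpow (j : ℕ) (i : ℤ) : g.b ^ j * g.a ^ i = g.a ^ (i * g.t ^ j) * g.b ^ j := by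
  rw [← pow_conj_zpow]; group

/-- An element `a ^ i * b ^ j` acts on `A` as `b ^ j`. -/
theorem conj_mem {x : G} (hx : x ∈ F.A) (i : ℤ) (j : ℕ) :
    (g.a ^ i * g.b ^ j) * x * (g.a ^ i * g.b ^ j)⁻¹ = x ^ (g.t ^ j) := by
  obtain ⟨k, rfl⟩ := (g.mem_A x).1 hx
  rw [mul_inv_rev]
  calc g.a ^ i * g.b ^ j * g.a ^ k * ((g.b ^ j)⁻¹ * (g.a ^ i)⁻¹)
      = g.a ^ i * (g.b ^ j * g.a ^ k * (g.b ^ j)⁻¹) * (g.a ^ i)⁻¹ := by group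
    _ = _ := by rw [g.pow_conj_zpow, ← zpow_mul]; group

/-- The powers of `a ^ i * b ^ j`. -/
theorem mul_pow (i : ℤ) (j n : ℕ) : (g.a ^ i * g.b ^ j) ^ n =
    g.a ^ (i * ∑ l ∈ Finset.range n, (g.t ^ j) ^ l) * g.b ^ (j * n) := by
  induction n with
  | zero => simp
  | succ n ih =>
    rw [pow_succ, ih, Finset.sum_range_succ]
    calc g.a ^ (i * ∑ l ∈ Finset.range n, (g.t ^ j) ^ l) * g.b ^ (j * n) * (g.a ^ i * g.b ^ j)
        = g.a ^ (i * ∑ l ∈ Finset.range n, (g.t ^ j) ^ l) *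
          (g.b ^ (j * n) * g.a ^ i) * g.b ^ j := by
          group
      _ = _ := by
          rw [g.pow_mul_zpow, ← mul_assoc, ← zpow_add, mul_assoc, ← pow_add, pow_mul]
          congr 2
          ring

theorem orderOf_b_mul_s : orderOf g.b * F.s = F.m * F.n := by
  rw [← Nat.card_zpowers, ← g.hB, F.m_mul_n]
  exact Subgroup.card_mul_index _

theorem pow_dvd_gcd_iff {p k : ℕ} :
    p ^ k ∣ Int.gcd (g.t - 1) F.m ↔ p ^ k ∣ F.m ∧ (p : ℤ) ^ k ∣ g.t - 1 := by
  rw [Int.dvd_gcd_iff, and_comm]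
  norm_cast

theorem s_dvd_c {c : ℤ} (hc : Int.gcd c F.m = F.s) : (F.s : ℤ) ∣ c := by
  rw [← hc]; exact Int.gcd_dvd_left _ _

theorem zpow_mem_zpowers_of_gcd_dvd (g : Gen F) {Y z : ℤ} (h : (Int.gcd Y F.m : ℤ) ∣ z) :
    g.a ^ z ∈ Subgroup.zpowers (g.a ^ Y) := by
  obtain ⟨w, rfl⟩ := h
  rw [zpow_mul]
  refine Subgroup.zpow_mem _ ?_ w
  have h1 : g.a ^ (F.m : ℤ) = 1 := (g.zpow_eq_one_iff _).2 dvd_rfl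
  rw [Int.gcd_eq_gcd_ab, zpow_add, zpow_mul, zpow_mul, h1, one_zpow, mul_one]
  exact Subgroup.zpow_mem _ (Subgroup.mem_zpowers _) _

variable [Finite G]

theorem exists_eq (x : G) : ∃ (i : ℤ) (j : ℕ), x = g.a ^ i * g.b ^ j := by
  obtain ⟨y, hy, z, hz, rfl⟩ := F.eq_mul x
  obtain ⟨i, rfl⟩ := (g.mem_A y).1 hy
  rw [g.hB, ← mem_powers_iff_mem_zpowers] at hz
  obtain ⟨j, rfl⟩ := hz
  exact ⟨i, j, rfl⟩

theorem normal_of_le (g : Gen F) {H : Subgroup G} (h : H ≤ F.A) : H.Normal := by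
  refine ⟨fun x hx y => ?_⟩
  obtain ⟨i, j, rfl⟩ := g.exists_eq y
  rw [g.conj_mem (h hx)]
  exact H.zpow_mem hx _

theorem mk_b_zpowers_eq_top : haveI := F.normal
    Subgroup.zpowers (g.b : G ⧸ F.A) = ⊤ := by
  have := F.normal
  refine eq_top_iff.2 fun x _ => ?_
  obtain ⟨y, rfl⟩ := QuotientGroup.mk_surjective x
  obtain ⟨i, j, rfl⟩ := g.exists_eq y
  rw [QuotientGroup.mk_mul, (QuotientGroup.eq_one_iff _).2 ((g.mem_A _).2 ⟨i, rfl⟩), one_mul]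
  exact ⟨j, by simp⟩

theorem orderOf_mk_b : haveI := F.normal
    orderOf (g.b : G ⧸ F.A) = F.n := by
  have := F.normal
  rw [← Nat.card_zpowers, g.mk_b_zpowers_eq_top, Subgroup.card_top]
  rfl

theorem zpow_b_mem_iff (j : ℤ) : g.b ^ j ∈ F.A ↔ (F.n : ℤ) ∣ j := by
  have := F.normal
  rw [← g.orderOf_mk_b, orderOf_dvd_iff_zpow_eq_one, ← QuotientGroup.mk_zpow,
    QuotientGroup.eq_one_iff]

theorem pow_b_mem_iff (j : ℕ) : g.b ^ j ∈ F.A ↔ F.n ∣ j := by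
  rw [← zpow_natCast, g.zpow_b_mem_iff, Int.natCast_dvd_natCast]

theorem isCoprime_t : IsCoprime g.t (F.m : ℤ) := by
  have h : orderOf (g.a ^ g.t) = orderOf g.a := by
    rw [← g.conj]
    exact orderOf_injective (MulAut.conj g.b).toMonoidHom (MulAut.conj g.b).injective g.a
  have h1 := orderOf_zpow_mul_gcd g.a g.t
  rw [h] at h1
  have h2 := Nat.eq_of_mul_eq_mul_left (orderOf_pos g.a) (h1.trans (mul_one _).symm)
  rw [g.orderOf_a] at h2
  exact Int.isCoprime_iff_gcd_eq_one.2 h2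

/-- Compare orders: `orderOf b = n * orderOf (a ^ c)`, `orderOf (a ^ c) * gcd(c, m) = m` and
`orderOf b * s = m * n`. -/
theorem exists_pow_b_eq : ∃ c : ℤ, g.b ^ F.n = g.a ^ c ∧ Int.gcd c F.m = F.s := by
  obtain ⟨c, hc⟩ := (g.mem_A _).1 ((g.pow_b_mem_iff F.n).2 dvd_rfl)
  refine ⟨c, hc.symm, ?_⟩
  have h1 : F.n ∣ orderOf g.b := by
    rw [← g.pow_b_mem_iff, pow_orderOf_eq_one]; exact F.A.one_mem
  have h2 : orderOf (g.b ^ F.n) * F.n = orderOf g.b := by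
    rw [orderOf_pow_of_dvd F.n_ne_zero h1, Nat.div_mul_cancel h1]
  have h3 := orderOf_zpow_mul_gcd g.a c
  rw [hc, g.orderOf_a] at h3
  have h4 : orderOf g.b * F.s = Nat.card G := by
    rw [← Nat.card_zpowers, ← g.hB]
    exact Subgroup.card_mul_index _
  have h5 := F.m_mul_n
  have h6 : 0 < orderOf (g.b ^ F.n) := orderOf_pos _
  have hn := F.n_ne_zero
  rw [← h4, ← h2, ← h3] at h5
  have h7 : (orderOf (g.b ^ F.n) * F.n) * Int.gcd c F.m = (orderOf (g.b ^ F.n) * F.n) * F.s := by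
    rw [← h5]; ring
  exact Nat.eq_of_mul_eq_mul_left (by positivity) h7

theorem s_dvd_m (g : Gen F) : F.s ∣ F.m := by
  obtain ⟨c, -, h⟩ := g.exists_pow_b_eq
  rw [← h]
  exact_mod_cast Int.gcd_dvd_right c (F.m : ℤ)

/-- `b` commutes with `b ^ n = a ^ c`, so `m ∣ (t - 1) * c`; Bézout replaces `c` by `gcd(c, m) = s`.
-/
theorem m_dvd_mul_s : (F.m : ℤ) ∣ (g.t - 1) * F.s := by
  obtain ⟨c, hc, h⟩ := g.exists_pow_b_eq
  have h1 : (F.m : ℤ) ∣ (g.t - 1) * c := by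
    have h2 := g.conj_zpow c
    rw [← hc] at h2
    have h3 : g.b * g.b ^ F.n * g.b⁻¹ = g.b ^ F.n := by
      rw [← pow_succ', pow_succ, mul_inv_cancel_right]
    rw [h3, hc, eq_comm, g.zpow_eq_iff] at h2
    rwa [show (g.t - 1) * c = c * g.t - c by ring]
  rw [← h, Int.gcd_eq_gcd_ab, mul_add]
  refine dvd_add ?_ ?_
  · rw [← mul_assoc]; exact h1.mul_right _
  · exact Dvd.dvd.mul_left (dvd_mul_right _ _) _

theorem m_dvd_pow_sub_one : (F.m : ℤ) ∣ g.t ^ F.n - 1 := by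
  obtain ⟨c, hc, h⟩ := g.exists_pow_b_eq
  have h1 := g.pow_conj_zpow F.n 1
  rw [hc, one_mul, ← zpow_neg, ← zpow_add, ← zpow_add, g.zpow_eq_iff] at h1
  rw [← dvd_neg]
  rwa [show c + 1 + -c - g.t ^ F.n = -(g.t ^ F.n - 1) by ring] at h1

/-- An element `a ^ i * b ^ j` acts on the abelian group `A` as `b ^ j`, that is, by the exponent `t
^ j`. -/
theorem exists_T_eq : ∃ u : (ZMod F.m)ˣ, (u : ZMod F.m) = g.t ∧ F.T = Subgroup.zpowers u := by
  have : NeZero F.m := ⟨F.m_ne_zero⟩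
  have hu : IsUnit (g.t : ZMod F.m) := (ZMod.coe_int_isUnit_iff_isCoprime _ _).2 g.isCoprime_t.symm
  obtain ⟨u, hu⟩ := hu
  refine ⟨u, hu, ?_⟩
  have hval : ∀ (w : (ZMod F.m)ˣ) (z : ℤ), (∀ x ∈ F.A, x ^ (w : ZMod F.m).val = x ^ z) ↔
      (w : ZMod F.m) = z := by
    intro w z
    constructor
    · intro h
      have h1 := h g.a g.a_mem
      rw [← zpow_natCast, g.zpow_eq_iff, ← ZMod.intCast_eq_intCast_iff_dvd_sub] at h1
      rw [h1]
      simp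
    · intro h x hx
      obtain ⟨i, rfl⟩ := (g.mem_A x).1 hx
      rw [← zpow_natCast, ← zpow_mul, ← zpow_mul, g.zpow_eq_iff, ← mul_sub]
      refine Dvd.dvd.mul_left ?_ _
      rw [← ZMod.intCast_eq_intCast_iff_dvd_sub, ← h]
      simp
  ext w
  constructor
  · rintro ⟨y, hy⟩
    obtain ⟨i, j, rfl⟩ := g.exists_eq y
    have h1 : (w : ZMod F.m) = ((g.t ^ j : ℤ) : ZMod F.m) := by
      refine (hval w _).1 fun x hx => ?_
      rw [← g.conj_mem hx i j]
      exact (hy x hx).symm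
    refine Subgroup.mem_zpowers_iff.2 ⟨j, Units.ext ?_⟩
    rw [zpow_natCast, Units.val_pow_eq_pow_val, hu, h1, Int.cast_pow]
  · intro hw
    rw [← mem_powers_iff_mem_zpowers] at hw
    obtain ⟨j, rfl⟩ := hw
    refine ⟨g.b ^ j, fun x hx => ?_⟩
    have h1 := g.conj_mem hx 0 j
    rw [zpow_zero, one_mul] at h1
    rw [h1]
    refine ((hval (u ^ j) (g.t ^ j)).2 ?_ x hx).symm
    rw [Units.val_pow_eq_pow_val, hu, Int.cast_pow]

/-- Modulo `⟨a ^ (t - 1)⟩` the generators commute. The derived subgroup does not depend on the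
factorization and lies in every normal factor, which makes it the bridge between two factorizations.
-/
theorem commutator_eq : commutator G = Subgroup.zpowers (g.a ^ (g.t - 1)) := by
  set N := Subgroup.zpowers (g.a ^ (g.t - 1)) with hN
  have hle : N ≤ F.A := Subgroup.zpowers_le.2 (F.A.zpow_mem g.a_mem _)
  have hnor : N.Normal := g.normal_of_le hle
  have hba : ⁅g.b, g.a⁆ = g.a ^ (g.t - 1) := by
    rw [commutatorElement_def, g.conj, zpow_sub_one]
  refine le_antisymm ?_ ?_
  · rw [commutator_def, Subgroup.commutator_le]
    have hc : Commute (g.b : G ⧸ N) (g.a : G ⧸ N) := by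
      rw [commute_iff_eq, ← mul_inv_eq_one, mul_inv_rev, ← mul_assoc, ← commutatorElement_def]
      have : ((⁅g.b, g.a⁆ : G) : G ⧸ N) = 1 :=
        (QuotientGroup.eq_one_iff _).2 (hba ▸ Subgroup.mem_zpowers _)
      exact this
    have hall : ∀ x y : G, Commute (x : G ⧸ N) (y : G ⧸ N) := by
      intro x y
      obtain ⟨i, j, rfl⟩ := g.exists_eq x
      obtain ⟨k, l, rfl⟩ := g.exists_eq y
      have h1 : Commute ((g.a : G ⧸ N) ^ i * (g.b : G ⧸ N) ^ j) (g.a : G ⧸ N) :=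
        ((Commute.refl _).zpow_left i).mul_left (hc.pow_left j)
      have h2 : Commute ((g.a : G ⧸ N) ^ i * (g.b : G ⧸ N) ^ j) (g.b : G ⧸ N) :=
        (hc.symm.zpow_left i).mul_left ((Commute.refl _).pow_left j)
      exact (h1.zpow_right k).mul_right (h2.pow_right l)
    intro x _ y _
    rw [← QuotientGroup.eq_one_iff]
    have := (hall x y)
    rw [commute_iff_eq, ← mul_inv_eq_one, mul_inv_rev, ← mul_assoc] at this
    exact this
  · rw [Subgroup.zpowers_le, ← hba, commutator_def]
    exact Subgroup.commutator_mem_commutator (Subgroup.mem_top _) (Subgroup.mem_top _)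

theorem commutator_le (g : Gen F) : commutator G ≤ F.A := by
  rw [g.commutator_eq]
  exact Subgroup.zpowers_le.2 (F.A.zpow_mem g.a_mem _)

theorem card_commutator_mul : Nat.card (commutator G) * Int.gcd (g.t - 1) F.m = F.m := by
  rw [g.commutator_eq, Nat.card_zpowers, ← g.orderOf_a]
  exact orderOf_zpow_mul_gcd _ _

end Gen

/-! ### Arithmetic constraints valid for every factorization -/

theorem pow_dvd_pow_mul_of_not_dvd {p : ℕ} (hp : p.Prime) {x y : ℤ} {k i : ℕ}
    (h : (p : ℤ) ^ k ∣ x * y) (hx : ¬ (p : ℤ) ^ (i + 1) ∣ x) : (p : ℤ) ^ k ∣ (p : ℤ) ^ i * y := by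
  have hpi : Prime (p : ℤ) := Nat.prime_iff_prime_int.1 hp
  have hx0 : x ≠ 0 := by rintro rfl; exact hx (dvd_zero _)
  have hfin : FiniteMultiplicity (p : ℤ) x :=
    Int.finiteMultiplicity_iff.2 ⟨by simpa using hp.ne_one, hx0⟩
  obtain ⟨x', hx', hnd⟩ := hfin.exists_eq_pow_mul_and_not_dvd
  set j := multiplicity (p : ℤ) x
  have hji : j ≤ i := by
    by_contra! hlt
    exact hx ((pow_dvd_pow _ hlt).trans (hx' ▸ dvd_mul_right _ _))
  rw [hx', mul_comm _ x', mul_assoc] at h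
  exact (hpi.pow_dvd_of_dvd_mul_left k hnd h).trans (mul_dvd_mul_right (pow_dvd_pow _ hji) _)

theorem piPart_int_dvd_iff {ν : Finset ℕ} (hν : ∀ q ∈ ν, q.Prime) {m : ℕ} {x : ℤ} :
    (piPart ν m : ℤ) ∣ x ↔ ∀ q ∈ ν, (q : ℤ) ^ (m.factorization q) ∣ x := by
  constructor
  · intro h q hq
    refine dvd_trans ?_ h
    exact_mod_cast Finset.dvd_prod_of_mem (fun p => ordProj[p] m) hq
  · intro h
    refine int_dvd_iff_prime_pow_dvd.2 fun p k hp hk => ?_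
    rw [hp.pow_dvd_iff_le_factorization (piPart_ne_zero hν), factorization_piPart hν] at hk
    split_ifs at hk with h1
    · exact (pow_dvd_pow _ hk).trans (h p h1)
    · simp [Nat.le_zero.1 hk]

theorem factorization_eq_of_pow_dvd_iff {p a b : ℕ} (hp : p.Prime) (ha : a ≠ 0) (hb : b ≠ 0)
    (h : ∀ k, p ^ k ∣ a ↔ p ^ k ∣ b) : a.factorization p = b.factorization p := by
  refine le_antisymm ?_ ?_
  · exact (hp.pow_dvd_iff_le_factorization hb).1 ((h _).1 (Nat.ordProj_dvd a p))
  · exact (hp.pow_dvd_iff_le_factorization ha).1 ((h _).2 (Nat.ordProj_dvd b p))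

theorem le_factorization_of_int_dvd {p k i x : ℕ} (hp : p.Prime) (hx : x ≠ 0)
    (h : (p : ℤ) ^ k ∣ (p : ℤ) ^ i * x) : k ≤ i + x.factorization p := by
  have h1 : p ^ k ∣ p ^ i * x := by exact_mod_cast h
  rw [hp.pow_dvd_iff_le_factorization (mul_ne_zero (pow_ne_zero _ hp.ne_zero) hx),
    Nat.factorization_mul (pow_ne_zero _ hp.ne_zero) hx, hp.factorization_pow] at h1
  simpa using h1

namespace Factorization

variable {G : Type*} [Group G] [Finite G] (F : Factorization G)

/-- The first entry of `inv T`. -/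
noncomputable def r : ℕ := rInv F.T

/-- The second entry of `inv T`. -/
noncomputable def eps : ℤ := epsInv F.T

/-- The third entry of `inv T`. -/
noncomputable def o : ℕ := oInv F.T

/-- The primes that divide `m` and not `r`. -/
noncomputable def ν : Finset ℕ := nu F.m F.r

theorem r_ne_zero : F.r ≠ 0 := rInv_ne_zero F.m_ne_zero _

theorem r_dvd_m : F.r ∣ F.m := rInv_dvd _

theorem eps_eq : F.eps = 1 ∨ F.eps = -1 := epsInv_eq _

theorem prime_of_mem_ν {p : ℕ} (h : p ∈ F.ν) : p.Prime := prime_of_mem_nu h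

theorem mem_ν {p : ℕ} : p ∈ F.ν ↔ p.Prime ∧ p ∣ F.m ∧ ¬ p ∣ F.r := mem_nu F.m_ne_zero F.r_ne_zero

theorem data_eq : F.data = (F.m, F.n, F.s, F.r, F.eps, F.o) := by
  obtain ⟨g⟩ := F.exists_gen
  obtain ⟨u, hu, hT⟩ := g.exists_T_eq
  have h : inv F.Delta = inv F.T := by
    have h1 : ∀ T : Subgroup (ZMod F.m)ˣ, T = Subgroup.zpowers u →
        inv (Res (modulus_dvd T F.n F.s) T) = inv T := by
      rintro T rfl
      exact inv_res_modulus F.m_ne_zero hu g.isCoprime_t _ _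
    exact h1 _ hT
  rw [data, h]
  rfl

theorem o_ne_zero : F.o ≠ 0 := by
  obtain ⟨g⟩ := F.exists_gen
  obtain ⟨u, hu, hT⟩ := g.exists_T_eq
  unfold o
  rw [hT]
  exact (oInv_zpowers_spec F.m_ne_zero hu rfl).1

theorem eps_pow_eq_one_or {p : ℕ} (hp : p.Prime) : F.eps ^ (p - 1) = 1 ∨ p = 2 ∧ F.eps = -1 := by
  rcases F.eps_eq with h | h
  · left; rw [h, one_pow]
  · by_cases hp2 : p = 2
    · exact Or.inr ⟨hp2, h⟩
    · left; rw [h]; exact (hp.even_sub_one hp2).neg_one_pow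

theorem factorization_r_le (p : ℕ) : F.r.factorization p ≤ F.m.factorization p :=
  (Nat.factorization_le_iff_dvd F.r_ne_zero F.m_ne_zero).2 F.r_dvd_m p

end Factorization

namespace Gen

variable {G : Type*} [Group G] [Finite G] {F F' : Factorization G}

theorem pow_dvd_r_iff (g : Gen F) {p : ℕ} (hp : p.Prime) (k : ℕ) :
    p ^ k ∣ F.r ↔ p ^ k ∣ F.m ∧ PowCond g.t p k := by
  obtain ⟨u, hu, hT⟩ := g.exists_T_eq
  unfold Factorization.r
  rw [hT]
  exact prime_pow_dvd_rInv_iff F.m_ne_zero hu hp k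

theorem eps_eq_neg_one_iff (g : Gen F) : F.eps = -1 ↔ 4 ∣ F.m ∧ (4 : ℤ) ∣ g.t + 1 := by
  obtain ⟨u, hu, hT⟩ := g.exists_T_eq
  unfold Factorization.eps
  rw [hT]
  exact epsInv_zpowers_eq_neg_one_iff F.m_ne_zero hu g.isCoprime_t

theorem four_dvd_r (g : Gen F) (h : 4 ∣ F.m) : 4 ∣ F.r := by
  obtain ⟨u, hu, hT⟩ := g.exists_T_eq
  unfold Factorization.r
  rw [hT]
  exact four_dvd_rInv F.m_ne_zero hu g.isCoprime_t h

theorem o_spec (g : Gen F) :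
    ∃ k : ℕ, k ≠ 0 ∧ (∀ j : ℕ, (piPart F.ν F.m : ℤ) ∣ g.t ^ j - 1 ↔ k ∣ j) ∧
    ∀ p, F.o.factorization p = if p ∈ F.ν then 0 else k.factorization p := by
  obtain ⟨u, hu, hT⟩ := g.exists_T_eq
  have := oInv_zpowers_spec (ν := F.ν) F.m_ne_zero hu (by rw [← hT]; rfl)
  unfold Factorization.o
  rw [hT]
  exact this.2

theorem two_dvd_t_sub_one (g : Gen F) (h : 2 ∣ F.m) : (2 : ℤ) ∣ g.t - 1 := by
  have := odd_of_isCoprime g.isCoprime_t h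
  omega

theorem mem_ν_iff (g : Gen F) {p : ℕ} : p ∈ F.ν ↔ p.Prime ∧ p ∣ F.m ∧ ¬ (p : ℤ) ∣ g.t - 1 := by
  rw [F.mem_ν]
  refine and_congr_right fun hp => and_congr_right fun hm => not_congr ?_
  have := g.pow_dvd_r_iff hp 1
  rw [pow_one, PowCond, pow_one] at this
  rw [this]
  constructor
  · rintro ⟨-, h | ⟨rfl, h⟩⟩
    · exact h
    · exact g.two_dvd_t_sub_one hm
  · exact fun h => ⟨hm, Or.inl h⟩

theorem dvd_t_sub_one (g : Gen F) {p : ℕ} (hp : p.Prime) (hm : p ∣ F.m) (hν : p ∉ F.ν) :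
    (p : ℤ) ∣ g.t - 1 := by
  by_contra h
  exact hν (g.mem_ν_iff.2 ⟨hp, hm, h⟩)

theorem pow_dvd_r_iff_of_eps (g : Gen F) {p : ℕ} (hp : p.Prime) (he : F.eps ^ (p - 1) = 1) (k : ℕ) :
    p ^ k ∣ F.r ↔ p ^ k ∣ F.m ∧ (p : ℤ) ^ k ∣ g.t - 1 := by
  rw [g.pow_dvd_r_iff hp]
  refine and_congr_right fun hm => ⟨?_, Or.inl⟩
  rintro (h | ⟨rfl, h⟩)
  · exact h
  · have he1 : ¬ (4 ∣ F.m ∧ (4 : ℤ) ∣ g.t + 1) := by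
      rw [← g.eps_eq_neg_one_iff]
      intro h1
      rw [h1] at he
      norm_num at he
    rcases k with _ | _ | k
    · simp
    · simpa using g.two_dvd_t_sub_one (by simpa using hm)
    · refine absurd ⟨dvd_trans (pow_dvd_pow 2 (Nat.le_add_left 2 k)) hm, ?_⟩ he1
      exact dvd_trans (pow_dvd_pow (2 : ℤ) (Nat.le_add_left 2 k)) h

theorem two_pow_dvd_r_iff_of_eps (g : Gen F) (he : F.eps = -1) (k : ℕ) :
    2 ^ k ∣ F.r ↔ 2 ^ k ∣ F.m ∧ (2 : ℤ) ^ k ∣ g.t + 1 := by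
  rw [g.pow_dvd_r_iff Nat.prime_two]
  obtain ⟨-, h4⟩ := g.eps_eq_neg_one_iff.1 he
  refine and_congr_right fun hm => ⟨?_, fun h => Or.inr ⟨rfl, h⟩⟩
  rintro (h | ⟨-, h⟩)
  · rcases k with _ | _ | k
    · simp
    · simp only [zero_add, pow_one]; omega
    · have : (4 : ℤ) ∣ g.t - 1 := dvd_trans (pow_dvd_pow (2 : ℤ) (Nat.le_add_left 2 k)) h
      omega
  · exact h

theorem gcd_ne_zero (g : Gen F) : Int.gcd (g.t - 1) F.m ≠ 0 := by
  rw [Ne, Int.gcd_eq_zero_iff]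
  have := F.m_ne_zero
  simp [this]

theorem factorization_m (g : Gen F) (p : ℕ) : F.m.factorization p =
    (Nat.card (commutator G)).factorization p + (Int.gcd (g.t - 1) F.m).factorization p := by
  conv_lhs => rw [← g.card_commutator_mul]
  rw [Nat.factorization_mul Nat.card_pos.ne' g.gcd_ne_zero, Finsupp.add_apply]

/-- In this case `r` and `gcd(t - 1, m)` have the same `p`-part. As the order of `G'` is intrinsic,
`m_p` and `r_p` determine each other within `G`. -/
theorem factorization_m_of_eps (g : Gen F) {p : ℕ} (hp : p.Prime) (he : F.eps ^ (p - 1) = 1) :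
    F.m.factorization p = (Nat.card (commutator G)).factorization p + F.r.factorization p := by
  rw [g.factorization_m]
  congr 1
  refine factorization_eq_of_pow_dvd_iff hp g.gcd_ne_zero F.r_ne_zero fun k => ?_
  rw [g.pow_dvd_gcd_iff, g.pow_dvd_r_iff_of_eps hp he]

/-- `t ≡ -1` mod 4, so `t - 1` is twice an odd number. -/
theorem factorization_gcd_of_eps_neg (g : Gen F) (he : F.eps = -1) :
    (Int.gcd (g.t - 1) F.m).factorization 2 = 1 := by
  obtain ⟨h4, ht⟩ := g.eps_eq_neg_one_iff.1 he
  refine le_antisymm ?_ ?_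
  · by_contra! h
    have h1 := (Nat.prime_two.pow_dvd_iff_le_factorization g.gcd_ne_zero).2 h
    have h2 := (g.pow_dvd_gcd_iff.1 h1).2
    norm_num at h2
    omega
  · refine (Nat.prime_two.pow_dvd_iff_le_factorization g.gcd_ne_zero).1 (g.pow_dvd_gcd_iff.2 ?_)
    have h2 : 2 ∣ F.m := dvd_trans (by norm_num) h4
    refine ⟨by simpa using h2, by simpa using g.two_dvd_t_sub_one h2⟩

theorem factorization_m_of_eps_neg (g : Gen F) (he : F.eps = -1) :
    F.m.factorization 2 = (Nat.card (commutator G)).factorization 2 + 1 := by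
  rw [g.factorization_m, g.factorization_gcd_of_eps_neg he]

theorem factorization_m_of_mem_ν (g : Gen F) {p : ℕ} (h : p ∈ F.ν) :
    F.m.factorization p = (Nat.card (commutator G)).factorization p := by
  obtain ⟨hp, h1, h2⟩ := g.mem_ν_iff.1 h
  rw [g.factorization_m, Nat.factorization_eq_zero_of_not_dvd (n := Int.gcd _ _), add_zero]
  intro h3
  rw [← pow_one p, g.pow_dvd_gcd_iff, pow_one, pow_one] at h3
  exact h2 h3.2

theorem factorization_r_of_mem_ν {p : ℕ} (h : p ∈ F.ν) : F.r.factorization p = 0 :=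
  Nat.factorization_eq_zero_of_not_dvd (F.mem_ν.1 h).2.2

theorem factorization_s_le (g : Gen F) (p : ℕ) : F.s.factorization p ≤ F.m.factorization p :=
  (Nat.factorization_le_iff_dvd F.s_ne_zero F.m_ne_zero).2 g.s_dvd_m p

theorem pow_dvd_sub_one_mul_s (g : Gen F) (p : ℕ) :
    (p : ℤ) ^ F.m.factorization p ∣ (g.t - 1) * F.s := by
  refine dvd_trans ?_ g.m_dvd_mul_s
  exact_mod_cast Nat.ordProj_dvd F.m p

theorem factorization_s_of_mem_ν (g : Gen F) {p : ℕ} (h : p ∈ F.ν) :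
    F.s.factorization p = F.m.factorization p := by
  obtain ⟨hp, h1, h2⟩ := g.mem_ν_iff.1 h
  refine le_antisymm (g.factorization_s_le p) ?_
  have h3 := pow_dvd_pow_mul_of_not_dvd (i := 0) hp (g.pow_dvd_sub_one_mul_s p) (by simpa using h2)
  simpa using le_factorization_of_int_dvd hp F.s_ne_zero h3

theorem not_pow_dvd_t_sub_one (g : Gen F) {p : ℕ} (hp : p.Prime) (he : F.eps ^ (p - 1) = 1)
    (h : F.r.factorization p < F.m.factorization p) :
    ¬ (p : ℤ) ^ (F.r.factorization p + 1) ∣ g.t - 1 := by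
  intro h1
  have h2 := (g.pow_dvd_r_iff_of_eps hp he _).2
    ⟨(hp.pow_dvd_iff_le_factorization F.m_ne_zero).2 h, h1⟩
  have h3 := (hp.pow_dvd_iff_le_factorization F.r_ne_zero).1 h2
  omega

theorem not_two_pow_dvd_t_add_one (g : Gen F) (he : F.eps = -1)
    (h : F.r.factorization 2 < F.m.factorization 2) :
    ¬ ((2 : ℕ) : ℤ) ^ (F.r.factorization 2 + 1) ∣ g.t + 1 := by
  intro h1
  have h2 := (g.two_pow_dvd_r_iff_of_eps he _).2
    ⟨(Nat.prime_two.pow_dvd_iff_le_factorization F.m_ne_zero).2 h, h1⟩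
  have h3 := (Nat.prime_two.pow_dvd_iff_le_factorization F.r_ne_zero).1 h2
  omega

theorem two_le_factorization_r (g : Gen F) (he : F.eps = -1) : 2 ≤ F.r.factorization 2 :=
  (Nat.prime_two.pow_dvd_iff_le_factorization F.r_ne_zero).1
    (g.four_dvd_r (g.eps_eq_neg_one_iff.1 he).1)

theorem factorization_m_le_s_add_one (g : Gen F) (he : F.eps = -1) :
    F.m.factorization 2 ≤ F.s.factorization 2 + 1 := by
  have ht := (g.eps_eq_neg_one_iff.1 he).2
  have h3 := pow_dvd_pow_mul_of_not_dvd (i := 1) Nat.prime_two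
    (g.pow_dvd_sub_one_mul_s 2) (by norm_num; omega)
  have := le_factorization_of_int_dvd Nat.prime_two F.s_ne_zero h3
  omega

theorem factorization_m_le_r_add_s (g : Gen F) {p : ℕ} (hp : p.Prime) :
    F.m.factorization p ≤ F.r.factorization p + F.s.factorization p := by
  rcases F.eps_pow_eq_one_or hp with he | ⟨rfl, he⟩
  · rcases (F.factorization_r_le p).lt_or_eq with h | h
    · exact le_factorization_of_int_dvd hp F.s_ne_zero (pow_dvd_pow_mul_of_not_dvd hp
        (g.pow_dvd_sub_one_mul_s p) (g.not_pow_dvd_t_sub_one hp he h))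
    · omega
  · have := g.factorization_m_le_s_add_one he
    have := g.two_le_factorization_r he
    omega

theorem even_n_of_eps_neg (g : Gen F) (he : F.eps = -1) : 2 ∣ F.n := by
  obtain ⟨h4, ht⟩ := g.eps_eq_neg_one_iff.1 he
  by_contra hn
  have hodd : Odd F.n := Nat.not_even_iff_odd.1 fun h => hn h.two_dvd
  have h1 : (4 : ℤ) ∣ g.t ^ F.n - 1 := dvd_trans (by exact_mod_cast h4) g.m_dvd_pow_sub_one
  have h2 : (4 : ℤ) ∣ g.t ^ F.n - (-1) ^ F.n :=
    dvd_trans (by simpa using ht) (sub_dvd_pow_sub_pow g.t (-1) F.n)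
  rw [hodd.neg_one_pow] at h2
  omega

theorem pow_dvd_geom_mul (g : Gen F) {p : ℕ} :
    (p : ℤ) ^ F.m.factorization p ∣ (g.t - 1) * ∑ l ∈ Finset.range F.n, g.t ^ l := by
  rw [mul_comm, geom_sum_mul]
  refine dvd_trans ?_ g.m_dvd_pow_sub_one
  exact_mod_cast Nat.ordProj_dvd F.m p

theorem four_dvd_t_sub_one (g : Gen F) (he : F.eps = 1) (hm : 4 ∣ F.m) : (4 : ℤ) ∣ g.t - 1 := by
  have h1 : ¬ (4 : ℤ) ∣ g.t + 1 := by
    intro h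
    have := g.eps_eq_neg_one_iff.2 ⟨hm, h⟩
    omega
  have h2 := g.two_dvd_t_sub_one (dvd_trans (by norm_num) hm)
  omega

/-- `m` divides `t ^ n - 1 = (t - 1) * ∑ t ^ l`. If `r_p < m_p`, the `p`-part of `t - 1` is at most
`r_p`, and what remains divides the sum, hence `n`. For `ε = -1` the factor `t - 1` contributes a
single 2, the sum contributes the 2-part of `(t + 1) * (n / 2)`, and `t + 1` is bounded by `r_2`. -/
theorem factorization_m_le_r_add_n (g : Gen F) {p : ℕ} (hp : p.Prime) (hν : p ∉ F.ν) :
    F.m.factorization p ≤ F.r.factorization p + F.n.factorization p := by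
  rcases (F.factorization_r_le p).lt_or_eq with h | h
  swap
  · omega
  have hpm : p ∣ F.m := Nat.dvd_of_factorization_pos (by omega)
  rcases F.eps_pow_eq_one_or hp with he | ⟨rfl, he⟩
  · have h1 := pow_dvd_pow_mul_of_not_dvd hp g.pow_dvd_geom_mul (g.not_pow_dvd_t_sub_one hp he h)
    obtain ⟨d, hd⟩ := Nat.exists_eq_add_of_lt h
    have hpz : (p : ℤ) ^ F.r.factorization p ≠ 0 :=
      pow_ne_zero _ (by exact_mod_cast hp.ne_zero)
    rw [hd, add_assoc, pow_add, mul_dvd_mul_iff_left hpz] at h1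
    have hp1 := g.dvd_t_sub_one hp hpm hν
    have h2 : p = 2 → (4 : ℤ) ∣ g.t - 1 := by
      rintro rfl
      have he1 : F.eps = 1 := by simpa using he
      refine g.four_dvd_t_sub_one he1 ?_
      have h3 : 1 ≤ F.r.factorization 2 := by
        rw [← Nat.prime_two.pow_dvd_iff_le_factorization F.r_ne_zero,
          g.pow_dvd_r_iff_of_eps hp he]
        exact ⟨by simpa using hpm, by simpa using hp1⟩
      exact (Nat.prime_two.pow_dvd_iff_le_factorization (k := 2) F.m_ne_zero).2 (by omega)
    rw [pow_dvd_geom_sum_iff hp hp1 h2,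
      hp.pow_dvd_iff_le_factorization F.n_ne_zero] at h1
    omega
  · obtain ⟨n', hn'⟩ := g.even_n_of_eps_neg he
    have ht := (g.eps_eq_neg_one_iff.1 he).2
    have h1 := pow_dvd_pow_mul_of_not_dvd (i := 1) hp (g.pow_dvd_geom_mul (p := 2))
      (by norm_num; omega)
    obtain ⟨d, hd⟩ := Nat.exists_eq_add_of_lt h
    have hd' : F.m.factorization 2 = 1 + (F.r.factorization 2 + d) := by omega
    rw [hd', pow_add, mul_dvd_mul_iff_left (by norm_num), hn'] at h1
    have h1' := (two_pow_dvd_geom_sum_iff ht n' _).1 (by exact_mod_cast h1)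
    have h2 : ((2 : ℕ) : ℤ) ^ F.m.factorization 2 ∣ (g.t + 1) * (F.n : ℤ) := by
      rw [hd', hn', pow_add]
      push_cast
      rw [mul_left_comm]
      exact mul_dvd_mul_left 2 (by exact_mod_cast h1')
    exact le_factorization_of_int_dvd hp F.n_ne_zero
      (pow_dvd_pow_mul_of_not_dvd hp h2 (g.not_two_pow_dvd_t_add_one he h))

theorem factorization_o_le (g : Gen F) (p : ℕ) : F.o.factorization p ≤ F.n.factorization p := by
  obtain ⟨k, hk0, hk, ho⟩ := g.o_spec
  rw [ho]
  split_ifs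
  · exact Nat.zero_le _
  · refine (Nat.factorization_le_iff_dvd hk0 F.n_ne_zero).2 ?_ p
    rw [← hk]
    exact dvd_trans (by exact_mod_cast piPart_dvd _ _) g.m_dvd_pow_sub_one

theorem factorization_o_of_mem_ν (g : Gen F) {p : ℕ} (h : p ∈ F.ν) : F.o.factorization p = 0 := by
  obtain ⟨k, hk0, hk, ho⟩ := g.o_spec
  rw [ho, if_pos h]

/-- By Fermat and lifting, the order of `t` modulo `m_ν` divides `L * m_ν`. The second factor
involves only primes of `ν`, which `o` avoids. -/
theorem o_dvd_lcm (g : Gen F) : F.o ∣ F.ν.lcm fun q => q - 1 := by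
  obtain ⟨k, hk0, hk, ho⟩ := g.o_spec
  set L := F.ν.lcm fun q => q - 1
  have hνp : ∀ q ∈ F.ν, q.Prime := fun q => F.prime_of_mem_ν
  have h1 : k ∣ L * piPart F.ν F.m := by
    rw [← hk, piPart_int_dvd_iff hνp]
    intro q hq
    have hqp := hνp q hq
    have hqd : (q : ℤ) ∣ g.t ^ L - 1 := by
      obtain ⟨e, he⟩ : q - 1 ∣ L := Finset.dvd_lcm (f := fun q => q - 1) hq
      rw [he, pow_mul]
      refine dvd_trans ?_ (sub_one_dvd_pow_sub_one _ _)
      have := Int.ModEq.pow_card_sub_one_eq_one hqp (n := g.t)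
        ((Nat.prime_iff_prime_int.1 hqp).coprime_iff_not_dvd.2
          (not_dvd_of_isCoprime hqp g.isCoprime_t (g.mem_ν_iff.1 hq).2.1)).symm
      exact this.symm.dvd
    rw [pow_mul]
    have h2 := pow_dvd_pow_sub_one (k := 1) (j := F.m.factorization q) (n := piPart F.ν F.m) hqp
      one_ne_zero (by simpa using hqd)
      (Finset.dvd_prod_of_mem (fun p => ordProj[p] F.m) hq)
    exact (pow_dvd_pow _ (Nat.le_add_left _ _)).trans h2
  refine (Nat.dvd_iff_prime_pow_dvd_dvd _ _).2 fun p i hp hi => ?_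
  rw [hp.pow_dvd_iff_le_factorization F.o_ne_zero, ho] at hi
  split_ifs at hi with hpν
  · simp [Nat.le_zero.1 hi]
  · have h2 := ((hp.pow_dvd_iff_le_factorization hk0).2 hi).trans h1
    refine Nat.Coprime.dvd_of_dvd_mul_right ?_ h2
    refine Nat.Coprime.pow_left _ (Nat.Coprime.prod_right fun q hq => Nat.Coprime.pow_right _ ?_)
    exact (Nat.coprime_primes hp (hνp q hq)).2 fun h => hpν (h ▸ hq)

/-- Since `t ≢ 1` mod `q`, its order modulo `q` has a prime divisor `p`, which divides `n`, `q - 1`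
and the order `k` modulo `m_ν`. Outside `ν` it would divide `o` as well, hence `gcd(o, q - 1)`. -/
theorem exists_prime_dvd_of_gcd_eq_one (g : Gen F) {q : ℕ} (hq : q ∈ F.ν)
    (h : Nat.gcd F.o (q - 1) = 1) :
    ∃ p ∈ F.ν ∩ F.n.primeFactors, p ∣ q - 1 := by
  obtain ⟨k, hk0, hk, ho⟩ := g.o_spec
  obtain ⟨hqp, hqm, hqt⟩ := g.mem_ν_iff.1 hq
  have : Fact q.Prime := ⟨hqp⟩
  obtain ⟨u, hu, -⟩ := g.exists_T_eq
  set w := ZMod.unitsMap hqm u with hw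
  have hwt : (w : ZMod q) = g.t := unitsMap_eq_intCast hqm hu
  have hdvd : ∀ j : ℕ, orderOf w ∣ j ↔ (q : ℤ) ∣ g.t ^ j - 1 := by
    intro j
    rw [orderOf_dvd_iff_pow_eq_one, unit_eq_one_iff]
    rw [Units.val_pow_eq_pow_val, hwt, Int.cast_pow]
  have h1 : orderOf w ≠ 1 := by
    rw [Ne, ← Nat.dvd_one, hdvd, pow_one]
    exact hqt
  obtain ⟨p, hp, hpw⟩ := Nat.exists_prime_and_dvd h1
  have hpn : p ∣ F.n := hpw.trans ((hdvd _).2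
    (dvd_trans (by exact_mod_cast hqm) g.m_dvd_pow_sub_one))
  have hpq : p ∣ q - 1 := hpw.trans (ZMod.orderOf_units_dvd_card_sub_one w)
  have hqM : q ∣ piPart F.ν F.m :=
    (Nat.dvd_ordProj_of_dvd F.m_ne_zero hqp hqm).trans
      (Finset.dvd_prod_of_mem (fun p => ordProj[p] F.m) hq)
  have hpk : p ∣ k := hpw.trans ((hdvd _).2 (dvd_trans (by exact_mod_cast hqM) ((hk k).2 dvd_rfl)))
  refine ⟨p, Finset.mem_inter.2 ⟨?_, Nat.mem_primeFactors.2 ⟨hp, hpn, F.n_ne_zero⟩⟩, hpq⟩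
  by_contra hpν
  have hpo : p ∣ F.o := by
    refine Nat.dvd_of_factorization_pos ?_
    rw [ho, if_neg hpν]
    exact (hp.factorization_pos_of_dvd hk0 hpk).ne'
  have := Nat.dvd_gcd hpo hpq
  rw [h] at this
  exact hp.not_dvd_one this

/-! ### Comparison of two factorizations of the same group -/

/-- `G'` contains an element `x` of order `p` that `b` does not centralize. It also lies in `A'`,
and `t' ≡ 1` mod `p` would make all of `G` centralize it. -/
theorem ν_subset (g : Gen F) (g' : Gen F') : F.ν ⊆ F'.ν := by
  intro p hp
  obtain ⟨hpp, hpm, hpt⟩ := g.mem_ν_iff.1 hp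
  -- The cofactor is `e = m / p`; its multiples are the exponents of the subgroup of order `p` of
  -- `A`.
  obtain ⟨e, he⟩ := hpm
  have he0 : e ≠ 0 := by rintro rfl; exact F.m_ne_zero (by simpa using he)
  have hpi : Prime (p : ℤ) := Nat.prime_iff_prime_int.1 hpp
  have hxp : ∀ i : ℤ, g.a ^ ((e : ℤ) * i) = 1 ↔ (p : ℤ) ∣ i := by
    intro i
    rw [g.zpow_eq_one_iff, he, Nat.cast_mul, mul_comm (p : ℤ),
      mul_dvd_mul_iff_left (by exact_mod_cast he0)]
  set x := g.a ^ ((e : ℤ) * (g.t - 1)) with hx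
  have hxG : x ∈ commutator G := by
    rw [g.commutator_eq, Subgroup.mem_zpowers_iff]
    exact ⟨e, by rw [← zpow_mul, hx, mul_comm]⟩
  have hx1 : x ≠ 1 := fun h => hpt ((hxp _).1 h)
  have hxp' : x ^ p = 1 := by
    rw [hx, ← zpow_natCast, ← zpow_mul, mul_assoc, hxp]
    exact dvd_mul_left _ _
  have : Fact p.Prime := ⟨hpp⟩
  have hxo : orderOf x = p := orderOf_eq_prime hxp' hx1
  have hxc : g.b * x * g.b⁻¹ ≠ x := by
    rw [hx, g.conj_zpow, Ne, g.zpow_eq_iff, ← g.zpow_eq_one_iff,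
      show (e : ℤ) * (g.t - 1) * g.t - e * (g.t - 1) = e * ((g.t - 1) * (g.t - 1)) by ring, hxp]
    intro h
    exact hpt ((hpi.dvd_or_dvd h).elim id id)
  have hxA : x ∈ F'.A := g'.commutator_le hxG
  have hpm' : p ∣ F'.m := by
    rw [← hxo]; exact Subgroup.orderOf_dvd_natCard _ hxA
  refine g'.mem_ν_iff.2 ⟨hpp, hpm', fun h => hxc ?_⟩
  obtain ⟨i, j, hb⟩ := g'.exists_eq g.b
  rw [hb, g'.conj_mem hxA]
  have h1 : x ^ (g'.t ^ j) = x ^ (1 : ℤ) := by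
    rw [zpow_eq_zpow_iff_dvd, hxo]
    exact h.trans (sub_one_dvd_pow_sub_one _ _)
  rw [h1, zpow_one]

theorem ν_eq (g : Gen F) (g' : Gen F') : F.ν = F'.ν := (ν_subset g g').antisymm (ν_subset g' g)

/-- Both exponents describe the action of `b` on `G'`, a cyclic group contained in `A` and in `A'`.
-/
theorem exists_dvd_sub_pow (g : Gen F) (g' : Gen F') :
    ∃ (i : ℤ) (j : ℕ), g.b = g'.a ^ i * g'.b ^ j ∧
    (Nat.card (commutator G) : ℤ) ∣ g.t - g'.t ^ j := by
  obtain ⟨i, j, hb⟩ := g'.exists_eq g.b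
  refine ⟨i, j, hb, ?_⟩
  set x := g.a ^ (g.t - 1) with hx
  have hxG : x ∈ commutator G := by rw [g.commutator_eq]; exact Subgroup.mem_zpowers _
  have h1 : g.b * x * g.b⁻¹ = x ^ g.t := by
    rw [hx, g.conj_zpow, zpow_mul]
  rw [hb, g'.conj_mem (g'.commutator_le hxG), eq_comm, zpow_eq_zpow_iff_dvd] at h1
  rwa [g.commutator_eq, Nat.card_zpowers]

theorem piPart_dvd_card_commutator (g : Gen F) : piPart F.ν F.m ∣ Nat.card (commutator G) := by
  rw [piPart_dvd_iff (fun q => F.prime_of_mem_ν) Nat.card_pos.ne']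
  intro p hp
  exact (g.factorization_m_of_mem_ν hp).le

theorem piPart_eq (g : Gen F) (g' : Gen F') : piPart F.ν F.m = piPart F'.ν F'.m := by
  rw [← ν_eq g g', piPart_eq_iff fun q => F.prime_of_mem_ν]
  intro p hp
  rw [g.factorization_m_of_mem_ν hp, g'.factorization_m_of_mem_ν (ν_eq g g' ▸ hp)]

/-- Since `m_ν` divides the order of `G'`, the exponent `t` is a power of `t'` modulo `m_ν`. -/
theorem dvd_pow_sub_one (g : Gen F) (g' : Gen F') {j : ℕ}
    (h : (piPart F'.ν F'.m : ℤ) ∣ g'.t ^ j - 1) :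
    (piPart F.ν F.m : ℤ) ∣ g.t ^ j - 1 := by
  obtain ⟨i, z, -, hz⟩ := exists_dvd_sub_pow g g'
  have h1 : (piPart F.ν F.m : ℤ) ∣ g.t - g'.t ^ z :=
    dvd_trans (by exact_mod_cast g.piPart_dvd_card_commutator) hz
  have h2 := h1.trans (sub_dvd_pow_sub_pow g.t (g'.t ^ z) j)
  rw [← piPart_eq g g'] at h
  have h3 := h.trans (sub_one_dvd_pow_sub_one (g'.t ^ j) z)
  rw [← pow_mul, mul_comm, pow_mul] at h3
  have := dvd_add h2 h3
  rwa [sub_add_sub_cancel] at this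

/-- The order of the group of automorphisms induced on the part `A_ν`, for both factorizations. -/
theorem exists_order (g : Gen F) (g' : Gen F') : ∃ k : ℕ, k ≠ 0 ∧
    (∀ j : ℕ, (piPart F.ν F.m : ℤ) ∣ g.t ^ j - 1 ↔ k ∣ j) ∧
    (∀ j : ℕ, (piPart F.ν F.m : ℤ) ∣ g'.t ^ j - 1 ↔ k ∣ j) ∧
    ∀ p, F.o.factorization p = if p ∈ F.ν then 0 else k.factorization p := by
  obtain ⟨k, hk0, hk, ho⟩ := g.o_spec
  refine ⟨k, hk0, hk, fun j => ?_, ho⟩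
  rw [← hk]
  constructor
  · intro h
    exact dvd_pow_sub_one g g' (piPart_eq g g' ▸ h)
  · intro h
    rw [piPart_eq g g']
    exact dvd_pow_sub_one g' g h

theorem o_eq (g : Gen F) (g' : Gen F') : F.o = F'.o := by
  obtain ⟨k, hk0, hk, hk', ho⟩ := exists_order g g'
  obtain ⟨l, hl0, hl, ho'⟩ := g'.o_spec
  have hkl : k = l := by
    rw [← piPart_eq g g'] at hl
    exact Nat.dvd_antisymm ((hk' l).1 ((hl l).2 dvd_rfl)) ((hl k).1 ((hk' k).2 dvd_rfl))
  refine Nat.eq_of_factorization_eq F.o_ne_zero F'.o_ne_zero fun p => ?_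
  rw [ho, ho', hkl, ν_eq g g']

/-- The quotient of `m_2` by the 2-part of the order of `G'` is the 2-part of `gcd(t - 1, m)`. It is
2 for `ε = -1`, at least 2 whenever `m` is even, and at least 4 if `4 ∣ m` and `ε = 1`. -/
theorem factorization_m_le_of_eps_neg (g : Gen F) (g' : Gen F') (he : F.eps = -1) :
    F.m.factorization 2 ≤ F'.m.factorization 2 ∧
      (F.m.factorization 2 = F'.m.factorization 2 → F'.eps = -1) := by
  have h1 := g.factorization_m_of_eps_neg he
  have h2 := g'.factorization_m 2
  have h4 : 2 ≤ F.m.factorization 2 :=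
    (Nat.prime_two.pow_dvd_iff_le_factorization F.m_ne_zero).1 (g.eps_eq_neg_one_iff.1 he).1
  have h5 : 2 ∣ F'.m := Nat.dvd_of_factorization_pos (by omega)
  have h6 : 1 ≤ (Int.gcd (g'.t - 1) F'.m).factorization 2 := by
    rw [← Nat.prime_two.pow_dvd_iff_le_factorization g'.gcd_ne_zero, g'.pow_dvd_gcd_iff]
    exact ⟨by simpa using h5, by simpa using g'.two_dvd_t_sub_one h5⟩
  refine ⟨by omega, fun h => ?_⟩
  have hm4 : 4 ∣ F'.m :=
    (Nat.prime_two.pow_dvd_iff_le_factorization (k := 2) F'.m_ne_zero).2 (by omega)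
  rcases F'.eps_eq with he' | he'
  · have h7 := g'.four_dvd_t_sub_one he' hm4
    have h8 : 2 ≤ (Int.gcd (g'.t - 1) F'.m).factorization 2 := by
      rw [← Nat.prime_two.pow_dvd_iff_le_factorization g'.gcd_ne_zero, g'.pow_dvd_gcd_iff]
      exact ⟨by simpa using hm4, by simpa using h7⟩
    omega
  · exact he'

end Gen

/-! ### Reduced factorizations are minimal -/

open Finset in
theorem dvd_geom_sum_sub {d x : ℤ} (h : d ∣ x - 1) (N : ℕ) : d ∣ ∑ l ∈ range N, x ^ l - N := by
  have h1 : ∑ l ∈ range N, x ^ l - (N : ℤ) = ∑ l ∈ range N, (x ^ l - 1) := by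
    rw [sum_sub_distrib]; simp
  rw [h1]
  exact dvd_sum fun l _ => h.trans (sub_one_dvd_pow_sub_one _ _)

theorem dvd_mul_ordCompl {d m x p : ℕ} (hd : d ∣ m) (hm : m ≠ 0) (hx : x ≠ 0)
    (h : d.factorization p ≤ x.factorization p) : d ∣ x * ordCompl[p] m := by
  have hd0 := ne_zero_of_dvd_ne_zero hm hd
  have hc0 := (Nat.ordCompl_pos p hm).ne'
  refine (Nat.factorization_le_iff_dvd hd0 (mul_ne_zero hx hc0)).1 fun q => ?_
  rw [Nat.factorization_mul hx hc0, Nat.factorization_ordCompl, Finsupp.add_apply]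
  by_cases hq : q = p
  · subst hq; omega
  · rw [Finsupp.erase_ne hq]
    have := (Nat.factorization_le_iff_dvd hd0 hm).2 hd q
    omega

theorem odd_of_four_dvd_pow_add_one {t : ℤ} {j : ℕ} (ht : (4 : ℤ) ∣ t + 1)
    (h : (4 : ℤ) ∣ t ^ j + 1) : Odd j := by
  by_contra hj
  have h1 : (4 : ℤ) ∣ t ^ j - (-1) ^ j :=
    dvd_trans (by simpa using ht) (sub_dvd_pow_sub_pow t (-1) j)
  rw [(Nat.not_odd_iff_even.1 hj).neg_one_pow] at h1
  omega

theorem add_one_dvd_pow_add_one (t : ℤ) {j : ℕ} (hj : Odd j) : t + 1 ∣ t ^ j + 1 := by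
  have := sub_dvd_pow_sub_pow t (-1) j
  rwa [hj.neg_one_pow, sub_neg_eq_add, sub_neg_eq_add] at this

theorem add_one_dvd_pow_sub_one (t : ℤ) {j : ℕ} (hj : Even j) : t + 1 ∣ t ^ j - 1 := by
  have := sub_dvd_pow_sub_pow t (-1) j
  rwa [hj.neg_one_pow, sub_neg_eq_add] at this

theorem two_pow_dvd_add_one_of_pow {t : ℤ} {e l : ℕ} (ht : ¬ (2 : ℤ) ∣ t) (hl : Odd l)
    (h : (2 : ℤ) ^ e ∣ t ^ l + 1) : (2 : ℤ) ^ e ∣ t + 1 := by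
  have h1 := geom_sum_mul (-t) l
  rw [hl.neg_pow] at h1
  have h2 : (2 : ℤ) ∣ -t - 1 := by omega
  have h3 := dvd_geom_sum_sub h2 l
  have h4 : ¬ (2 : ℤ) ∣ ∑ i ∈ Finset.range l, (-t) ^ i := by
    obtain ⟨w, rfl⟩ := hl
    push_cast at h3
    omega
  have h5 : (2 : ℤ) ^ e ∣ (∑ i ∈ Finset.range l, (-t) ^ i) * (t + 1) := by
    rw [show (∑ i ∈ Finset.range l, (-t) ^ i) * (t + 1) =
      -((∑ i ∈ Finset.range l, (-t) ^ i) * (-t - 1)) by ring, h1]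
    rwa [show -(-t ^ l - 1) = t ^ l + 1 by ring]
  exact Int.prime_two.pow_dvd_of_dvd_mul_left e h4 h5

/-- The conditions on `(m, n, s, r, ε, o)` that characterize minimal factorizations. -/
structure Factorization.Reduced {G : Type*} [Group G] [Finite G] (F : Factorization G) : Prop where
  pos : ∀ p, p.Prime → p ∣ F.r → F.eps ^ (p - 1) = 1 →
    F.s.factorization p ≤ F.n.factorization p ∧ (F.r.factorization p ≤ F.s.factorization p ∨
      F.n.factorization p < F.s.factorization p + F.o.factorization p)
  neg : F.eps = -1 → F.s.factorization 2 ≠ F.n.factorization 2 + F.r.factorization 2 ∧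
    (2 ≤ F.n.factorization 2 → 3 ≤ F.m.factorization 2 →
      F.o.factorization 2 < F.n.factorization 2 → F.r.factorization 2 ≤ F.s.factorization 2)

namespace Gen

variable {G : Type*} [Group G] [Finite G] {F F' : Factorization G}

theorem zpow_mem_commutator (g : Gen F) {z : ℤ} (h : (Int.gcd (g.t - 1) F.m : ℤ) ∣ z) :
    g.a ^ z ∈ commutator G := by
  obtain ⟨w, rfl⟩ := h
  rw [zpow_mul]
  refine (commutator G).zpow_mem ?_ w
  have h1 : g.a ^ (F.m : ℤ) = 1 := (g.zpow_eq_one_iff _).2 dvd_rfl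
  rw [Int.gcd_eq_gcd_ab, zpow_add, zpow_mul, zpow_mul, h1, one_zpow, mul_one, g.commutator_eq]
  exact Subgroup.zpow_mem _ (Subgroup.mem_zpowers _) _

/-- Elements of `A'` centralize the derived subgroup. -/
theorem card_commutator_dvd_pow_sub_one (g : Gen F) (g' : Gen F') {i : ℤ} {j : ℕ}
    (h : g.a ^ i * g.b ^ j ∈ F'.A) :
    (Nat.card (commutator G) : ℤ) ∣ g.t ^ j - 1 := by
  obtain ⟨z, hz⟩ := (g'.mem_A _).1 h
  set x := g.a ^ (g.t - 1) with hx
  have hxG : x ∈ commutator G := by rw [g.commutator_eq]; exact Subgroup.mem_zpowers _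
  obtain ⟨w, hw⟩ := (g'.mem_A _).1 (g'.commutator_le hxG)
  have h1 := g.conj_mem (g.commutator_le hxG) i j
  rw [← hz, ← hw] at h1
  have h2 : g'.a ^ z * g'.a ^ w * (g'.a ^ z)⁻¹ = (g'.a ^ w) ^ (1 : ℤ) := by group
  rw [h2, hw, eq_comm, zpow_eq_zpow_iff_dvd] at h1
  rwa [g.commutator_eq, Nat.card_zpowers]

/-- Here `b' ^ n = a ^ X` with `p ^ e ∣ X`, so the `p`-part of the order of `b'` is at most `n_p *
m_p / p ^ e`. The relation `orderOf b' * s' = m * n` turns this into a lower bound for `s'`. -/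
theorem le_factorization_s (g : Gen F) (g' : Gen F') {p e : ℕ} {i : ℤ} {j : ℕ} (hp : p.Prime)
    (hb : g'.b = g.a ^ i * g.b ^ j) (he : e ≤ F.s.factorization p)
    (h : (p : ℤ) ^ e ∣ ∑ l ∈ Finset.range F.n, (g.t ^ j) ^ l) :
    e ≤ F'.s.factorization p := by
  obtain ⟨c, hc, hcs⟩ := g.exists_pow_b_eq
  set S := ∑ l ∈ Finset.range F.n, (g.t ^ j) ^ l with hS
  set μ := F.m.factorization p with hμ
  set K := ordCompl[p] F.m with hK
  have hem : e ≤ μ := he.trans (g.factorization_s_le p)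
  have h1 : g'.b ^ F.n = g.a ^ (i * S + c * j) := by
    rw [hb, g.mul_pow, mul_comm j, pow_mul, hc, ← zpow_natCast, ← zpow_mul, ← zpow_add]
  have hpc : (p : ℤ) ^ e ∣ c := by
    refine dvd_trans ?_ (s_dvd_c hcs)
    exact_mod_cast (hp.pow_dvd_iff_le_factorization F.s_ne_zero).2 he
  have h2 : g'.b ^ (F.n * (K * p ^ (μ - e))) = 1 := by
    rw [pow_mul, h1, ← zpow_natCast, ← zpow_mul, g.zpow_eq_one_iff]
    obtain ⟨y, hy⟩ : (p : ℤ) ^ e ∣ i * S + c * j := dvd_add (h.mul_left _) (hpc.mul_right _)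
    have hmm : (F.m : ℤ) = p ^ e * (K * p ^ (μ - e)) := by
      have h3 := Nat.ordProj_mul_ordCompl_eq_self F.m p
      have h4 : p ^ μ = p ^ e * p ^ (μ - e) := by rw [← pow_add]; congr 1; omega
      rw [← hK, ← hμ, h4] at h3
      rw [← h3]
      push_cast
      ring
    rw [hy, hmm]
    push_cast
    exact ⟨y, by ring⟩
  have hK0 : K ≠ 0 := (Nat.ordCompl_pos p F.m_ne_zero).ne'
  have hpp : p ^ (μ - e) ≠ 0 := pow_ne_zero _ hp.ne_zero
  have h3 := (Nat.factorization_le_iff_dvd (orderOf_pos g'.b).ne'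
    (mul_ne_zero F.n_ne_zero (mul_ne_zero hK0 hpp))).2 (orderOf_dvd_of_pow_eq_one h2) p
  rw [Nat.factorization_mul F.n_ne_zero (mul_ne_zero hK0 hpp), Nat.factorization_mul hK0 hpp,
    hp.factorization_pow, hK, Nat.factorization_ordCompl] at h3
  simp only [Finsupp.add_apply, Finsupp.erase_same, Finsupp.single_eq_same, zero_add] at h3
  have h4 := congrArg (fun x => x.factorization p)
    (g'.orderOf_b_mul_s.trans (F'.m_mul_n.trans F.m_mul_n.symm))
  simp only [Nat.factorization_mul (orderOf_pos g'.b).ne' F'.s_ne_zero,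
    Nat.factorization_mul F.m_ne_zero F.n_ne_zero, Finsupp.add_apply] at h4
  omega

theorem factorization_m_add_n (F F' : Factorization G) (p : ℕ) :
    F.m.factorization p + F.n.factorization p = F'.m.factorization p + F'.n.factorization p := by
  have h4 := congrArg (fun x => x.factorization p) (F.m_mul_n.trans F'.m_mul_n.symm)
  simpa only [Nat.factorization_mul F.m_ne_zero F.n_ne_zero,
    Nat.factorization_mul F'.m_ne_zero F'.n_ne_zero, Finsupp.add_apply] using h4

/-- When `r_p ≤ s_p ≤ n_p`, the element `b' ^ (n * K)` lies in `G' ≤ A'`, with `K` prime to `p`; and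
`n'` is the order of `b'` modulo `A'`. As `m * n = m' * n'`, an upper bound for `n'_p` is a lower
bound for `m'_p`. -/
theorem factorization_n_le_of_r_le_s (g : Gen F) (g' : Gen F') {p : ℕ} (hp : p.Prime)
    (he : F.eps ^ (p - 1) = 1)
    (h1 : F.s.factorization p ≤ F.n.factorization p)
    (h2 : F.r.factorization p ≤ F.s.factorization p) :
    F'.n.factorization p ≤ F.n.factorization p := by
  obtain ⟨c, hc, hcs⟩ := g.exists_pow_b_eq
  obtain ⟨i, j, hb⟩ := g.exists_eq g'.b
  set K := ordCompl[p] F.m with hK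
  set d := Int.gcd (g.t - 1) F.m with hd
  have hdm : d ∣ F.m := by exact_mod_cast Int.gcd_dvd_right (g.t - 1) (F.m : ℤ)
  have hdt : (d : ℤ) ∣ g.t ^ j - 1 :=
    (Int.gcd_dvd_left (g.t - 1) (F.m : ℤ)).trans (sub_one_dvd_pow_sub_one _ _)
  have hdr : d.factorization p = F.r.factorization p := by
    have h3 := g.factorization_m p
    have h4 := g.factorization_m_of_eps hp he
    rw [← hd] at h3
    omega
  have hdn : d ∣ F.n * K := dvd_mul_ordCompl hdm F.m_ne_zero F.n_ne_zero (by omega)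
  have hds : d ∣ F.s * K := dvd_mul_ordCompl hdm F.m_ne_zero F.s_ne_zero (by omega)
  have hK0 : K ≠ 0 := (Nat.ordCompl_pos p F.m_ne_zero).ne'
  have hmem : g'.b ^ (F.n * K) ∈ commutator G := by
    rw [hb, g.mul_pow, show j * (F.n * K) = F.n * (K * j) by ring, pow_mul, hc, ← zpow_natCast,
      ← zpow_mul, ← zpow_add]
    refine g.zpow_mem_commutator (dvd_add (Dvd.dvd.mul_left ?_ _) ?_)
    · have h3 := dvd_geom_sum_sub hdt (F.n * K)
      exact (dvd_sub_left (by exact_mod_cast hdn)).1 h3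
    · have h4 : ((F.s * K : ℕ) : ℤ) ∣ c * ((K * j : ℕ) : ℤ) := by
        push_cast
        rw [← mul_assoc]
        exact (mul_dvd_mul_right (s_dvd_c hcs) _).mul_right _
      exact dvd_trans (by exact_mod_cast hds) h4
  have h3 := (g'.pow_b_mem_iff _).1 (g'.commutator_le hmem)
  have h4 := (Nat.factorization_le_iff_dvd F'.n_ne_zero (mul_ne_zero F.n_ne_zero hK0)).2 h3 p
  rw [Nat.factorization_mul F.n_ne_zero hK0, hK, Nat.factorization_ordCompl] at h4
  simpa using h4

/-- In `G / A'`, generated by `b'`, write `a = b' ^ j` and `b = b' ^ l`. As `a` centralizes `G'`, `k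
∣ j` and so `o_p ∣ j`; as `b` induces the full order `k`, a multiple of `p`, on the `ν`-part, `p ∤
l`. Then `b ^ n = a ^ c` reads `l * n ≡ j * c` mod `n'`, where `p ^ (n_p + 1)`, with `n_p` the
exponent of `p` in `n`, divides `j * c` but not `l * n`. -/
theorem factorization_n_le_of_n_lt (g : Gen F) (g' : Gen F') {p : ℕ} (hp : p.Prime) (hν : p ∉ F.ν)
    (h1 : F.s.factorization p ≤ F.n.factorization p)
    (h2 : F.n.factorization p < F.s.factorization p + F.o.factorization p) :
    F'.n.factorization p ≤ F.n.factorization p := by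
  obtain ⟨c, hc, hcs⟩ := g.exists_pow_b_eq
  obtain ⟨k, hk0, hk, hk', ho⟩ := exists_order g g'
  obtain ⟨i, l, hb, hl⟩ := exists_dvd_sub_pow g g'
  obtain ⟨i', j, ha⟩ := g'.exists_eq g.a
  have hM : (piPart F.ν F.m : ℤ) ∣ Nat.card (commutator G) := by
    exact_mod_cast g.piPart_dvd_card_commutator
  have hop := ho p
  rw [if_neg hν] at hop
  have hkj : k ∣ j := (hk' j).1 (hM.trans (card_commutator_dvd_pow_sub_one g' g (ha ▸ g.a_mem)))
  have hpl : ¬ p ∣ l := by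
    rintro ⟨l', rfl⟩
    obtain ⟨k', rfl⟩ : p ∣ k := Nat.dvd_of_factorization_pos (by omega)
    have h3 : (piPart F.ν F.m : ℤ) ∣ g.t ^ k' - 1 := by
      have h4 := (hM.trans hl).trans (sub_dvd_pow_sub_pow _ _ k')
      have h5 := (hk' (p * l' * k')).2 ⟨l', by ring⟩
      rw [pow_mul] at h5
      have := dvd_add h4 h5
      rwa [sub_add_sub_cancel] at this
    have h6 := Nat.le_of_dvd (Nat.pos_of_ne_zero (right_ne_zero_of_mul hk0)) ((hk k').1 h3)
    have h7 : 0 < k' := Nat.pos_of_ne_zero (right_ne_zero_of_mul hk0)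
    have := hp.two_le
    nlinarith
  have := F'.normal
  have hqa : (g.a : G ⧸ F'.A) = (g'.b : G ⧸ F'.A) ^ j := by
    rw [ha, QuotientGroup.mk_mul, (QuotientGroup.eq_one_iff _).2 ((g'.mem_A _).2 ⟨i', rfl⟩),
      one_mul, QuotientGroup.mk_pow]
  have hqb : (g.b : G ⧸ F'.A) = (g'.b : G ⧸ F'.A) ^ l := by
    rw [hb, QuotientGroup.mk_mul, (QuotientGroup.eq_one_iff _).2 ((g'.mem_A _).2 ⟨i, rfl⟩),
      one_mul, QuotientGroup.mk_pow]
  have hq := congrArg (QuotientGroup.mk (s := F'.A)) hc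
  rw [QuotientGroup.mk_pow, QuotientGroup.mk_zpow, hqa, hqb, ← zpow_natCast, ← zpow_natCast,
    ← zpow_natCast, ← zpow_mul, ← zpow_mul, zpow_eq_zpow_iff_dvd, g'.orderOf_mk_b] at hq
  by_contra! hlt
  have h3 : (p : ℤ) ^ (F.n.factorization p + 1) ∣ (l : ℤ) * F.n - j * c := by
    refine dvd_trans ?_ hq
    exact_mod_cast (hp.pow_dvd_iff_le_factorization F'.n_ne_zero).2 hlt
  have h4 : (p : ℤ) ^ (F.n.factorization p + 1) ∣ j * c := by
    refine (pow_dvd_pow _ (show _ ≤ F.o.factorization p + F.s.factorization p by omega)).trans ?_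
    rw [pow_add]
    refine mul_dvd_mul ?_ ?_
    · have : p ^ F.o.factorization p ∣ j := by
        rw [hop]; exact (Nat.ordProj_dvd k p).trans hkj
      exact_mod_cast this
    · refine dvd_trans ?_ (s_dvd_c hcs)
      exact_mod_cast Nat.ordProj_dvd F.s p
  have h5 : p ^ (F.n.factorization p + 1) ∣ l * F.n := by
    exact_mod_cast (dvd_sub_left h4).1 h3
  have h6 := hp.prime.pow_dvd_of_dvd_mul_left _ hpl h5
  rw [hp.pow_dvd_iff_le_factorization F.n_ne_zero] at h6
  omega

theorem factorization_s_le_of_s_le_n (g : Gen F) (g' : Gen F') {p : ℕ} (hp : p.Prime) (hν : p ∉ F.ν)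
    (h1 : F.s.factorization p ≤ F.n.factorization p) :
    F.s.factorization p ≤ F'.s.factorization p := by
  obtain ⟨i, j, hb⟩ := g.exists_eq g'.b
  by_cases hpm : p ∣ F.m
  · refine le_factorization_s g g' hp hb le_rfl (pow_dvd_geom_sum hp ?_ ?_)
    · exact (g.dvd_t_sub_one hp hpm hν).trans (sub_one_dvd_pow_sub_one _ _)
    · exact (hp.pow_dvd_iff_le_factorization F.n_ne_zero).2 h1
  · have h2 := g.factorization_s_le p
    rw [Nat.factorization_eq_zero_of_not_dvd hpm] at h2
    omega

theorem factorization_r_le_of_eps (g : Gen F) (g' : Gen F') {p : ℕ} (hp : p.Prime)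
    (he : F.eps ^ (p - 1) = 1)
    (hm : F.m.factorization p = F'.m.factorization p) :
    F.r.factorization p ≤ F'.r.factorization p := by
  rcases F'.eps_pow_eq_one_or hp with he' | ⟨rfl, he'⟩
  · have h1 := g.factorization_m_of_eps hp he
    have h2 := g'.factorization_m_of_eps hp he'
    omega
  · have h3 := (factorization_m_le_of_eps_neg g' g he').2 hm.symm
    rw [h3] at he
    norm_num at he

end Gen

/-! ### Comparison at the prime 2 when `ε = -1` -/

namespace Gen

variable {G : Type*} [Group G] [Finite G] {F F' : Factorization G}

theorem exists_dvd_sub_pow_right (g : Gen F) (g' : Gen F') :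
    ∃ (i : ℤ) (j : ℕ), g'.b = g.a ^ i * g.b ^ j ∧
    (Nat.card (commutator G) : ℤ) ∣ g'.t - g.t ^ j := exists_dvd_sub_pow g' g

theorem two_pow_dvd_card_commutator (g : Gen F) (he : F.eps = -1) {e : ℕ}
    (h : e < F.m.factorization 2) :
    (2 : ℤ) ^ e ∣ Nat.card (commutator G) := by
  have h1 := g.factorization_m_of_eps_neg he
  have h2 : 2 ^ e ∣ Nat.card (commutator G) :=
    (Nat.prime_two.pow_dvd_iff_le_factorization Nat.card_pos.ne').2 (by omega)
  exact_mod_cast h2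

theorem odd_of_four_dvd_sub_pow {t t' : ℤ} {j : ℕ} (ht : (4 : ℤ) ∣ t + 1) (ht' : (4 : ℤ) ∣ t' + 1)
    (h : (4 : ℤ) ∣ t' - t ^ j) : Odd j := by
  refine odd_of_four_dvd_pow_add_one ht ?_
  have := dvd_sub ht' h
  rwa [show t' + 1 - (t' - t ^ j) = t ^ j + 1 by ring] at this

/-- `2 ^ e` divides the order of `G'`, so modulo `2 ^ e` the exponent `t'` is a power of `t`, an odd
one by comparison modulo 4; odd powers preserve `-1`. -/
theorem two_pow_dvd_t_add_one_of_lt (g : Gen F) (g' : Gen F') (he : F.eps = -1)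
    (he' : F'.eps = -1) {e : ℕ} (h2 : 2 ≤ e)
    (hem : e < F.m.factorization 2) (ht : (2 : ℤ) ^ e ∣ g.t + 1) : (2 : ℤ) ^ e ∣ g'.t + 1 := by
  obtain ⟨i, j, -, hj⟩ := exists_dvd_sub_pow_right g g'
  have h1 := (g.two_pow_dvd_card_commutator he hem).trans hj
  have h4 : (4 : ℤ) ∣ (2 : ℤ) ^ e := pow_dvd_pow (2 : ℤ) h2
  have hodd := odd_of_four_dvd_sub_pow (g.eps_eq_neg_one_iff.1 he).2 (g'.eps_eq_neg_one_iff.1 he').2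
    (h4.trans h1)
  have := dvd_add h1 (ht.trans (add_one_dvd_pow_add_one g.t hodd))
  rwa [show g'.t - g.t ^ j + (g.t ^ j + 1) = g'.t + 1 by ring] at this

/-- The `2`-part of the generator of `A'`. -/
theorem sq_mem_commutator (g' : Gen F') (he' : F'.eps = -1) :
    (g'.a ^ ordCompl[2] F'.m) ^ 2 ∈ commutator G := by
  rw [← pow_mul, ← zpow_natCast]
  refine g'.zpow_mem_commutator ?_
  have h1 : Int.gcd (g'.t - 1) F'.m ∣ F'.m := by
    exact_mod_cast Int.gcd_dvd_right (g'.t - 1) (F'.m : ℤ)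
  have h2 := dvd_mul_ordCompl (p := 2) (x := 2) h1 F'.m_ne_zero two_ne_zero
    (by rw [g'.factorization_gcd_of_eps_neg he', Nat.prime_two.factorization_self])
  rw [mul_comm]
  exact_mod_cast h2

theorem orderOf_two_part (F' : Factorization G) (g' : Gen F') :
    orderOf (g'.a ^ ordCompl[2] F'.m) = 2 ^ F'.m.factorization 2 := by
  have h := Nat.ordProj_mul_ordCompl_eq_self F'.m 2
  have h0 := (Nat.ordCompl_pos 2 F'.m_ne_zero).ne'
  rw [orderOf_pow_of_dvd h0 (by rw [g'.orderOf_a]; exact Nat.ordCompl_dvd _ _), g'.orderOf_a]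
  conv_lhs => rw [← h]
  rw [h]
  exact Nat.div_eq_of_eq_mul_left (Nat.pos_of_ne_zero h0) h.symm

theorem two_pow_dvd_of_zpow_eq (g : Gen F) {μ : ℕ} (hμ : F.m.factorization 2 = μ) {x : G}
    (hx : orderOf x = 2 ^ μ) {z X : ℤ} (h : x ^ z = g.a ^ X) (hX : (2 : ℤ) ^ μ ∣ X) :
    (2 : ℤ) ^ μ ∣ z := by
  subst hμ
  have h1 : x ^ (z * (ordCompl[2] F.m : ℕ)) = 1 := by
    rw [zpow_mul, h, ← zpow_mul, g.zpow_eq_one_iff]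
    have h2 := Nat.ordProj_mul_ordCompl_eq_self F.m 2
    conv_lhs => rw [← h2]
    rw [Nat.cast_mul]
    exact mul_dvd_mul (by exact_mod_cast hX) dvd_rfl
  rw [← orderOf_dvd_iff_zpow_eq_one, hx] at h1
  push_cast at h1
  refine Int.prime_two.pow_dvd_of_dvd_mul_right _ ?_ h1
  have := Nat.not_dvd_ordCompl Nat.prime_two F.m_ne_zero
  exact_mod_cast this

/-- If `r_2 < m_2`, the action on `G'` shows all that is needed. If `r_2 = m_2`, one factor 2 is
lost in `G'`, and the 2-part `x = a ^ i * b ^ j` of `a'` is examined instead, according to whether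
or not it lies in `A`. -/
theorem factorization_r_le_of_eps_neg (g : Gen F) (g' : Gen F') (hF : F.Reduced)
    (he : F.eps = -1) (he' : F'.eps = -1)
    (hm : F.m.factorization 2 = F'.m.factorization 2) :
    F.r.factorization 2 ≤ F'.r.factorization 2 := by
  have h2m := g.two_le_factorization_r he
  have hr := (g.two_pow_dvd_r_iff_of_eps he _).1 (Nat.ordProj_dvd F.r 2)
  suffices h : (2 : ℤ) ^ F.r.factorization 2 ∣ g'.t + 1 by
    refine (Nat.prime_two.pow_dvd_iff_le_factorization F'.r_ne_zero).1
      ((g'.two_pow_dvd_r_iff_of_eps he' _).2 ⟨?_, h⟩)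
    refine (Nat.prime_two.pow_dvd_iff_le_factorization F'.m_ne_zero).2 ?_
    rw [← hm]
    exact F.factorization_r_le 2
  rcases (F.factorization_r_le 2).lt_or_eq with hlt | heq
  · exact two_pow_dvd_t_add_one_of_lt g g' he he' h2m hlt hr.2
  obtain ⟨μ, hμ⟩ : ∃ μ, F.m.factorization 2 = μ := ⟨_, rfl⟩
  have ht := (g.eps_eq_neg_one_iff.1 he).2
  have ht' := (g'.eps_eq_neg_one_iff.1 he').2
  rw [heq, hμ] at hr h2m ⊢
  rcases eq_or_ne μ 2 with rfl | hμ2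
  · exact ht'
  have hμ3 : 3 ≤ μ := by omega
  have hlow : (2 : ℤ) ^ (μ - 1) ∣ Nat.card (commutator G) :=
    g.two_pow_dvd_card_commutator he (by omega)
  have h4low : (4 : ℤ) ∣ (2 : ℤ) ^ (μ - 1) := pow_dvd_pow (2 : ℤ) (show 2 ≤ μ - 1 by omega)
  set x := g'.a ^ ordCompl[2] F'.m with hx
  have hxo : orderOf x = 2 ^ μ := by rw [← hμ, hm]; exact orderOf_two_part F' g'
  have hxA : x ∈ F'.A := F'.A.pow_mem g'.a_mem _
  obtain ⟨i, j, hij⟩ := g.exists_eq x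
  have hx2 : x ^ 2 = g.a ^ (i * (1 + g.t ^ j)) * g.b ^ (j * 2) := by
    rw [hij, g.mul_pow, Finset.sum_range_succ, Finset.sum_range_one, pow_zero, pow_one]
  have hnj : F.n ∣ j * 2 := by
    rw [← g.pow_b_mem_iff]
    have h1 := g.commutator_le (sq_mem_commutator g' he')
    rw [← hx, hx2] at h1
    exact (F.A.mul_mem_cancel_left (F.A.zpow_mem g.a_mem _)).1 h1
  -- If `n ∣ j` then `x ∈ A`, and `b'` acts on `x` both by `t'` and by an odd power of `t`; the
  -- order `2 ^ μ` of `x` recovers the lost factor 2.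
  by_cases hj : F.n ∣ j
  · obtain ⟨i', j', hb', hj'⟩ := exists_dvd_sub_pow_right g g'
    have hxA' : x ∈ F.A := by
      rw [hij]
      exact F.A.mul_mem (F.A.zpow_mem g.a_mem _) ((g.pow_b_mem_iff _).2 hj)
    have h1 := g.conj_mem hxA' i' j'
    have h2 := g'.conj_mem hxA 0 1
    rw [zpow_zero, one_mul, pow_one, pow_one] at h2
    rw [← hb', h2, zpow_eq_zpow_iff_dvd, hxo] at h1
    push_cast at h1
    have hodd := odd_of_four_dvd_sub_pow ht ht' ((h4low.trans hlow).trans hj')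
    have := dvd_add h1 (hr.2.trans (add_one_dvd_pow_add_one g.t hodd))
    rwa [show g'.t - g.t ^ j' + (g.t ^ j' + 1) = g'.t + 1 by ring] at this
  · obtain ⟨y, hy⟩ := hnj
    have hcent : (Nat.card (commutator G) : ℤ) ∣ g.t ^ j - 1 :=
      card_commutator_dvd_pow_sub_one g g' (hij ▸ hxA)
    have hjeven : Even j := by
      by_contra hodd
      have h1 := add_one_dvd_pow_add_one g.t (Nat.not_even_iff_odd.1 hodd)
      have h2 := (h4low.trans hlow).trans hcent
      have h3 := ht.trans h1
      omega
    have hy2 : ¬ 2 ∣ y := by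
      rintro ⟨w, rfl⟩
      refine hj ⟨w, ?_⟩
      linarith
    have hyj : F.n.factorization 2 = j.factorization 2 + 1 := by
      have hj0 : j ≠ 0 := by rintro rfl; exact hj (dvd_zero _)
      have hy0 : y ≠ 0 := by rintro rfl; exact hy2 (dvd_zero _)
      have h1 := congrArg (fun x => x.factorization 2) hy
      simp only [Nat.factorization_mul hj0 two_ne_zero, Nat.factorization_mul F.n_ne_zero hy0,
        Finsupp.add_apply, Nat.prime_two.factorization_self,
        Nat.factorization_eq_zero_of_not_dvd hy2] at h1
      omega
    have hj0 : j ≠ 0 := by rintro rfl; exact hj (dvd_zero _)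
    have hj1 : 1 ≤ j.factorization 2 :=
      Nat.prime_two.factorization_pos_of_dvd hj0 hjeven.two_dvd
    have ho : F.o.factorization 2 ≤ j.factorization 2 := by
      obtain ⟨k, hk0, hk, ho⟩ := g.o_spec
      rw [ho]
      split_ifs
      · exact Nat.zero_le _
      · refine (Nat.factorization_le_iff_dvd hk0 hj0).2 ((hk j).1 (dvd_trans ?_ hcent)) 2
        exact_mod_cast g.piPart_dvd_card_commutator
    -- Now `n_2 = 2 * j_2` and `o_2 ∣ j_2`, so `o_2 < n_2` and reducedness applies; with `r_2 = m_2`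
    -- it gives `2 ^ μ ∣ s`.
    have hs := (hF.neg he).2 (by omega) (by omega) (by omega)
    obtain ⟨c, hc, hcs⟩ := g.exists_pow_b_eq
    have hcμ : (2 : ℤ) ^ μ ∣ c := by
      refine dvd_trans ?_ (s_dvd_c hcs)
      have : 2 ^ μ ∣ F.s := (Nat.prime_two.pow_dvd_iff_le_factorization F.s_ne_zero).2 (by omega)
      exact_mod_cast this
    obtain ⟨i', l, hb, hl⟩ := exists_dvd_sub_pow g g'
    have h1 := g'.conj_mem hxA i' l
    rw [← hb] at h1
    have h2 : g.b * x * g.b⁻¹ = g.a ^ (i * (g.t - 1)) * x := by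
      rw [hij]
      calc g.b * (g.a ^ i * g.b ^ j) * g.b⁻¹
          = (g.b * g.a ^ i * g.b⁻¹) * (g.b * g.b ^ j * g.b⁻¹) := by group
        _ = g.a ^ (i * g.t) * g.b ^ j := by
            rw [g.conj_zpow, ← pow_succ', pow_succ, mul_inv_cancel_right]
        _ = _ := by rw [← mul_assoc, ← zpow_add]; congr 2; ring
    -- This is `(b x b⁻¹) * x`. Its exponent vanishes modulo `2 ^ μ`, because there `t ≡ -1`, `t ^ j
    -- ≡ 1` and `c ≡ 0`.
    have h3 : x ^ (g'.t ^ l + 1) = g.a ^ (i * (g.t + g.t ^ j) + c * y) := by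
      rw [zpow_add, ← h1, zpow_one, h2, mul_assoc, ← pow_two, hx2, hy, pow_mul, hc, ← zpow_natCast,
        ← zpow_mul, ← zpow_add, ← zpow_add]
      congr 1
      ring
    have h4 : (2 : ℤ) ^ μ ∣ i * (g.t + g.t ^ j) + c * y := by
      refine dvd_add (Dvd.dvd.mul_left ?_ _) (hcμ.mul_right _)
      have := dvd_add hr.2 (hr.2.trans (add_one_dvd_pow_sub_one g.t hjeven))
      rwa [show g.t + 1 + (g.t ^ j - 1) = g.t + g.t ^ j by ring] at this
    have h5 := g.two_pow_dvd_of_zpow_eq hμ hxo h3 h4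
    have h6 : (4 : ℤ) ∣ g'.t ^ l + 1 := dvd_trans (pow_dvd_pow (2 : ℤ) h2m) h5
    exact two_pow_dvd_add_one_of_pow (by omega) (odd_of_four_dvd_pow_add_one ht' h6) h5

/-- Both `s_2` and `s'_2` are `m_2` or `m_2 / 2`, so the only case to exclude is `s_2 = m_2`, `s'_2
= m_2 / 2`. Then the geometric sum attached to `b' = a ^ i * b ^ j` is not divisible by `m_2`, which
forces `j` even, `m_2 = 4` and `n_2 = 2`. The 2-part of `a'`, of order 4, then involves an odd power
of `b`, and its square would be trivial. -/
theorem factorization_s_le_of_eps_neg (g : Gen F) (g' : Gen F') (hF : F.Reduced)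
    (he : F.eps = -1) (he' : F'.eps = -1)
    (hm : F.m.factorization 2 = F'.m.factorization 2) (hν : 2 ∉ F.ν) :
    F.s.factorization 2 ≤ F'.s.factorization 2 := by
  have hs1 := g.factorization_m_le_s_add_one he
  have hs1' := g'.factorization_m_le_s_add_one he'
  have hs2 := g.factorization_s_le 2
  have hs2' := g'.factorization_s_le 2
  have hns := (hF.neg he).1
  have hle := g.factorization_m_le_r_add_n Nat.prime_two hν
  have h2r := g.two_le_factorization_r he
  have hrm := F.factorization_r_le 2
  have hr := ((g.two_pow_dvd_r_iff_of_eps he _).1 (Nat.ordProj_dvd F.r 2)).2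
  have ht := (g.eps_eq_neg_one_iff.1 he).2
  have ht' := (g'.eps_eq_neg_one_iff.1 he').2
  by_contra! hlt
  obtain ⟨μ, hμ⟩ : ∃ μ, F.m.factorization 2 = μ := ⟨_, rfl⟩
  have hsμ : F.s.factorization 2 = μ := by omega
  obtain ⟨i, j, hb, hj⟩ := exists_dvd_sub_pow_right g g'
  have hn2 := g.even_n_of_eps_neg he
  have hndvd : ∀ e, e ≤ F.n.factorization 2 → 2 ^ e ∣ F.n := fun e h =>
    (Nat.prime_two.pow_dvd_iff_le_factorization F.n_ne_zero).2 h
  have hnot : ¬ ((2 : ℕ) : ℤ) ^ μ ∣ ∑ l ∈ Finset.range F.n, (g.t ^ j) ^ l := by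
    intro h
    have := le_factorization_s g g' Nat.prime_two hb hsμ.ge h
    omega
  -- For odd `j` the sum is divisible by `r_2 * n_2 / 2`. This is a multiple of `m_2`, because `m_2
  -- ∣ r_2 * n_2` and `m_2 = s_2 ≠ r_2 * n_2`.
  have hjeven : Even j := by
    by_contra hodd
    have hj1 := add_one_dvd_pow_add_one g.t (Nat.not_even_iff_odd.1 hodd)
    refine hnot ?_
    obtain ⟨n', hn'⟩ := hn2
    rw [hn', Nat.cast_ofNat, two_pow_dvd_geom_sum_iff (ht.trans hj1)]
    have h1 : (2 : ℤ) ^ (F.n.factorization 2 - 1) ∣ n' := by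
      have hn1 : 1 ≤ F.n.factorization 2 :=
        Nat.prime_two.factorization_pos_of_dvd F.n_ne_zero (hn' ▸ dvd_mul_right _ _)
      have h2 := hndvd _ le_rfl
      nth_rewrite 2 [hn'] at h2
      obtain ⟨e, he⟩ := Nat.exists_eq_add_of_le' hn1
      rw [he] at h2 ⊢
      rw [pow_succ', Nat.mul_dvd_mul_iff_left two_pos] at h2
      exact_mod_cast h2
    refine dvd_trans ?_ (mul_dvd_mul (hr.trans hj1) h1)
    rw [← pow_add]
    exact pow_dvd_pow _ (by omega)
  have hμ2 : μ = 2 := by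
    by_contra hne
    have h1 : (2 : ℤ) ^ 2 ∣ Nat.card (commutator G) :=
      g.two_pow_dvd_card_commutator he (by omega)
    exact Nat.not_odd_iff_even.2 hjeven (odd_of_four_dvd_sub_pow ht ht' (h1.trans hj))
  subst hμ2
  have hn1 : F.n.factorization 2 = 1 := by
    refine le_antisymm ?_ (Nat.prime_two.factorization_pos_of_dvd F.n_ne_zero hn2)
    by_contra! h
    refine hnot (pow_dvd_geom_sum Nat.prime_two ?_ (hndvd 2 h))
    exact ((g.two_dvd_t_sub_one (dvd_trans (by norm_num)
      (g.eps_eq_neg_one_iff.1 he).1)).trans (sub_one_dvd_pow_sub_one _ _))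
  set K := ordCompl[2] F'.m with hK
  have hKodd : ¬ 2 ∣ K := Nat.not_dvd_ordCompl Nat.prime_two F'.m_ne_zero
  set x := g'.a ^ K with hx
  have hxo : orderOf x = 2 ^ 2 := by
    have h := orderOf_two_part F' g'
    rw [← hK, ← hx, ← hm, hμ] at h
    exact h
  obtain ⟨i₁, j₁, hij⟩ := g.exists_eq x
  have hx2 : x ^ 2 = g.a ^ (i₁ * (1 + g.t ^ j₁)) * g.b ^ (j₁ * 2) := by
    rw [hij, g.mul_pow, Finset.sum_range_succ, Finset.sum_range_one, pow_zero, pow_one]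
  have hnj : F.n ∣ j₁ * 2 := by
    rw [← g.pow_b_mem_iff]
    have h1 := g.commutator_le (sq_mem_commutator g' he')
    rw [← hK, ← hx, hx2] at h1
    exact (F.A.mul_mem_cancel_left (F.A.zpow_mem g.a_mem _)).1 h1
  -- `a'` and `b'` generate `G`, and `G / A` is cyclic of even order on `b`. As `b'` maps to an even
  -- power of `b`, the generator `a'` and its odd power `x` map to odd ones.
  have hj₁ : Odd j₁ := by
    have := F.normal
    have hq : ∀ (z : ℤ) (l : ℕ), ((g.a ^ z * g.b ^ l : G) : G ⧸ F.A) = (g.b : G ⧸ F.A) ^ l := by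
      intro z l
      rw [QuotientGroup.mk_mul, (QuotientGroup.eq_one_iff _).2 ((g.mem_A _).2 ⟨z, rfl⟩),
        one_mul, QuotientGroup.mk_pow]
    obtain ⟨y, z, hyz⟩ := g.exists_eq g'.a
    obtain ⟨α, β, hαβ⟩ := g'.exists_eq g.b
    have h1 := congrArg (QuotientGroup.mk (s := F.A)) hij
    rw [hx, hq, QuotientGroup.mk_pow, hyz, hq, ← pow_mul, ← zpow_natCast, ← zpow_natCast,
      zpow_eq_zpow_iff_dvd, g.orderOf_mk_b] at h1
    have h2 := congrArg (QuotientGroup.mk (s := F.A)) hαβ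
    rw [QuotientGroup.mk_mul, QuotientGroup.mk_zpow, QuotientGroup.mk_pow, hyz, hb, hq, hq,
      ← zpow_natCast, ← zpow_natCast, ← zpow_natCast, ← zpow_mul, ← zpow_mul, ← zpow_add,
      ← zpow_one (g.b : G ⧸ F.A), ← zpow_mul, zpow_eq_zpow_iff_dvd, g.orderOf_mk_b] at h2
    have hn2' : (2 : ℤ) ∣ F.n := by exact_mod_cast hn2
    have h3 := hn2'.trans h1
    have h4 := hn2'.trans h2
    by_contra hodd
    have e1 : (2 : ℤ) ∣ j₁ := by exact_mod_cast (Nat.not_odd_iff_even.1 hodd).two_dvd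
    have e2 : (2 : ℤ) ∣ j := by exact_mod_cast hjeven.two_dvd
    have e3 : (2 : ℤ) ∣ (z : ℤ) * K := by
      have := dvd_add h3 e1
      push_cast at this
      simpa using this
    have e4 : (2 : ℤ) ∣ z := by
      refine (Int.prime_two.dvd_or_dvd e3).resolve_right ?_
      exact_mod_cast hKodd
    have e5 : (2 : ℤ) ∣ (z : ℤ) * α + j * β := dvd_add (e4.mul_right _) (e2.mul_right _)
    omega
  obtain ⟨y, hy⟩ := hnj
  obtain ⟨c, hc, hcs⟩ := g.exists_pow_b_eq
  have hcμ : (2 : ℤ) ^ 2 ∣ c := by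
    refine dvd_trans ?_ (s_dvd_c hcs)
    have : 2 ^ 2 ∣ F.s := (Nat.prime_two.pow_dvd_iff_le_factorization F.s_ne_zero).2 hsμ.ge
    exact_mod_cast this
  have h3 : x ^ (2 : ℤ) = g.a ^ (i₁ * (1 + g.t ^ j₁) + c * y) := by
    rw [← Nat.cast_ofNat, zpow_natCast, hx2, hy, pow_mul, hc, ← zpow_natCast, ← zpow_mul,
      ← zpow_add]
  have h4 : (2 : ℤ) ^ 2 ∣ i₁ * (1 + g.t ^ j₁) + c * y := by
    refine dvd_add (Dvd.dvd.mul_left ?_ _) (hcμ.mul_right _)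
    rw [add_comm]
    exact ht.trans (add_one_dvd_pow_add_one g.t hj₁)
  have h5 := g.two_pow_dvd_of_zpow_eq hμ hxo h3 h4
  norm_num at h5

theorem factorization_le_of_reduced (g : Gen F) (g' : Gen F') (hF : F.Reduced) {p : ℕ}
    (hp : p.Prime) :
    F.m.factorization p ≤ F'.m.factorization p ∧
      (F.m.factorization p = F'.m.factorization p →
        F.r.factorization p ≤ F'.r.factorization p ∧
          F.s.factorization p ≤ F'.s.factorization p) := by
  by_cases hν : p ∈ F.ν
  · have hν' := ν_subset g g' hν
    rw [g.factorization_m_of_mem_ν hν, g'.factorization_m_of_mem_ν hν', factorization_r_of_mem_ν hν,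
      g.factorization_s_of_mem_ν hν, g'.factorization_s_of_mem_ν hν',
      g.factorization_m_of_mem_ν hν, g'.factorization_m_of_mem_ν hν']
    exact ⟨le_rfl, fun _ => ⟨Nat.zero_le _, le_rfl⟩⟩
  by_cases hpm : p ∣ F.m
  swap
  · have h1 := g.factorization_s_le p
    have h2 := F.factorization_r_le p
    rw [Nat.factorization_eq_zero_of_not_dvd hpm] at h1 h2 ⊢
    omega
  rcases F.eps_pow_eq_one_or hp with he | ⟨rfl, he⟩
  · have hpr : p ∣ F.r := by
      by_contra h
      exact hν (F.mem_ν.2 ⟨hp, hpm, h⟩)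
    obtain ⟨h1, h2⟩ := hF.pos p hp hpr he
    have hn : F'.n.factorization p ≤ F.n.factorization p := by
      rcases h2 with h2 | h2
      · exact factorization_n_le_of_r_le_s g g' hp he h1 h2
      · exact factorization_n_le_of_n_lt g g' hp hν h1 h2
    have hmn := factorization_m_add_n F F' p
    exact ⟨by omega, fun h => ⟨factorization_r_le_of_eps g g' hp he h,
      factorization_s_le_of_s_le_n g g' hp hν h1⟩⟩
  · obtain ⟨h1, h2⟩ := factorization_m_le_of_eps_neg g g' he
    exact ⟨h1, fun h => ⟨factorization_r_le_of_eps_neg g g' hF he (h2 h) h,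
      factorization_s_le_of_eps_neg g g' hF he (h2 h) h hν⟩⟩

end Gen

namespace Factorization

variable {G : Type*} [Group G] [Finite G] {F : Factorization G}

/-- The comparison holds at each prime separately, so `m ∣ m'`, and if `m = m'` also `r ∣ r'` and `s
∣ s'`; divisibility gives the lexicographic inequality. -/
theorem Reduced.isMinimal (hF : F.Reduced) : F.IsMinimal := by
  intro F'
  obtain ⟨g⟩ := F.exists_gen
  obtain ⟨g'⟩ := F'.exists_gen
  have key := fun (p : ℕ) (hp : p.Prime) => Gen.factorization_le_of_reduced g g' hF hp
  have hm : F.m ∣ F'.m :=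
    (Nat.factorization_prime_le_iff_dvd F.m_ne_zero F'.m_ne_zero).1 fun p hp => (key p hp).1
  rw [Prod.Lex.toLex_le_toLex, Prod.Lex.toLex_le_toLex]
  rcases (Nat.le_of_dvd (Nat.pos_of_ne_zero F'.m_ne_zero) hm).lt_or_eq with h | h
  · exact Or.inl h
  refine Or.inr ⟨h, ?_⟩
  have hr : F.r ∣ F'.r := (Nat.factorization_prime_le_iff_dvd F.r_ne_zero F'.r_ne_zero).1
    fun p hp => ((key p hp).2 (h ▸ rfl)).1
  have hs : F.s ∣ F'.s := (Nat.factorization_prime_le_iff_dvd F.s_ne_zero F'.s_ne_zero).1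
    fun p hp => ((key p hp).2 (h ▸ rfl)).2
  rcases (Nat.le_of_dvd (Nat.pos_of_ne_zero F'.r_ne_zero) hr).lt_or_eq with h' | h'
  · exact Or.inl h'
  · exact Or.inr ⟨h', Nat.le_of_dvd (Nat.pos_of_ne_zero F'.s_ne_zero) hs⟩

end Factorization

/-! ### Minimal factorizations are reduced -/

/-- The choice `u = 1` works unless the sum is `≡ S` mod `p * R`. In that case `u = 1 + R / S`
leaves the sum unchanged modulo `p * R`, since `T ^ (h * R / S) ≡ 1`, while `S * u` grows by `R`. -/
theorem not_dvd_of_dvd_geom_sum {p R S h : ℕ} (hp : p.Prime) {ρ ς : ℕ} (hR : R = p ^ ρ)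
    (hS : S = p ^ ς) (hlt : ς < ρ) {T : ℤ} (hT : (R : ℤ) ∣ T - 1) :
    ∃ u : ℕ, u ≠ 0 ∧ (R : ℤ) ∣ ∑ l ∈ Finset.range S, (T ^ (h * u)) ^ l - S * u ∧
      ¬ ((p * R : ℕ) : ℤ) ∣ ∑ l ∈ Finset.range S, (T ^ (h * u)) ^ l - S * u := by
  have hD : ∀ u : ℕ, (R : ℤ) ∣ ∑ l ∈ Finset.range S, (T ^ (h * u)) ^ l - S := fun u =>
    dvd_geom_sum_sub (hT.trans (sub_one_dvd_pow_sub_one _ _)) S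
  by_cases h1 : ((p * R : ℕ) : ℤ) ∣ ∑ l ∈ Finset.range S, (T ^ (h * 1)) ^ l - S
  swap
  · exact ⟨1, one_ne_zero, by simpa using hD 1, by simpa using h1⟩
  have hRS : (R : ℤ) = S * p ^ (ρ - ς) := by
    rw [hR, hS]
    push_cast
    rw [← pow_add]
    congr 1
    omega
  have hu : ((p * R : ℕ) : ℤ) ∣ ∑ l ∈ Finset.range S, (T ^ (h * (1 + p ^ (ρ - ς)))) ^ l - S := by
    have h2 : ((p * R : ℕ) : ℤ) ∣ T ^ (h * (1 + p ^ (ρ - ς))) - T ^ (h * 1) := by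
      rw [mul_add, pow_add, ← mul_sub_one]
      refine Dvd.dvd.mul_left ?_ _
      have h3 := pow_dvd_pow_sub_one (k := ρ) (j := 1) (n := h * p ^ (ρ - ς)) hp (by omega)
        (by rw [hR] at hT; exact_mod_cast hT)
        (Dvd.dvd.mul_left (pow_dvd_pow p (show 1 ≤ ρ - ς by omega)) h)
      rw [hR, ← pow_succ']
      exact_mod_cast h3
    have h3 : ((p * R : ℕ) : ℤ) ∣ ∑ l ∈ Finset.range S, (T ^ (h * (1 + p ^ (ρ - ς)))) ^ l -
        ∑ l ∈ Finset.range S, (T ^ (h * 1)) ^ l := by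
      rw [← Finset.sum_sub_distrib]
      exact Finset.dvd_sum fun l _ => h2.trans (sub_dvd_pow_sub_pow _ _ l)
    have := dvd_add h3 h1
    rwa [sub_add_sub_cancel] at this
  have e1 : ∑ l ∈ Finset.range S, (T ^ (h * (1 + p ^ (ρ - ς)))) ^ l -
      S * ((1 + p ^ (ρ - ς) : ℕ) : ℤ) =
      ∑ l ∈ Finset.range S, (T ^ (h * (1 + p ^ (ρ - ς)))) ^ l - S - R := by
    rw [hRS]; push_cast; ring
  refine ⟨1 + p ^ (ρ - ς), by omega, ?_, ?_⟩
  · rw [e1]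
    exact dvd_sub (hD (1 + p ^ (ρ - ς))) (dvd_refl (R : ℤ))
  · intro h4
    rw [e1] at h4
    have h6 : ((p * R : ℕ) : ℤ) ∣ R := by
      have := dvd_sub hu h4
      rwa [sub_sub_cancel] at this
    have hR0 : 0 < R := hR ▸ pow_pos hp.pos _
    have h7 := Nat.le_of_dvd hR0 (by exact_mod_cast h6)
    have := hp.two_le
    nlinarith

theorem int_gcd_eq_prime_pow {p ρ m : ℕ} {Y : ℤ} (hp : p.Prime) (h1 : p ^ ρ ∣ m)
    (h2 : (p : ℤ) ^ ρ ∣ Y) (h3 : p ^ (ρ + 1) ∣ m → ¬ (p : ℤ) ^ (ρ + 1) ∣ Y)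
    (h4 : ∀ q : ℕ, q.Prime → q ∣ m → q ≠ p → ¬ (q : ℤ) ∣ Y) : Int.gcd Y m = p ^ ρ := by
  refine eq_of_prime_pow_dvd_iff fun q k hq => ?_
  have h5 : q ^ k ∣ Int.gcd Y m ↔ (q : ℤ) ^ k ∣ Y ∧ q ^ k ∣ m := by
    rw [Int.dvd_gcd_iff]; norm_cast
  rw [h5]
  rcases eq_or_ne k 0 with rfl | hk
  · simp
  by_cases hqp : q = p
  · subst hqp
    rw [Nat.pow_dvd_pow_iff_le_right hq.one_lt]
    constructor
    · rintro ⟨h6, h7⟩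
      by_contra! hlt
      exact h3 ((pow_dvd_pow _ hlt).trans h7) ((pow_dvd_pow _ hlt).trans h6)
    · intro hle
      exact ⟨(pow_dvd_pow _ hle).trans h2, (pow_dvd_pow _ hle).trans h1⟩
  · constructor
    · rintro ⟨h6, h7⟩
      exact absurd ((dvd_pow_self _ hk).trans h6) (h4 q hq ((dvd_pow_self _ hk).trans h7) hqp)
    · intro h6
      exact absurd ((Nat.prime_dvd_prime_iff_eq hq hp).1
        (hq.dvd_of_dvd_pow ((dvd_pow_self _ hk).trans h6))) hqp

theorem dvd_ordCompl_of_prime {m p q : ℕ} (hp : p.Prime) (hq : q.Prime)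
    (hqm : q ∣ m) (hqp : q ≠ p) : q ∣ ordCompl[p] m := by
  have h3 := Nat.ordProj_mul_ordCompl_eq_self m p
  rw [← h3] at hqm
  exact Nat.Coprime.dvd_of_dvd_mul_left
    (Nat.Coprime.pow_right _ ((Nat.coprime_primes hq hp).2 hqp)) hqm

namespace Gen

variable {G : Type*} [Group G] [Finite G] {F F' : Factorization G}

/-- Replacing the normal factor. -/
theorem exists_gen_of_pow_eq (g : Gen F) {η Y : ℤ} {z S : ℕ} (h : (g.a ^ η * g.b ^ z) ^ S = g.a ^ Y)
    (hY : (Int.gcd Y F.m : ℤ) ∣ g.t - 1) (hη : Int.gcd η F.m = 1) :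
    ∃ (F' : Factorization G) (g' : Gen F'), g'.a = g.a ^ η * g.b ^ z ∧ g'.b = g.b ∧
      F'.m * Int.gcd Y F.m ∣ S * F.m := by
  set a' := g.a ^ η * g.b ^ z with ha'
  -- A subgroup containing `G'` is normal, and `gcd(Y, m) ∣ t - 1` puts `G'` inside `⟨a ^ Y⟩ ≤
  -- ⟨a'⟩`.
  have hcomm : commutator G ≤ Subgroup.zpowers a' := by
    rw [g.commutator_eq, Subgroup.zpowers_le]
    refine (Subgroup.zpowers_le.2 ?_) (g.zpow_mem_zpowers_of_gcd_dvd hY)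
    rw [← h]
    exact Subgroup.pow_mem _ (Subgroup.mem_zpowers _) _
  have hnor : (Subgroup.zpowers a').Normal := by
    refine ⟨fun x hx y => ?_⟩
    have h1 : ⁅y, x⁆ ∈ Subgroup.zpowers a' := hcomm (by
      rw [commutator_def]
      exact Subgroup.commutator_mem_commutator (Subgroup.mem_top _) (Subgroup.mem_top _))
    have h2 : y * x * y⁻¹ = ⁅y, x⁆ * x := by rw [commutatorElement_def]; group
    rw [h2]
    exact Subgroup.mul_mem _ h1 hx
  -- As `η` is a unit modulo `m`, the generator `a` is recovered from `a'` and `b`.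
  have hsup : Subgroup.zpowers a' ⊔ Subgroup.zpowers g.b = ⊤ := by
    have hb : g.b ∈ Subgroup.zpowers a' ⊔ Subgroup.zpowers g.b :=
      Subgroup.mem_sup_right (Subgroup.mem_zpowers _)
    have hη' : g.a ^ η ∈ Subgroup.zpowers a' ⊔ Subgroup.zpowers g.b := by
      have h1 : g.a ^ η = a' * (g.b ^ z)⁻¹ := by rw [ha']; group
      rw [h1]
      exact Subgroup.mul_mem _ (Subgroup.mem_sup_left (Subgroup.mem_zpowers _))
        (Subgroup.inv_mem _ (Subgroup.pow_mem _ hb _))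
    have ha : g.a ∈ Subgroup.zpowers a' ⊔ Subgroup.zpowers g.b := by
      have h1 := g.zpow_mem_zpowers_of_gcd_dvd (Y := η) (z := 1) (by rw [hη]; simp)
      rw [zpow_one] at h1
      exact (Subgroup.zpowers_le.2 hη') h1
    refine eq_top_iff.2 fun x _ => ?_
    obtain ⟨i, j, rfl⟩ := g.exists_eq x
    exact Subgroup.mul_mem _ (Subgroup.zpow_mem _ ha _) (Subgroup.pow_mem _ hb _)
  obtain ⟨t', ht'⟩ := Subgroup.mem_zpowers_iff.1
    (hnor.conj_mem a' (Subgroup.mem_zpowers _) g.b)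
  let F' : Factorization G :=
    { A := Subgroup.zpowers a'
      B := Subgroup.zpowers g.b
      normal := hnor
      cyclicA := inferInstance
      cyclicB := inferInstance
      eq_mul := fun x => by
        have hx : x ∈ Subgroup.zpowers a' ⊔ Subgroup.zpowers g.b := hsup ▸ Subgroup.mem_top x
        obtain ⟨y, hy, w, hw, e⟩ := Subgroup.mem_sup_of_normal_left.1 hx
        exact ⟨y, hy, w, hw, e.symm⟩ }
  refine ⟨F', ⟨a', g.b, t', rfl, rfl, ht'.symm⟩, rfl, rfl, ?_⟩
  have h1 : F'.m = orderOf a' := Nat.card_zpowers a'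
  have h2 : F'.m ∣ S * orderOf (g.a ^ Y) := by
    rw [h1]
    refine orderOf_dvd_of_pow_eq_one ?_
    rw [pow_mul, h, pow_orderOf_eq_one]
  have h3 := orderOf_zpow_mul_gcd g.a Y
  rw [g.orderOf_a] at h3
  conv_rhs => rw [← h3]
  rw [← mul_assoc]
  exact mul_dvd_mul_right h2 _

theorem not_pow_dvd_c {c : ℤ} (hc : Int.gcd c F.m = F.s) {p : ℕ} (hp : p.Prime)
    (h : F.s.factorization p < F.m.factorization p) :
    ¬ (p : ℤ) ^ (F.s.factorization p + 1) ∣ c := by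
  intro h1
  have h2 : p ^ (F.s.factorization p + 1) ∣ F.m :=
    (hp.pow_dvd_iff_le_factorization F.m_ne_zero).2 h
  have h3 : p ^ (F.s.factorization p + 1) ∣ Int.gcd c F.m :=
    Int.dvd_gcd (by exact_mod_cast h1) (by exact_mod_cast h2)
  rw [hc, hp.pow_dvd_iff_le_factorization F.s_ne_zero] at h3
  omega

/-- Replacing `b` by `a ^ K * b`, with `K` the prime-to-`p` part of `m`, keeps `A` and `t` and turns
`c` into `K * S + c`. If the sum `S` lacked divisibility by `s_p`, the new index `s'` would be a
proper divisor of `s`. -/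
theorem pow_dvd_geom_sum_of_isMinimal (g : Gen F) (hF : F.IsMinimal) {p : ℕ} (hp : p.Prime) :
    (p : ℤ) ^ F.s.factorization p ∣ ∑ l ∈ Finset.range F.n, g.t ^ l := by
  by_contra hS
  set S := ∑ l ∈ Finset.range F.n, g.t ^ l with hSdef
  set K := ordCompl[p] F.m with hK
  obtain ⟨c, hc, hcs⟩ := g.exists_pow_b_eq
  set b' := g.a ^ (K : ℤ) * g.b ^ 1 with hb'
  let F' : Factorization G :=
    { A := F.A
      B := Subgroup.zpowers b'
      normal := F.normal
      cyclicA := F.cyclicA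
      cyclicB := inferInstance
      eq_mul := fun x => by
        have := F.normal
        obtain ⟨i, j, rfl⟩ := g.exists_eq x
        refine ⟨g.a ^ i * g.b ^ j * (b' ^ j)⁻¹, ?_, b' ^ j,
          Subgroup.pow_mem _ (Subgroup.mem_zpowers _) _, by group⟩
        rw [← QuotientGroup.eq_one_iff]
        have ha : ∀ z : ℤ, ((g.a ^ z : G) : G ⧸ F.A) = 1 := fun z =>
          (QuotientGroup.eq_one_iff _).2 ((g.mem_A _).2 ⟨z, rfl⟩)
        rw [QuotientGroup.mk_mul, QuotientGroup.mk_mul, QuotientGroup.mk_inv, QuotientGroup.mk_pow,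
          QuotientGroup.mk_pow, hb', QuotientGroup.mk_mul, ha, ha, pow_one, one_mul, one_mul,
          mul_inv_cancel] }
  let g' : Gen F' := ⟨g.a, b', g.t, g.hA, rfl, by
    rw [hb', g.conj_mem g.a_mem, pow_one]⟩
  have hle : F.s ≤ F'.s := by
    have h1 := hF F'
    rw [Prod.Lex.toLex_le_toLex, Prod.Lex.toLex_le_toLex] at h1
    rcases h1 with h1 | ⟨-, h1 | ⟨-, h1⟩⟩
    · exact absurd h1 (lt_irrefl F.m)
    · exact absurd h1 (lt_irrefl F.r)
    · exact h1
  obtain ⟨c', hc', hcs'⟩ := g'.exists_pow_b_eq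
  have hX : (F.m : ℤ) ∣ (K * S + c) - c' := by
    have h1 : b' ^ F.n = g.a ^ c' := hc'
    have h2 : b' ^ F.n = g.a ^ (K * S + c) := by
      rw [hb', g.mul_pow, one_mul, hc, pow_one, ← zpow_add]
    rw [h2, g.zpow_eq_iff] at h1
    exact h1
  have hs'X : (F'.s : ℤ) ∣ K * S + c := by
    have h1 : (F'.s : ℤ) ∣ F.m := by exact_mod_cast g'.s_dvd_m
    exact (dvd_sub_left (s_dvd_c hcs')).1 (h1.trans hX)
  have hpK : ¬ p ∣ K := Nat.not_dvd_ordCompl hp F.m_ne_zero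
  have hplt : F'.s.factorization p < F.s.factorization p := by
    by_contra! h1
    have h2 : (p : ℤ) ^ F.s.factorization p ∣ F'.s := by
      have : p ^ F.s.factorization p ∣ F'.s :=
        (hp.pow_dvd_iff_le_factorization F'.s_ne_zero).2 h1
      exact_mod_cast this
    have h3 : (p : ℤ) ^ F.s.factorization p ∣ c := by
      refine dvd_trans ?_ (s_dvd_c hcs)
      exact_mod_cast Nat.ordProj_dvd F.s p
    have h4 : (p : ℤ) ^ F.s.factorization p ∣ K * S := (dvd_add_left h3).1 (h2.trans hs'X)
    exact hS ((Nat.prime_iff_prime_int.1 hp).pow_dvd_of_dvd_mul_left _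
      (by exact_mod_cast hpK) h4)
  have hdvd : F'.s ∣ F.s := by
    refine (Nat.factorization_prime_le_iff_dvd F'.s_ne_zero F.s_ne_zero).1 fun q hq => ?_
    by_cases hqp : q = p
    · subst hqp; exact hplt.le
    · have h1 : q ^ F'.s.factorization q ∣ F.m := (Nat.ordProj_dvd _ _).trans g'.s_dvd_m
      have h2 : q ^ F'.s.factorization q ∣ K := by
        have h3 := Nat.ordProj_mul_ordCompl_eq_self F.m p
        rw [← h3] at h1
        refine Nat.Coprime.dvd_of_dvd_mul_left ?_ h1
        exact Nat.Coprime.pow _ _ ((Nat.coprime_primes hq hp).2 hqp)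
      have h3 : (q : ℤ) ^ F'.s.factorization q ∣ c := by
        have h4 : (q : ℤ) ^ F'.s.factorization q ∣ F'.s := by
          exact_mod_cast Nat.ordProj_dvd F'.s q
        have h5 : (q : ℤ) ^ F'.s.factorization q ∣ K := by exact_mod_cast h2
        exact (dvd_add_right (h5.mul_right S)).1 (h4.trans hs'X)
      rw [← hq.pow_dvd_iff_le_factorization F.s_ne_zero, ← hcs]
      exact Int.dvd_gcd (by exact_mod_cast h3) (by exact_mod_cast h1)
  have h1 := Nat.le_antisymm hle (Nat.le_of_dvd (Nat.pos_of_ne_zero F.s_ne_zero) hdvd)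
  rw [← h1] at hplt
  exact lt_irrefl _ hplt

/-- The sum has the same `p`-part as `n`, except possibly for `p = 2` and `t ≡ -1` mod 4. With `ε =
1` that exception forces `4 ∤ m`, so `s_2 ≤ 2` and parity suffices. -/
theorem factorization_s_le_n_of_isMinimal (g : Gen F) (hF : F.IsMinimal) {p : ℕ} (hp : p.Prime)
    (hpr : p ∣ F.r) (he : F.eps ^ (p - 1) = 1) :
    F.s.factorization p ≤ F.n.factorization p := by
  have h1 := g.pow_dvd_geom_sum_of_isMinimal hF hp
  have hpm := hpr.trans F.r_dvd_m
  have hpt : (p : ℤ) ∣ g.t - 1 :=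
    g.dvd_t_sub_one hp hpm fun h => (F.mem_ν.1 h).2.2 hpr
  by_cases h4 : p = 2 → (4 : ℤ) ∣ g.t - 1
  · rwa [pow_dvd_geom_sum_iff hp hpt h4, hp.pow_dvd_iff_le_factorization F.n_ne_zero] at h1
  · push Not at h4
    obtain ⟨rfl, h4⟩ := h4
    have hm4 : ¬ 2 ^ 2 ∣ F.m := fun h => h4 (g.four_dvd_t_sub_one (by simpa using he) h)
    rw [Nat.prime_two.pow_dvd_iff_le_factorization F.m_ne_zero] at hm4
    have hs := g.factorization_s_le 2
    rcases Nat.eq_zero_or_pos (F.s.factorization 2) with h0 | h0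
    · omega
    have hs1 : F.s.factorization 2 = 1 := by omega
    rw [hs1, pow_one] at h1
    have h2 := (dvd_sub_right h1).1 (dvd_geom_sum_sub hpt F.n)
    rw [hs1]
    exact Nat.prime_two.factorization_pos_of_dvd F.n_ne_zero (by exact_mod_cast h2)

/-- The sum has the 2-part of `(t + 1) * n / 2`. If it were divisible by `s_2 = n_2 * r_2`, then `2
* r_2 ∣ t + 1`; as `r_2 < s_2 ≤ m_2`, this contradicts the maximality of `r`. -/
theorem factorization_s_ne_of_isMinimal (g : Gen F) (hF : F.IsMinimal) (he : F.eps = -1) :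
    F.s.factorization 2 ≠ F.n.factorization 2 + F.r.factorization 2 := by
  intro heq
  have h1 := g.pow_dvd_geom_sum_of_isMinimal hF Nat.prime_two
  obtain ⟨n', hn'⟩ := g.even_n_of_eps_neg he
  have hn1 := Nat.prime_two.factorization_pos_of_dvd F.n_ne_zero (hn' ▸ dvd_mul_right _ _)
  have hs := g.factorization_s_le 2
  rw [hn', Nat.cast_ofNat, two_pow_dvd_geom_sum_iff (g.eps_eq_neg_one_iff.1 he).2] at h1
  have h2 : ((2 : ℕ) : ℤ) ^ (F.s.factorization 2 + 1) ∣ (g.t + 1) * (F.n : ℤ) := by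
    rw [hn', pow_succ']
    push_cast
    rw [mul_left_comm]
    exact mul_dvd_mul_left 2 h1
  have h3 := le_factorization_of_int_dvd Nat.prime_two F.n_ne_zero
    (pow_dvd_pow_mul_of_not_dvd Nat.prime_two h2 (g.not_two_pow_dvd_t_add_one he (by omega)))
  omega

theorem n_dvd_orderOf_b (g : Gen F) : F.n ∣ orderOf g.b := by
  rw [← g.pow_b_mem_iff, pow_orderOf_eq_one]; exact F.A.one_mem

/-- Raising `b` to the prime-to-`p` part of its order leaves a `p`-element; its power lying in `A`
is `a ^ ζ`, where `ζ` has `p`-part exactly `s_p`. The new normal factors are built from it. -/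
theorem exists_pow_b_p_part (g : Gen F) {p : ℕ} (hp : p.Prime)
    (h : F.s.factorization p < F.m.factorization p) :
    ∃ ζ : ℤ, g.b ^ (ordCompl[p] (orderOf g.b) * p ^ F.n.factorization p) = g.a ^ ζ ∧
      ((ordCompl[p] F.m : ℕ) : ℤ) ∣ ζ ∧ (p : ℤ) ^ F.s.factorization p ∣ ζ ∧
      ¬ (p : ℤ) ^ (F.s.factorization p + 1) ∣ ζ := by
  obtain ⟨c, hc, hcs⟩ := g.exists_pow_b_eq
  have hpi := Nat.prime_iff_prime_int.1 hp
  have hb0 : orderOf g.b ≠ 0 := (orderOf_pos g.b).ne'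
  set f := ordCompl[p] (orderOf g.b) with hf
  have hf0 : f ≠ 0 := (Nat.ordCompl_pos p hb0).ne'
  have hpf : ¬ p ∣ f := Nat.not_dvd_ordCompl hp hb0
  obtain ⟨e, he⟩ : F.n ∣ p ^ F.n.factorization p * f :=
    dvd_mul_ordCompl g.n_dvd_orderOf_b hb0 (pow_ne_zero _ hp.ne_zero)
      (by rw [hp.factorization_pow, Finsupp.single_eq_same])
  have hpe : ¬ (p : ℤ) ∣ e := by
    intro h1
    have h2 : p ∣ e := by exact_mod_cast h1
    have h3 : p ^ (F.n.factorization p + 1) ∣ p ^ F.n.factorization p * f := by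
      rw [he, pow_succ]
      exact mul_dvd_mul (Nat.ordProj_dvd _ _) h2
    rw [pow_succ, Nat.mul_dvd_mul_iff_left (pow_pos hp.pos _)] at h3
    exact hpf h3
  have hbz : g.b ^ (f * p ^ F.n.factorization p) = g.a ^ (c * e) := by
    rw [mul_comm, he, pow_mul, hc, ← zpow_natCast, ← zpow_mul]
  refine ⟨c * e, hbz, ?_, ?_, ?_⟩
  · have h1 : g.a ^ (c * e * ((p ^ (orderOf g.b).factorization p : ℕ) : ℤ)) = 1 := by
      rw [zpow_mul, ← hbz, zpow_natCast, ← pow_mul]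
      have h2 := Nat.ordProj_mul_ordCompl_eq_self (orderOf g.b) p
      rw [← hf] at h2
      rw [show f * p ^ F.n.factorization p * p ^ (orderOf g.b).factorization p =
        (p ^ (orderOf g.b).factorization p * f) * p ^ F.n.factorization p by ring, h2, pow_mul,
        pow_orderOf_eq_one, one_pow]
    rw [g.zpow_eq_one_iff] at h1
    have h2 : ((ordCompl[p] F.m : ℕ) : ℤ) ∣ F.m := by exact_mod_cast Nat.ordCompl_dvd F.m p
    have h3 : IsCoprime ((ordCompl[p] F.m : ℕ) : ℤ)
        ((p ^ (orderOf g.b).factorization p : ℕ) : ℤ) := by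
      rw [Nat.isCoprime_iff_coprime]
      exact ((Nat.coprime_ordCompl hp F.m_ne_zero).symm).pow_right _
    exact h3.dvd_of_dvd_mul_right (h2.trans h1)
  · refine Dvd.dvd.mul_right (dvd_trans ?_ (s_dvd_c hcs)) _
    exact_mod_cast Nat.ordProj_dvd F.s p
  · intro h1
    exact not_pow_dvd_c hcs hp h (hpi.pow_dvd_of_dvd_mul_right _ hpe h1)

/-- For `q ∈ ν` the order of `t` modulo `m_ν` divides the exponent: its `p`-part is `o_p`, and its
other part divides that of `orderOf b`. For `q ∉ ν` already `t ≡ 1` mod `q`. -/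
theorem dvd_pow_mul_sub_one (g : Gen F) {p q y : ℕ} (hp : p ∉ F.ν) (hq : q.Prime) (hqm : q ∣ F.m)
    (hy0 : y ≠ 0) (hy : F.o.factorization p ≤ y.factorization p) :
    (q : ℤ) ∣ g.t ^ (ordCompl[p] (orderOf g.b) * y) - 1 := by
  by_cases hqν : q ∈ F.ν
  · obtain ⟨k, hk0, hk, ho⟩ := g.o_spec
    have ho' := ho p
    rw [if_neg hp] at ho'
    have hkn : k ∣ F.n :=
      (hk _).1 (dvd_trans (by exact_mod_cast piPart_dvd _ _) g.m_dvd_pow_sub_one)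
    have h1 : k ∣ y * ordCompl[p] (orderOf g.b) :=
      dvd_mul_ordCompl (hkn.trans g.n_dvd_orderOf_b) (orderOf_pos g.b).ne' hy0 (by omega)
    rw [mul_comm] at h1
    refine dvd_trans ?_ ((hk _).2 h1)
    have h2 : q ∣ piPart F.ν F.m := (Nat.dvd_ordProj_of_dvd F.m_ne_zero hq hqm).trans
      (Finset.dvd_prod_of_mem (fun p => ordProj[p] F.m) hqν)
    exact_mod_cast h2
  · exact (g.dvd_t_sub_one hq hqm hqν).trans (sub_one_dvd_pow_sub_one _ _)

/-- If `s_p < r_p` and `s_p * o_p ∣ n_p`, a smaller normal factor exists. Its generator `a'`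
satisfies `a' ^ S = a ^ Y` with `gcd(Y, m) = R`, so its order divides `m * S / R < m`. -/
theorem not_of_isMinimal_of_lt (g : Gen F) (hF : F.IsMinimal) {p : ℕ} (hp : p.Prime)
    (hpr : p ∣ F.r) (he : F.eps ^ (p - 1) = 1)
    (hsn : F.s.factorization p ≤ F.n.factorization p)
    (hsr : F.s.factorization p < F.r.factorization p) :
    F.n.factorization p < F.s.factorization p + F.o.factorization p := by
  by_contra! hso
  have hpν : p ∉ F.ν := fun h => (F.mem_ν.1 h).2.2 hpr
  have hpi := Nat.prime_iff_prime_int.1 hp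
  have hrm := F.factorization_r_le p
  obtain ⟨ζ, hbζ, hKζ, ⟨ξ, rfl⟩, hnζ⟩ := g.exists_pow_b_p_part hp (by omega)
  set K := ordCompl[p] F.m with hK
  set f := ordCompl[p] (orderOf g.b) with hf
  set S := p ^ F.s.factorization p with hS
  set R := p ^ F.r.factorization p with hR
  set P := p ^ F.m.factorization p with hP
  have hpξ : ¬ (p : ℤ) ∣ ξ := fun h => hnζ (by rw [pow_succ]; exact mul_dvd_mul_left _ h)
  have hKξ : (K : ℤ) ∣ ξ := by
    have h3 : IsCoprime (K : ℤ) ((p : ℤ) ^ F.s.factorization p) := by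
      refine IsCoprime.pow_right ?_
      rw [Nat.isCoprime_iff_coprime]
      exact (Nat.coprime_ordCompl hp F.m_ne_zero).symm
    exact h3.dvd_of_dvd_mul_left hKζ
  have hRt : (R : ℤ) ∣ g.t - 1 := by
    have h1 := ((g.pow_dvd_r_iff_of_eps hp he _).1 (Nat.ordProj_dvd F.r p)).2
    exact_mod_cast h1
  -- `h = n_p / s_p`: the `S`-th power of `b ^ (f * h)` is `a ^ ζ`, and `o_p ∣ h` makes the action
  -- trivial modulo the primes `q ≠ p` of `m`.
  obtain ⟨h, hh⟩ : ∃ h, h = p ^ (F.n.factorization p - F.s.factorization p) := ⟨_, rfl⟩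
  have hhS : h * S = p ^ F.n.factorization p := by
    rw [hh, hS, ← pow_add]; congr 1; omega
  obtain ⟨u, hu0, hu1, hu2⟩ := not_dvd_of_dvd_geom_sum (h := h) hp hR hS hsr
    (hRt.trans (sub_one_dvd_pow_sub_one g.t f))
  rw [← pow_mul] at hu1 hu2
  set D := ∑ l ∈ Finset.range S, (g.t ^ (f * (h * u))) ^ l with hD
  -- `Y = P * D - ξ * (D - S * u)`. The choice of `u` gives the second term the exact `p`-part `R`.
  -- Modulo the other primes of `m` the integer `ξ` vanishes, and the summand `P` keeps `P - ξ` and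
  -- `Y` nonzero there.
  set Y : ℤ := (P - ξ) * D + ξ * S * u with hY
  have hpow : (g.a ^ ((P : ℤ) - ξ) * g.b ^ (f * (h * u))) ^ S = g.a ^ Y := by
    rw [g.mul_pow, show f * (h * u) * S = (f * (h * S)) * u by ring, hhS,
      pow_mul g.b, hbζ, ← zpow_natCast, ← zpow_mul, ← zpow_add, hY, hS]
    congr 1
    push_cast
    ring
  have hh0 : h ≠ 0 := hh ▸ pow_ne_zero _ hp.ne_zero
  have hq : ∀ q : ℕ, q.Prime → q ∣ F.m → q ≠ p → ¬ (q : ℤ) ∣ Y := by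
    intro q hq hqm hqp h1
    have h2 : (q : ℤ) ∣ g.t ^ (f * (h * u)) - 1 := by
      refine g.dvd_pow_mul_sub_one hpν hq hqm (mul_ne_zero hh0 hu0) ?_
      rw [Nat.factorization_mul hh0 hu0, Finsupp.add_apply, hh, hp.factorization_pow,
        Finsupp.single_eq_same]
      omega
    have h3 := dvd_geom_sum_sub h2 S
    have h4 : (q : ℤ) ∣ ξ := dvd_trans (by exact_mod_cast dvd_ordCompl_of_prime hp hq hqm hqp) hKξ
    have h5 : (q : ℤ) ∣ P * S := by
      have h6 : (P * S : ℤ) = Y - ξ * (S * u - D) - P * (D - S) := by rw [hY]; ring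
      rw [h6]
      exact dvd_sub (dvd_sub h1 (h4.mul_right _)) (h3.mul_left _)
    have h7 : q ∣ P * S := by exact_mod_cast h5
    rw [hP, hS, ← pow_add] at h7
    exact hqp ((Nat.prime_dvd_prime_iff_eq hq hp).1 (hq.dvd_of_dvd_pow h7))
  have hgcd : Int.gcd Y F.m = p ^ F.r.factorization p := by
    have hYX : Y = P * D - ξ * (D - S * u) := by rw [hY]; ring
    have hRP : R ∣ P := pow_dvd_pow p hrm
    refine int_gcd_eq_prime_pow hp ((Nat.ordProj_dvd _ _).trans F.r_dvd_m) ?_ ?_ hq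
    · rw [hYX]
      refine dvd_sub (Dvd.dvd.mul_right ?_ _) (Dvd.dvd.mul_left ?_ _)
      · exact_mod_cast hRP
      · exact_mod_cast hu1
    · intro h1 h2
      rw [hp.pow_dvd_iff_le_factorization F.m_ne_zero] at h1
      have h3 : (p : ℤ) ^ (F.r.factorization p + 1) ∣ P := by
        rw [hP]; push_cast; exact pow_dvd_pow _ h1
      have h4 : (p : ℤ) ^ (F.r.factorization p + 1) ∣ ξ * (D - S * u) := by
        have h5 := dvd_sub (h3.mul_right D) h2
        rwa [hYX, sub_sub_cancel] at h5
      refine hu2 ?_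
      have h6 := hpi.pow_dvd_of_dvd_mul_left _ hpξ h4
      rw [hR, ← pow_succ']
      exact_mod_cast h6
  have hη : Int.gcd ((P : ℤ) - ξ) F.m = 1 := by
    have hp1 : 1 ≤ F.m.factorization p := by omega
    have := int_gcd_eq_prime_pow (ρ := 0) (m := F.m) (Y := (P : ℤ) - ξ) hp (by simp) (by simp) ?_ ?_
    · simpa using this
    · intro _ h1
      rw [zero_add, pow_one] at h1
      have h2 : (p : ℤ) ∣ P := by
        rw [hP]; push_cast; exact dvd_pow_self _ (by omega)
      exact hpξ ((dvd_sub_right h2).1 h1)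
    · intro q hq hqm hqp h1
      have h4 : (q : ℤ) ∣ ξ :=
        dvd_trans (by exact_mod_cast dvd_ordCompl_of_prime hp hq hqm hqp) hKξ
      have h5 : (q : ℤ) ∣ P := (dvd_sub_left h4).1 h1
      have h7 : q ∣ P := by exact_mod_cast h5
      exact hqp ((Nat.prime_dvd_prime_iff_eq hq hp).1 (hq.dvd_of_dvd_pow h7))
  obtain ⟨F', g', -, -, hm'⟩ := g.exists_gen_of_pow_eq hpow (by rw [hgcd]; exact hRt) hη
  rw [hgcd] at hm'
  have hle : F.m ≤ F'.m := by
    have h1 := hF F'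
    rw [Prod.Lex.toLex_le_toLex] at h1
    rcases h1 with h1 | ⟨h1, -⟩
    · exact h1.le
    · exact h1.le
  have hSR : S < R := Nat.pow_lt_pow_right hp.one_lt hsr
  have hm0 := Nat.pos_of_ne_zero F.m_ne_zero
  have h1 := Nat.le_of_dvd (Nat.mul_pos (pow_pos hp.pos _) hm0) hm'
  have h2 : F.m * S < F.m * R := Nat.mul_lt_mul_of_pos_left hSR hm0
  have h3 : F.m * R ≤ F'.m * R := Nat.mul_le_mul_right _ hle
  have h4 : F'.m * R ≤ S * F.m := h1
  linarith

/-- `s_2 < r_2` leaves only `r_2 = m_2 = 2 * s_2`. Then `a' = a * b ^ (f * y)` generates a normal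
factor of order dividing `m`, hence equal to `m` by minimality, but with a smaller `r`. -/
theorem factorization_r_le_s_of_isMinimal (g : Gen F) (hF : F.IsMinimal) (he : F.eps = -1)
    (hn : 2 ≤ F.n.factorization 2) (hm : 3 ≤ F.m.factorization 2)
    (ho : F.o.factorization 2 < F.n.factorization 2) :
    F.r.factorization 2 ≤ F.s.factorization 2 := by
  by_contra! hlt
  have hrm := F.factorization_r_le 2
  have hms := g.factorization_m_le_s_add_one he
  obtain ⟨hm4, ht⟩ := g.eps_eq_neg_one_iff.1 he
  have h2m : 2 ∣ F.m := dvd_trans (by norm_num) hm4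
  have h2ν : 2 ∉ F.ν := fun h => (F.mem_ν.1 h).2.2
    (dvd_trans (by norm_num) (g.four_dvd_r hm4))
  obtain ⟨μ, hμ⟩ : ∃ μ, F.m.factorization 2 = μ := ⟨_, rfl⟩
  have hrμ : F.r.factorization 2 = μ := by omega
  have hsμ : F.s.factorization 2 + 1 = μ := by omega
  obtain ⟨ζ, hbζ, hKζ, hζ, hnζ⟩ := g.exists_pow_b_p_part Nat.prime_two (by omega)
  rw [hsμ] at hnζ
  set K := ordCompl[2] F.m with hK
  set f := ordCompl[2] (orderOf g.b) with hf
  have htμ : (2 : ℤ) ^ μ ∣ g.t + 1 := by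
    rw [← hrμ]
    exact ((g.two_pow_dvd_r_iff_of_eps he _).1 (Nat.ordProj_dvd F.r 2)).2
  -- `y = n_2 / 2` is even because `4 ∣ n`, and `o_2 ∣ y` because `o_2 < n_2`.
  obtain ⟨y, hy⟩ : ∃ y, y = 2 ^ (F.n.factorization 2 - 1) := ⟨_, rfl⟩
  have hy2 : y * 2 = 2 ^ F.n.factorization 2 := by
    rw [hy, ← pow_succ]; congr 1; omega
  have hyeven : Even (f * y) := by
    refine Even.mul_left ?_ _
    rw [hy]
    exact (even_two).pow_of_ne_zero (by omega)
  set σ := g.t ^ (f * y) with hσ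
  have hσμ : (2 : ℤ) ^ μ ∣ σ - 1 := htμ.trans (add_one_dvd_pow_sub_one g.t hyeven)
  have h4μ : (4 : ℤ) ∣ 2 ^ μ := pow_dvd_pow (2 : ℤ) (show 2 ≤ μ by omega)
  have h4ζ : (4 : ℤ) ∣ ζ := dvd_trans (pow_dvd_pow (2 : ℤ) (show 2 ≤ F.s.factorization 2 by omega))
    (by exact_mod_cast hζ)
  have h4σ := h4μ.trans hσμ
  set Y : ℤ := 1 + σ + ζ with hY
  have hpow : (g.a ^ (1 : ℤ) * g.b ^ (f * y)) ^ 2 = g.a ^ Y := by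
    rw [g.mul_pow, mul_assoc f, hy2, hbζ, ← zpow_add, Finset.sum_range_succ, Finset.sum_range_one,
      pow_zero, pow_one, one_mul]
  have hgcd : Int.gcd Y F.m = 2 ^ 1 := by
    refine int_gcd_eq_prime_pow Nat.prime_two (by simpa using h2m) ?_ ?_ ?_
    · push_cast; omega
    · intro _; push_cast; omega
    · intro q hq hqm hqp h1
      have hy0 : y ≠ 0 := hy ▸ pow_ne_zero _ two_ne_zero
      have h2 : (q : ℤ) ∣ σ - 1 := by
        refine g.dvd_pow_mul_sub_one h2ν hq hqm hy0 ?_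
        rw [hy, Nat.prime_two.factorization_pow, Finsupp.single_eq_same]
        omega
      have h4 : (q : ℤ) ∣ ζ :=
        dvd_trans (by exact_mod_cast dvd_ordCompl_of_prime Nat.prime_two hq hqm hqp) hKζ
      have h5 : (q : ℤ) ∣ 2 := by
        have h6 : (2 : ℤ) = Y - ζ - (σ - 1) := by rw [hY]; ring
        rw [h6]
        exact dvd_sub (dvd_sub h1 h4) h2
      exact hqp ((Nat.prime_dvd_prime_iff_eq hq Nat.prime_two).1 (by exact_mod_cast h5))
  obtain ⟨F', g', ha', hb', hm'⟩ := g.exists_gen_of_pow_eq hpow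
    (by rw [hgcd]; simpa using g.two_dvd_t_sub_one h2m) (by simp)
  have hmin := hF F'
  rw [Prod.Lex.toLex_le_toLex, Prod.Lex.toLex_le_toLex] at hmin
  have hmle : F'.m ≤ F.m := by
    rw [hgcd, pow_one, mul_comm, Nat.mul_dvd_mul_iff_left two_pos] at hm'
    exact Nat.le_of_dvd (Nat.pos_of_ne_zero F.m_ne_zero) hm'
  have hmm : F.m = F'.m := by
    rcases hmin with h1 | ⟨h1, -⟩
    · exact absurd h1 (not_lt.2 hmle)
    · exact h1
  have hrle : F.r ≤ F'.r := by
    rcases hmin with h1 | ⟨-, h1 | ⟨h1, -⟩⟩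
    · exact absurd h1 (not_lt.2 hmle)
    · exact h1.le
    · exact h1.le
  have he' := (factorization_m_le_of_eps_neg g g' he).2 (by rw [hmm])
  -- If `t' ≡ -1` mod `2 ^ μ`, then `a' ^ (t' + 1) = a ^ (t + σ + ζ)` has odd order. But modulo `2 ^
  -- μ` this exponent is `ζ`, which `2 ^ μ` does not divide.
  have hr2 : F'.r.factorization 2 < F.r.factorization 2 := by
    by_contra! h1
    have h2 : (2 : ℤ) ^ μ ∣ g'.t + 1 := by
      refine ((g'.two_pow_dvd_r_iff_of_eps he' μ).1 ?_).2
      exact (Nat.prime_two.pow_dvd_iff_le_factorization F'.r_ne_zero).2 (by omega)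
    have h3 : g'.a ^ (g'.t + 1) = g.a ^ (g.t + σ + ζ) := by
      have h4 : g'.a ^ g'.t = g.a ^ (g.t - 1) * g'.a := by
        rw [← g'.conj, hb', ha']
        calc g.b * (g.a ^ (1 : ℤ) * g.b ^ (f * y)) * g.b⁻¹
            = (g.b * g.a ^ (1 : ℤ) * g.b⁻¹) * (g.b * g.b ^ (f * y) * g.b⁻¹) := by group
          _ = g.a ^ g.t * g.b ^ (f * y) := by
            rw [g.conj_zpow, one_mul, ← pow_succ', pow_succ, mul_inv_cancel_right]
          _ = _ := by rw [← mul_assoc, ← zpow_add, sub_add_cancel]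
      rw [zpow_add, h4, zpow_one, mul_assoc, ← pow_two, ha', hpow, ← zpow_add, hY]
      congr 1
      ring
    have h4 : g.a ^ ((g.t + σ + ζ) * (K : ℤ)) = 1 := by
      rw [zpow_mul, ← h3, ← zpow_mul, g'.zpow_eq_one_iff, ← hmm]
      have h5 := Nat.ordProj_mul_ordCompl_eq_self F.m 2
      rw [← hK, hμ] at h5
      rw [← h5, Nat.cast_mul]
      exact mul_dvd_mul (by exact_mod_cast h2) dvd_rfl
    rw [g.zpow_eq_one_iff] at h4
    have h5 : (2 : ℤ) ^ μ ∣ (g.t + σ + ζ) * (K : ℤ) := by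
      refine dvd_trans ?_ h4
      rw [← hμ]
      exact_mod_cast Nat.ordProj_dvd F.m 2
    have h6 : ¬ (2 : ℤ) ∣ K := by
      have := Nat.not_dvd_ordCompl Nat.prime_two F.m_ne_zero
      exact_mod_cast this
    have h7 := Int.prime_two.pow_dvd_of_dvd_mul_right _ h6 h5
    refine hnζ ?_
    have h8 := dvd_sub (dvd_sub h7 htμ) hσμ
    rw [show g.t + σ + ζ - (g.t + 1) - (σ - 1) = ζ by ring] at h8
    exact_mod_cast h8
  -- At odd primes `r_q` is the quotient of `m_q` by the `q`-part of the order of `G'`, so it is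
  -- unchanged.
  have hdvd : F'.r ∣ F.r := by
    refine (Nat.factorization_prime_le_iff_dvd F'.r_ne_zero F.r_ne_zero).1 fun q hq => ?_
    by_cases hq2 : q = 2
    · subst hq2; exact hr2.le
    · have e1 := (F.eps_pow_eq_one_or hq).resolve_right fun h => hq2 h.1
      have e2 := (F'.eps_pow_eq_one_or hq).resolve_right fun h => hq2 h.1
      have h1 := g.factorization_m_of_eps hq e1
      have h2 := g'.factorization_m_of_eps hq e2
      rw [← hmm] at h2
      omega
  have h1 := Nat.le_antisymm hrle (Nat.le_of_dvd (Nat.pos_of_ne_zero F.r_ne_zero) hdvd)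
  rw [← h1] at hr2
  exact lt_irrefl _ hr2

end Gen

theorem Factorization.IsMinimal.reduced {G : Type*} [Group G] [Finite G] {F : Factorization G}
    (hF : F.IsMinimal) : F.Reduced := by
  obtain ⟨g⟩ := F.exists_gen
  refine ⟨fun p hp hpr he => ?_, fun he => ?_⟩
  · have hsn := g.factorization_s_le_n_of_isMinimal hF hp hpr he
    refine ⟨hsn, ?_⟩
    by_contra! h
    exact absurd (g.not_of_isMinimal_of_lt hF hp hpr he hsn h.1) (not_lt.2 h.2)
  · exact ⟨g.factorization_s_ne_of_isMinimal hF he,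
      g.factorization_r_le_s_of_isMinimal hF he⟩

/-! ### Construction of metacyclic groups from `m`, `n`, `s`, `t` -/

theorem exists_gen_of_relations {G : Type*} [Group G] {a b : G} {m n s : ℕ} {t : ℤ} (hn : n ≠ 0)
    (hm : m ≠ 0) (ha : orderOf a = m) (hconj : b * a * b⁻¹ = a ^ t) (hbn : b ^ n = a ^ s)
    (hsm : s ∣ m) (hmem : ∀ j : ℕ, b ^ j ∈ Subgroup.zpowers a → n ∣ j)
    (hgen : ∀ g : G, ∃ i j : ℤ, g = a ^ i * b ^ j) :
    ∃ (_ : Finite G) (F : Factorization G) (g : Gen F), F.m = m ∧ F.n = n ∧ F.s = s ∧ g.t = t := by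
  have hoa : IsOfFinOrder a := by
    rw [← orderOf_pos_iff, ha]
    exact Nat.pos_of_ne_zero hm
  have hob : IsOfFinOrder b := by
    refine IsOfFinOrder.of_pow (n := n) ?_ hn
    rw [hbn]
    exact hoa.pow
  have hfa : Finite (Subgroup.zpowers a) := finite_zpowers.2 hoa
  have hfb : Finite (Subgroup.zpowers b) := finite_zpowers.2 hob
  have hfin : Finite G := by
    refine Finite.of_surjective
      (fun x : Subgroup.zpowers a × Subgroup.zpowers b => (x.1 : G) * x.2) fun g => ?_
    obtain ⟨i, j, rfl⟩ := hgen g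
    exact ⟨(⟨a ^ i, i, rfl⟩, ⟨b ^ j, j, rfl⟩), rfl⟩
  have hpow : ∀ (j : ℕ) (x : G), x ∈ Subgroup.zpowers a →
    b ^ j * x * (b ^ j)⁻¹ ∈ Subgroup.zpowers a := by
    intro j
    induction j with
    | zero => intro x hx; simpa using hx
    | succ j ih =>
      intro x hx
      obtain ⟨k, rfl⟩ := Subgroup.mem_zpowers_iff.1 hx
      have h1 : b * a ^ k * b⁻¹ ∈ Subgroup.zpowers a := by
        rw [← conj_zpow, hconj]
        exact Subgroup.zpow_mem _ (Subgroup.zpow_mem _ (Subgroup.mem_zpowers _) _) _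
      have h2 := ih _ h1
      rw [pow_succ, mul_inv_rev]
      convert h2 using 1
      group
  have hnor : (Subgroup.zpowers a).Normal := by
    refine ⟨fun x hx g => ?_⟩
    obtain ⟨i, j, rfl⟩ := hgen g
    have h1 : b ^ j ∈ Subgroup.zpowers b := ⟨j, rfl⟩
    rw [← mem_powers_iff_mem_zpowers] at h1
    obtain ⟨l, hl⟩ := h1
    rw [← hl]
    have h2 := hpow l x hx
    have h3 : a ^ i ∈ Subgroup.zpowers a := ⟨i, rfl⟩
    have h4 := Subgroup.mul_mem _ (Subgroup.mul_mem _ h3 h2) (Subgroup.inv_mem _ h3)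
    convert h4 using 1
    group
  let F : Factorization G :=
    { A := Subgroup.zpowers a
      B := Subgroup.zpowers b
      normal := hnor
      cyclicA := inferInstance
      cyclicB := inferInstance
      eq_mul := fun g => by
        obtain ⟨i, j, rfl⟩ := hgen g
        exact ⟨_, ⟨i, rfl⟩, _, ⟨j, rfl⟩, rfl⟩ }
  let g : Gen F := ⟨a, b, t, rfl, rfl, hconj⟩
  have hFm : F.m = m := g.orderOf_a.symm.trans ha
  have hFn : F.n = n := by
    refine Nat.dvd_antisymm ?_ (hmem _ ((g.pow_b_mem_iff F.n).2 dvd_rfl))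
    rw [← g.pow_b_mem_iff]
    exact Subgroup.mem_zpowers_iff.2 ⟨s, by rw [zpow_natCast]; exact hbn.symm⟩
  refine ⟨hfin, F, g, hFm, hFn, ?_, rfl⟩
  obtain ⟨c, hc, hcs⟩ := g.exists_pow_b_eq
  rw [← hcs]
  have h1 : g.a ^ c = g.a ^ (s : ℤ) := by
    rw [← hc, hFn, zpow_natCast]; exact hbn
  rw [g.zpow_eq_iff] at h1
  have h2 : Int.gcd c F.m = Int.gcd (s : ℤ) F.m := by
    refine Nat.dvd_antisymm ?_ ?_
    · refine Int.dvd_gcd ?_ (Int.gcd_dvd_right _ _)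
      exact (dvd_sub_right (Int.gcd_dvd_left _ _)).1 ((Int.gcd_dvd_right _ _).trans h1)
    · refine Int.dvd_gcd ?_ (Int.gcd_dvd_right _ _)
      exact (dvd_sub_left (Int.gcd_dvd_left _ _)).1 ((Int.gcd_dvd_right _ _).trans h1)
  rw [h2, hFm, Int.gcd_natCast_natCast]
  exact Nat.gcd_eq_left hsm

/-- The action of `ℤ` on `ℤ/m` by the powers of a unit. -/
def unitAction {m : ℕ} (u : (ZMod m)ˣ) : Multiplicative ℤ →* MulAut (Multiplicative (ZMod m)) :=
  zpowersHom _ ((MulAutMultiplicative (ZMod m)).symm (AddAut.mulLeft u))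

theorem unitAction_apply {m : ℕ} (u : (ZMod m)ˣ) (i : ℤ) (x : ZMod m) :
    unitAction u (Multiplicative.ofAdd i) (Multiplicative.ofAdd x) =
      Multiplicative.ofAdd (((u ^ i : (ZMod m)ˣ) : ZMod m) * x) := by
  unfold unitAction
  rw [zpowersHom_apply, ← map_zpow, ← map_zpow]
  rfl

/-- The group is `(ℤ/m ⋊ ℤ) / ⟨z⟩` with `z = (-s, n)`. The two congruences make `z` central, and
`⟨z⟩` meets `ℤ/m` trivially since `z ^ k` has second coordinate `k * n`; so `a` keeps order `m`, and
`b ^ n = a ^ s`. -/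
theorem exists_group {m n s : ℕ} {t : ℤ} (hm : m ≠ 0) (hn : n ≠ 0) (hsm : s ∣ m)
    (htn : (m : ℤ) ∣ t ^ n - 1) (hts : (m : ℤ) ∣ (t - 1) * s) :
    ∃ (G : Type) (_ : Group G) (_ : Finite G) (F : Factorization G) (g : Gen F),
      F.m = m ∧ F.n = n ∧ F.s = s ∧ g.t = t := by
  obtain ⟨u, hu⟩ : ∃ u : (ZMod m)ˣ, (u : ZMod m) = t := by
    have h : (t : ZMod m) ^ n = 1 := by
      rw [← sub_eq_zero]
      exact_mod_cast (ZMod.intCast_zmod_eq_zero_iff_dvd _ _).2 htn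
    exact ⟨Units.ofPowEqOne _ n h hn, rfl⟩
  have hun : u ^ n = 1 := (unit_eq_one_iff (t := t ^ n) (by
    rw [Units.val_pow_eq_pow_val, hu, Int.cast_pow])).2 htn
  have hus : (u : ZMod m) * s = s := by
    have h := (ZMod.intCast_zmod_eq_zero_iff_dvd _ _).2 hts
    push_cast at h
    rw [hu, ← sub_eq_zero, ← h]
    ring
  have hus' : ∀ i : ℤ, ((u ^ i : (ZMod m)ˣ) : ZMod m) * s = s := by
    have h1 : u ∈ MulAction.stabilizer (ZMod m)ˣ (s : ZMod m) := hus
    intro i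
    exact (Subgroup.zpow_mem _ h1 i : u ^ i ∈ MulAction.stabilizer (ZMod m)ˣ (s : ZMod m))
  let H := Multiplicative (ZMod m) ⋊[unitAction u] Multiplicative ℤ
  let z : H := ⟨Multiplicative.ofAdd (-(s : ZMod m)), Multiplicative.ofAdd (n : ℤ)⟩
  have hz : ∀ h : H, h * z = z * h := by
    rintro ⟨x, i⟩
    induction x using Multiplicative.rec with | _ x
    induction i using Multiplicative.rec with | _ i
    refine SemidirectProduct.ext ?_ ?_
    · rw [SemidirectProduct.mul_left, SemidirectProduct.mul_left]
      change Multiplicative.ofAdd x * unitAction u (Multiplicative.ofAdd i)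
          (Multiplicative.ofAdd (-(s : ZMod m))) = Multiplicative.ofAdd (-(s : ZMod m)) *
          unitAction u (Multiplicative.ofAdd (n : ℤ)) (Multiplicative.ofAdd x)
      rw [unitAction_apply, unitAction_apply, zpow_natCast, hun, Units.val_one, one_mul, mul_neg,
        hus', mul_comm]
    · rw [SemidirectProduct.mul_right, SemidirectProduct.mul_right, mul_comm]
  have hZ : (Subgroup.zpowers z).Normal := by
    refine ⟨fun y hy h => ?_⟩
    obtain ⟨k, rfl⟩ := Subgroup.mem_zpowers_iff.1 hy
    have h1 : Commute h (z ^ k) := Commute.zpow_right (hz h) k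
    rw [h1.eq, mul_inv_cancel_right]
    exact hy
  have hzr : ∀ k : ℤ, (z ^ k).right = Multiplicative.ofAdd (k * n : ℤ) := by
    intro k
    have := map_zpow (SemidirectProduct.rightHom : H →* Multiplicative ℤ) z k
    refine this.trans ?_
    change (Multiplicative.ofAdd (n : ℤ)) ^ k = _
    rw [← ofAdd_zsmul, smul_eq_mul]
  let α : H := SemidirectProduct.inl (Multiplicative.ofAdd 1)
  let β : H := SemidirectProduct.inr (Multiplicative.ofAdd 1)
  have hα : ∀ i : ℤ, α ^ i = SemidirectProduct.inl (Multiplicative.ofAdd (i : ZMod m)) := by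
    intro i
    rw [← map_zpow, ← ofAdd_zsmul, zsmul_one]
  have hβ : ∀ i : ℤ, β ^ i = SemidirectProduct.inr (Multiplicative.ofAdd i) := by
    intro i
    rw [← map_zpow, ← ofAdd_zsmul, smul_eq_mul, mul_one]
  let a : H ⧸ Subgroup.zpowers z := QuotientGroup.mk α
  let b : H ⧸ Subgroup.zpowers z := QuotientGroup.mk β
  have ha1 : ∀ i : ℤ, a ^ i = 1 ↔ (m : ℤ) ∣ i := by
    intro i
    rw [← QuotientGroup.mk_zpow, QuotientGroup.eq_one_iff, hα,
      ← ZMod.intCast_zmod_eq_zero_iff_dvd]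
    constructor
    · intro h
      obtain ⟨k, hk⟩ := Subgroup.mem_zpowers_iff.1 h
      have h1 := hzr k
      rw [hk, SemidirectProduct.right_inl] at h1
      have h2 : (0 : ℤ) = k * n := congrArg Multiplicative.toAdd h1
      have h3 : k = 0 := by
        rcases mul_eq_zero.1 h2.symm with h | h
        · exact h
        · exact absurd (by exact_mod_cast h) hn
      rw [h3, zpow_zero] at hk
      have h4 := congrArg (fun y : H => Multiplicative.toAdd y.left) hk
      exact h4.symm
    · intro h
      rw [h, ofAdd_zero, map_one]
      exact Subgroup.one_mem _
  have hab : b ^ n = a ^ s := by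
    rw [← zpow_natCast, ← zpow_natCast, ← QuotientGroup.mk_zpow, ← QuotientGroup.mk_zpow,
      hα, hβ, eq_comm, QuotientGroup.eq]
    refine ⟨1, ?_⟩
    simp only [zpow_one]
    rw [← map_inv, Int.cast_natCast]
    exact SemidirectProduct.mk_eq_inl_mul_inr (φ := unitAction u) _ _
  have ha : orderOf a = m := by
    refine Nat.dvd_antisymm ?_ ?_
    · have := (ha1 m).2 dvd_rfl
      rw [zpow_natCast] at this
      exact orderOf_dvd_of_pow_eq_one this
    · have := (ha1 (orderOf a)).1 (by rw [zpow_natCast, pow_orderOf_eq_one])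
      exact_mod_cast this
  have hconj : b * a * b⁻¹ = a ^ t := by
    rw [← QuotientGroup.mk_zpow, hα]
    change ((β * α * β⁻¹ : H) : H ⧸ Subgroup.zpowers z) = _
    congr 1
    have h1 := SemidirectProduct.inl_aut (φ := unitAction u) (Multiplicative.ofAdd 1)
      (Multiplicative.ofAdd 1)
    rw [unitAction_apply, zpow_one, mul_one, hu] at h1
    rw [h1, map_inv]
  have hmem : ∀ j : ℕ, b ^ j ∈ Subgroup.zpowers a → n ∣ j := by
    intro j hj
    obtain ⟨i, hi⟩ := Subgroup.mem_zpowers_iff.1 hj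
    rw [← zpow_natCast, ← QuotientGroup.mk_zpow, ← QuotientGroup.mk_zpow, hα, hβ,
      QuotientGroup.eq] at hi
    obtain ⟨k, hk⟩ := hi
    have h1 := hzr k
    simp only at hk
    rw [hk, SemidirectProduct.mul_right, SemidirectProduct.inv_right,
      SemidirectProduct.right_inl, SemidirectProduct.right_inr, inv_one, one_mul] at h1
    have h2 : (j : ℤ) = k * n := congrArg Multiplicative.toAdd h1
    have h3 : (n : ℤ) ∣ j := ⟨k, by rw [h2, mul_comm]⟩
    exact_mod_cast h3
  have hgen : ∀ g, ∃ i j : ℤ, g = a ^ i * b ^ j := by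
    intro y
    obtain ⟨y, rfl⟩ := QuotientGroup.mk_surjective y
    obtain ⟨x, i⟩ := y
    obtain ⟨x', hx'⟩ := ZMod.intCast_surjective (Multiplicative.toAdd x)
    refine ⟨x', Multiplicative.toAdd i, ?_⟩
    rw [← QuotientGroup.mk_zpow, ← QuotientGroup.mk_zpow, ← QuotientGroup.mk_mul, hα, hβ, hx']
    congr 1
    exact SemidirectProduct.mk_eq_inl_mul_inr i x
  obtain ⟨hfin, F, g, h⟩ := exists_gen_of_relations hn hm ha hconj hab hsm hmem hgen
  exact ⟨_, inferInstance, hfin, F, g, h⟩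

/-! ### Admissible parameters and their realization -/

/-- The conditions on `(m, n, s, r, ε, o)` which hold for all metacyclic factorizations. -/
structure Admissible (m n s r o : ℕ) (ε : ℤ) : Prop where
  s_dvd : s ∣ m
  r_dvd : r ∣ m
  o_le : ∀ p, p.Prime → o.factorization p ≤ if p ∈ nu m r then 0 else n.factorization p
  m_le_n : ∀ p, p.Prime → p ∉ nu m r → m.factorization p ≤ r.factorization p + n.factorization p
  m_le_s : ∀ p, p.Prime → p ∉ nu m r → m.factorization p ≤ r.factorization p + s.factorization p
  s_eq : ∀ p ∈ nu m r, s.factorization p = m.factorization p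
  four_dvd : 4 ∣ m → 4 ∣ r
  neg : ε = -1 → 2 ∣ n ∧ 4 ∣ m ∧ m.factorization 2 ≤ s.factorization 2 + 1
  o_dvd : o ∣ (nu m r).lcm fun q => q - 1
  exists_dvd : ∀ q ∈ nu m r, Nat.gcd o (q - 1) = 1 → ∃ p ∈ nu m r ∩ n.primeFactors, p ∣ q - 1

theorem Gen.admissible {G : Type*} [Group G] [Finite G] {F : Factorization G} (g : Gen F) :
    Admissible F.m F.n F.s F.r F.o F.eps where
  s_dvd := g.s_dvd_m
  r_dvd := F.r_dvd_m
  o_le p _ := by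
    split_ifs with h
    · exact (g.factorization_o_of_mem_ν h).le
    · exact g.factorization_o_le p
  m_le_n _ hp hν := g.factorization_m_le_r_add_n hp hν
  m_le_s _ hp _ := g.factorization_m_le_r_add_s hp
  s_eq _ hp := g.factorization_s_of_mem_ν hp
  four_dvd := g.four_dvd_r
  neg he := ⟨g.even_n_of_eps_neg he, (g.eps_eq_neg_one_iff.1 he).1,
    g.factorization_m_le_s_add_one he⟩
  o_dvd := g.o_dvd_lcm
  exists_dvd _ hq h := g.exists_prime_dvd_of_gcd_eq_one hq h

theorem prime_pow_dvd_finset_lcm {ν : Finset ℕ} {d : ℕ → ℕ} {p k : ℕ} (hp : p.Prime) (hk : k ≠ 0)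
    (h : p ^ k ∣ ν.lcm d) : ∃ q ∈ ν, p ^ k ∣ d q := by
  induction ν using Finset.induction_on with
  | empty =>
    rw [Finset.lcm_empty, Nat.dvd_one, Nat.pow_eq_one] at h
    rcases h with h | h
    · exact absurd h hp.ne_one
    · exact absurd h hk
  | insert q ν _ ih =>
    rw [Finset.lcm_insert] at h
    rcases prime_pow_dvd_lcm hp h with h | h
    · exact ⟨q, Finset.mem_insert_self _ _, h⟩
    · obtain ⟨q', hq', h'⟩ := ih h
      exact ⟨q', Finset.mem_insert_of_mem hq', h'⟩

theorem exists_intCast_orderOf_eq {q v d : ℕ} (hq : q.Prime) (hq2 : q ≠ 2) (hv : v ≠ 0)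
    (hd : d ∣ q - 1) : ∃ f : ℕ, ∀ t : ℤ, ((q ^ v : ℕ) : ℤ) ∣ t - f →
      ∀ j : ℕ, ((q ^ v : ℕ) : ℤ) ∣ t ^ j - 1 ↔ d ∣ j := by
  have hcyc := ZMod.isCyclic_units_of_prime_pow q hq hq2 v
  have hne : NeZero (q ^ v) := ⟨pow_ne_zero _ hq.ne_zero⟩
  obtain ⟨w, hw⟩ := IsCyclic.exists_ofOrder_eq_natCard (α := (ZMod (q ^ v))ˣ)
  have hdo : d ∣ orderOf w := by
    rw [hw, Nat.card_eq_fintype_card, ZMod.card_units_eq_totient, Nat.totient_prime_pow hq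
      (Nat.pos_of_ne_zero hv)]
    exact hd.mul_left _
  obtain ⟨e, he⟩ := hdo
  have hpos := orderOf_pos w
  have he0 : e ≠ 0 := by rintro rfl; omega
  have hx : orderOf (w ^ e) = d := by
    rw [orderOf_pow_of_dvd he0 (he ▸ dvd_mul_left _ _), he, Nat.mul_div_cancel _
      (Nat.pos_of_ne_zero he0)]
  refine ⟨((w ^ e : (ZMod (q ^ v))ˣ) : ZMod (q ^ v)).val, fun t ht j => ?_⟩
  have hwt : ((w ^ e : (ZMod (q ^ v))ˣ) : ZMod (q ^ v)) = t := by
    rw [← ZMod.intCast_zmod_eq_zero_iff_dvd, Int.cast_sub, Int.cast_natCast, ZMod.natCast_zmod_val,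
      sub_eq_zero] at ht
    exact ht.symm
  rw [← hx, orderOf_dvd_iff_pow_eq_one]
  exact (unit_eq_one_iff (by rw [Units.val_pow_eq_pow_val, hwt, Int.cast_pow])).symm

namespace Admissible

variable {m n s r o : ℕ} {ε : ℤ}

theorem o_dvd_n (h : Admissible m n s r o ε) (hn : n ≠ 0) (ho : o ≠ 0) : o ∣ n := by
  rw [← Nat.factorization_prime_le_iff_dvd ho hn]
  intro p hp
  have := h.o_le p hp
  split_ifs at this <;> omega

/-- The orders of the local components of the automorphism to be constructed. -/
theorem exists_orders (h : Admissible m n s r o ε) (hn : n ≠ 0) (ho : o ≠ 0) :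
    ∃ d : ℕ → ℕ, ∀ q ∈ nu m r, d q ∣ n ∧ d q ∣ q - 1 ∧ d q ≠ 1 ∧
      (d q = Nat.gcd o (q - 1) ∨ Nat.gcd o (q - 1) = 1 ∧ d q ∈ nu m r) := by
  have h1 : ∀ q, ∃ d, q ∈ nu m r → d ∣ n ∧ d ∣ q - 1 ∧ d ≠ 1 ∧
      (d = Nat.gcd o (q - 1) ∨ Nat.gcd o (q - 1) = 1 ∧ d ∈ nu m r) := by
    intro q
    by_cases hg : Nat.gcd o (q - 1) = 1
    · by_cases hq : q ∈ nu m r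
      · obtain ⟨p, hp, hpq⟩ := h.exists_dvd q hq hg
        rw [Finset.mem_inter] at hp
        exact ⟨p, fun _ => ⟨Nat.dvd_of_mem_primeFactors hp.2, hpq,
          (prime_of_mem_nu hp.1).ne_one, Or.inr ⟨hg, hp.1⟩⟩⟩
      · exact ⟨0, fun h => absurd h hq⟩
    · exact ⟨_, fun _ => ⟨(Nat.gcd_dvd_left _ _).trans (h.o_dvd_n hn ho), Nat.gcd_dvd_right _ _, hg,
        Or.inl rfl⟩⟩
  choose d hd using h1
  exact ⟨d, hd⟩

/-- A power of `p ∉ ν` dividing `o` divides some `q - 1`, hence `gcd(o, q - 1)`, which is then not 1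
and equals `d q`. Conversely, the substitute used when the gcd is 1 is a prime of `ν` and
contributes nothing outside `ν`. -/
theorem factorization_lcm (h : Admissible m n s r o ε) (ho : o ≠ 0) {d : ℕ → ℕ}
    (hd : ∀ q ∈ nu m r, d q ∣ n ∧ d q ∣ q - 1 ∧ d q ≠ 1 ∧
      (d q = Nat.gcd o (q - 1) ∨ Nat.gcd o (q - 1) = 1 ∧ d q ∈ nu m r))
    (h0 : (nu m r).lcm d ≠ 0) (p : ℕ) :
    o.factorization p = if p ∈ nu m r then 0 else ((nu m r).lcm d).factorization p := by
  by_cases hp : p.Prime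
  swap
  · rw [Nat.factorization_eq_zero_of_not_prime _ hp, Nat.factorization_eq_zero_of_not_prime _ hp,
      ite_self]
  split_ifs with hν
  · have := h.o_le p hp
    rw [if_pos hν] at this
    omega
  refine factorization_eq_of_pow_dvd_iff hp ho h0 fun k => ?_
  rcases eq_or_ne k 0 with rfl | hk
  · simp
  have hpd : ∀ x, p ^ k ∣ x → x ≠ 1 := by
    rintro x hx rfl
    exact (Nat.one_lt_pow hk hp.one_lt).ne' (Nat.dvd_one.1 hx)
  constructor
  · intro hko
    obtain ⟨q, hq, hkq⟩ := prime_pow_dvd_finset_lcm hp hk (hko.trans h.o_dvd)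
    have hg := Nat.dvd_gcd hko hkq
    obtain ⟨-, -, -, h1 | h1⟩ := hd q hq
    · exact (h1 ▸ hg).trans (Finset.dvd_lcm hq)
    · exact absurd h1.1 (hpd _ hg)
  · intro hkl
    obtain ⟨q, hq, hkq⟩ := prime_pow_dvd_finset_lcm hp hk hkl
    obtain ⟨-, -, -, h1 | h1⟩ := hd q hq
    · exact (h1 ▸ hkq).trans (Nat.gcd_dvd_left _ _)
    · have h2 := (Nat.prime_dvd_prime_iff_eq hp (prime_of_mem_nu h1.2)).1
        ((dvd_pow_self p hk).trans hkq)
      exact absurd (h2 ▸ h1.2) hν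

/-- Units modulo an odd prime power form a cyclic group, so order `d` occurs. A residue `≡ 1` mod
`q` has `q`-power order, whereas `d ≠ 1` divides `q - 1`. -/
theorem local_nu {q v d : ℕ} (hq : q.Prime) (hv : v ≠ 0) (hd : d ∣ q - 1) (hd1 : d ≠ 1) :
    ∃ f : ℕ, ∀ t : ℤ, ((q ^ v : ℕ) : ℤ) ∣ t - f → (¬ (q : ℤ) ∣ t - 1) ∧
      ∀ j : ℕ, ((q ^ v : ℕ) : ℤ) ∣ t ^ j - 1 ↔ d ∣ j := by
  have hq2 : q ≠ 2 := by
    rintro rfl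
    exact hd1 (Nat.dvd_one.1 hd)
  obtain ⟨f, hf⟩ := exists_intCast_orderOf_eq hq hq2 hv hd
  refine ⟨f, fun t ht => ⟨fun h1 => ?_, hf t ht⟩⟩
  have h2 := pow_dvd_pow_sub_one (k := 1) (j := v) hq one_ne_zero (by simpa using h1)
    (dvd_refl (q ^ v))
  have h3 : ((q ^ v : ℕ) : ℤ) ∣ t ^ (q ^ v) - 1 := by
    refine dvd_trans ?_ h2
    push_cast
    exact pow_dvd_pow _ (by omega)
  rw [hf t ht] at h3
  have h4 : Nat.Coprime (q - 1) q := by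
    have := hq.pos
    exact (Nat.coprime_self_sub_left (by omega)).2 (Nat.coprime_one_left q)
  exact hd1 (Nat.eq_one_of_dvd_coprimes ((h4.pow_right v).coprime_dvd_left hd) dvd_rfl h3)

theorem pow_dvd_sub_one_iff_of_pow_dvd {p v w k : ℕ} {t : ℤ} (hp : p.Prime)
    (ht : ((p ^ v : ℕ) : ℤ) ∣ t - (p ^ w : ℕ)) (hk : k ≤ v) : (p : ℤ) ^ k ∣ t ↔ k ≤ w := by
  have h1 : (p : ℤ) ^ k ∣ t - (p ^ w : ℕ) := by
    refine dvd_trans ?_ ht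
    push_cast
    exact pow_dvd_pow _ hk
  rw [← Nat.pow_dvd_pow_iff_le_right hp.one_lt, ← Int.natCast_dvd_natCast, Nat.cast_pow]
  exact dvd_iff_dvd_of_dvd_sub h1

/-- At `p ∈ ν` a residue of order `d p` is taken. Elsewhere the residue is `1 + r_p`, or `-1 + r_2`
when `p = 2` and `ε = -1`: modulo `m_p`, it agrees with `±1` exactly as far as `r_p`. The
divisibilities `m_p ∣ r_p * n_p` and `m_p ∣ r_p * s_p`, or `m_2 ∣ 2 * s_2` for `ε = -1`, yield the
congruences. -/
theorem exists_local (h : Admissible m n s r o ε) (hm : m ≠ 0) (hn : n ≠ 0)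
    (hr : r ≠ 0) {d : ℕ → ℕ}
    (hd : ∀ q ∈ nu m r, d q ∣ n ∧ d q ∣ q - 1 ∧ d q ≠ 1) {p : ℕ} (hp : p.Prime) (hpm : p ∣ m) :
    ∃ f : ℕ, ∀ t : ℤ, ((ordProj[p] m : ℕ) : ℤ) ∣ t - f →
      ((ordProj[p] m : ℕ) : ℤ) ∣ t ^ n - 1 ∧ ((ordProj[p] m : ℕ) : ℤ) ∣ (t - 1) * s ∧
      (∀ k ≤ m.factorization p, PowCond t p k ↔ k ≤ r.factorization p) ∧
      (p = 2 → 4 ∣ m → (ε = -1 ↔ (4 : ℤ) ∣ t + 1)) ∧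
      (p ∈ nu m r → ∀ j : ℕ, ((ordProj[p] m : ℕ) : ℤ) ∣ t ^ j - 1 ↔ d p ∣ j) := by
  have hv : m.factorization p ≠ 0 := (hp.factorization_pos_of_dvd hm hpm).ne'
  have hpn : p ^ n.factorization p ∣ n := Nat.ordProj_dvd n p
  have hps : (p : ℤ) ^ s.factorization p ∣ s := by exact_mod_cast Nat.ordProj_dvd s p
  by_cases hν : p ∈ nu m r
  · obtain ⟨hdn, hdq, hd1⟩ := hd p hν
    obtain ⟨f, hf⟩ := local_nu hp hv hdq hd1
    have hvr : r.factorization p = 0 :=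
      Nat.factorization_eq_zero_of_not_dvd ((mem_nu hm hr).1 hν).2.2
    have hp2 : p ≠ 2 := by
      rintro rfl
      exact hd1 (Nat.dvd_one.1 hdq)
    refine ⟨f, fun t ht => ⟨((hf t ht).2 n).2 hdn, ?_, fun k hk => ?_, fun h2 => absurd h2 hp2,
      fun _ => (hf t ht).2⟩⟩
    · rw [← h.s_eq p hν]
      push_cast
      exact hps.mul_left _
    · rw [hvr, Nat.le_zero]
      constructor
      · rintro (h1 | h1)
        · by_contra hk0
          exact (hf t ht).1 ((dvd_pow_self _ hk0).trans h1)
        · exact absurd h1.1 hp2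
      · rintro rfl
        exact Or.inl (by simp)
  have hmn := h.m_le_n p hp hν
  have hms := h.m_le_s p hp hν
  have hpr : p ∣ r := by
    by_contra hpr
    exact hν ((mem_nu hm hr).2 ⟨hp, hpm, hpr⟩)
  have hvr : r.factorization p ≠ 0 := (hp.factorization_pos_of_dvd hr hpr).ne'
  have hrm : r.factorization p ≤ m.factorization p :=
    (Nat.factorization_le_iff_dvd hr hm).2 h.r_dvd p
  have hr2 : p = 2 → 2 ≤ m.factorization p → 2 ≤ r.factorization p := by
    rintro rfl h2
    rw [← hp.pow_dvd_iff_le_factorization hm] at h2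
    rw [← hp.pow_dvd_iff_le_factorization hr]
    exact h.four_dvd h2
  have hpow : p ≠ 2 → ∀ {k : ℕ} {t : ℤ}, PowCond t p k ↔ (p : ℤ) ^ k ∣ t - 1 := by
    intro h2 k t
    exact ⟨fun h => h.resolve_right fun h' => h2 h'.1, Or.inl⟩
  by_cases hneg : p = 2 ∧ ε = -1
  · obtain ⟨rfl, he⟩ := hneg
    obtain ⟨⟨n', rfl⟩, h4, hms1⟩ := h.neg he
    have h2 : 2 ≤ m.factorization 2 := (hp.pow_dvd_iff_le_factorization hm).1 h4
    have hr2 := hr2 rfl h2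
    have hpos : 1 ≤ 2 ^ r.factorization 2 := Nat.one_le_two_pow
    refine ⟨2 ^ r.factorization 2 - 1, fun t ht => ?_⟩
    have ht1 : ((2 ^ m.factorization 2 : ℕ) : ℤ) ∣ (t + 1) - (2 ^ r.factorization 2 : ℕ) := by
      convert ht using 1
      push_cast [hpos]
      ring
    have key : ∀ k ≤ m.factorization 2, ((2 : ℕ) : ℤ) ^ k ∣ t + 1 ↔ k ≤ r.factorization 2 :=
      fun k hk => pow_dvd_sub_one_iff_of_pow_dvd hp ht1 hk
    have ht4 : (4 : ℤ) ∣ t + 1 := by simpa using (key 2 h2).2 hr2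
    refine ⟨?_, ?_, fun k hk => ?_, fun _ _ => ⟨fun _ => ht4, fun _ => he⟩, fun h => absurd h hν⟩
    · rw [← geom_sum_mul]
      have hn' : n' ≠ 0 := by rintro rfl; simp at hn
      have hfn : (2 * n').factorization 2 = n'.factorization 2 + 1 := by
        rw [Nat.factorization_mul two_ne_zero hn', Finsupp.add_apply, hp.factorization_self,
          add_comm]
      have h5 : (2 : ℤ) ^ (r.factorization 2 + n'.factorization 2) ∣
          ∑ l ∈ Finset.range (2 * n'), t ^ l := by
        rw [two_pow_dvd_geom_sum_iff ht4, pow_add]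
        refine mul_dvd_mul ?_ (by exact_mod_cast Nat.ordProj_dvd n' 2)
        exact_mod_cast (key _ hrm).2 le_rfl
      have h6 : (2 : ℤ) ∣ t - 1 := by omega
      refine dvd_trans ?_ (mul_dvd_mul h5 h6)
      rw [← pow_succ]
      push_cast
      exact pow_dvd_pow _ (by omega)
    · have h6 : (2 : ℤ) ∣ t - 1 := by omega
      refine dvd_trans ?_ (mul_dvd_mul h6 hps)
      push_cast
      rw [← pow_succ']
      exact pow_dvd_pow _ hms1
    · rw [← key k hk]
      refine ⟨?_, fun h => Or.inr ⟨rfl, h⟩⟩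
      rintro (h1 | h1)
      -- As `t ≡ -1` mod 4, the number `t - 1` is not divisible by 4, and this branch of `PowCond`
      -- adds nothing.
      · have hk1 : k ≤ 1 := by
          by_contra! hk2
          have h5 := (pow_dvd_pow ((2 : ℕ) : ℤ) hk2).trans h1
          norm_num at h5
          omega
        rw [key k hk]
        omega
      · exact h1.2
  · have key : ∀ t : ℤ, ((p ^ m.factorization p : ℕ) : ℤ) ∣ t - (p ^ r.factorization p + 1 : ℕ) →
        ∀ k ≤ m.factorization p, (p : ℤ) ^ k ∣ t - 1 ↔ k ≤ r.factorization p := by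
      intro t ht k hk
      refine pow_dvd_sub_one_iff_of_pow_dvd hp ?_ hk
      convert ht using 1
      push_cast
      ring
    refine ⟨p ^ r.factorization p + 1, fun t ht => ?_⟩
    have key := key t ht
    have ht1 := (key _ hrm).2 le_rfl
    have h4 : p = 2 → 2 ≤ m.factorization p → (4 : ℤ) ∣ t - 1 := by
      intro hp2 h2
      have := (key 2 h2).2 (hr2 hp2 h2)
      rw [hp2] at this
      simpa using this
    refine ⟨?_, ?_, fun k hk => ?_, fun hp2 hm4 => ?_, fun h => absurd h hν⟩
    · refine dvd_trans ?_ (pow_dvd_pow_sub_one hp hvr ht1 hpn)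
      push_cast
      exact pow_dvd_pow _ hmn
    · refine dvd_trans ?_ (mul_dvd_mul ht1 hps)
      push_cast
      rw [← pow_add]
      exact pow_dvd_pow _ hms
    · rw [← key k hk]
      refine ⟨?_, Or.inl⟩
      rintro (h1 | ⟨hp2, h1⟩)
      · exact h1
      · have hk1 : k ≤ 1 := by
          by_contra! hk2
          have h5 := (pow_dvd_pow (p : ℤ) hk2).trans h1
          have h6 := h4 hp2 (by omega)
          rw [hp2] at h5
          norm_num at h5
          omega
        rw [key k hk]
        omega
    · have h6 := h4 hp2 ((hp.pow_dvd_iff_le_factorization hm).1 (by rw [hp2]; exact hm4))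
      have he : ε ≠ -1 := fun he => hneg ⟨hp2, he⟩
      exact ⟨fun h => absurd h he, fun h => by omega⟩

/-- Every clause is local, so Chinese remainders glue the residues; the order of `t` modulo `m_ν` is
the lcm of the local orders `d q`. -/
theorem exists_unit (h : Admissible m n s r o ε) (hm : m ≠ 0) (hn : n ≠ 0) (hr : r ≠ 0)
    (ho : o ≠ 0) :
    ∃ t : ℤ, (m : ℤ) ∣ t ^ n - 1 ∧ (m : ℤ) ∣ (t - 1) * s ∧
      (∀ p k, p.Prime → (p ^ k ∣ r ↔ p ^ k ∣ m ∧ PowCond t p k)) ∧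
      (ε = -1 ↔ 4 ∣ m ∧ (4 : ℤ) ∣ t + 1) ∧
      ∃ k : ℕ, (∀ j : ℕ, (piPart (nu m r) m : ℤ) ∣ t ^ j - 1 ↔ k ∣ j) ∧
        ∀ p, o.factorization p = if p ∈ nu m r then 0 else k.factorization p := by
  obtain ⟨d, hd⟩ := h.exists_orders hn ho
  have hloc : ∀ p, ∃ f : ℕ, p.Prime → p ∣ m → ∀ t : ℤ, ((ordProj[p] m : ℕ) : ℤ) ∣ t - f →
      ((ordProj[p] m : ℕ) : ℤ) ∣ t ^ n - 1 ∧ ((ordProj[p] m : ℕ) : ℤ) ∣ (t - 1) * s ∧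
      (∀ k ≤ m.factorization p, PowCond t p k ↔ k ≤ r.factorization p) ∧
      (p = 2 → 4 ∣ m → (ε = -1 ↔ (4 : ℤ) ∣ t + 1)) ∧
      (p ∈ nu m r → ∀ j : ℕ, ((ordProj[p] m : ℕ) : ℤ) ∣ t ^ j - 1 ↔ d p ∣ j) := by
    intro p
    by_cases hp : p.Prime ∧ p ∣ m
    · obtain ⟨f, hf⟩ := h.exists_local hm hn hr
        (fun q hq => ⟨(hd q hq).1, (hd q hq).2.1, (hd q hq).2.2.1⟩) hp.1 hp.2
      exact ⟨f, fun _ _ => hf⟩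
    · exact ⟨0, fun h1 h2 => absurd ⟨h1, h2⟩ hp⟩
  choose f hf using hloc
  obtain ⟨t, ht⟩ := Nat.chineseRemainderOfFinset f (fun p => ordProj[p] m) m.primeFactors
    (fun p _ => (Nat.ordProj_pos m p).ne') (fun p hp q hq hpq =>
      Nat.Coprime.pow _ _ ((Nat.coprime_primes (Nat.prime_of_mem_primeFactors hp)
        (Nat.prime_of_mem_primeFactors hq)).2 hpq))
  have hL := fun (p : ℕ) (hp : p.Prime) (hpm : p ∣ m) => hf p hp hpm t
    (Nat.modEq_iff_dvd.1 (ht p (Nat.mem_primeFactors.2 ⟨hp, hpm, hm⟩)).symm)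
  have hdvd : ∀ x : ℤ, (∀ p, p.Prime → p ∣ m → ((ordProj[p] m : ℕ) : ℤ) ∣ x) → (m : ℤ) ∣ x := by
    intro x hx
    rw [int_dvd_iff_prime_pow_dvd]
    intro p k hp hk
    rcases eq_or_ne k 0 with rfl | hk0
    · simp
    · refine dvd_trans ?_ (hx p hp ((dvd_pow_self p hk0).trans hk))
      push_cast
      exact pow_dvd_pow _ ((hp.pow_dvd_iff_le_factorization hm).1 hk)
  have hνp : ∀ q ∈ nu m r, q.Prime := fun q => prime_of_mem_nu
  refine ⟨t, hdvd _ fun p hp hpm => (hL p hp hpm).1, hdvd _ fun p hp hpm => (hL p hp hpm).2.1,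
    fun p k hp => ?_, ?_, (nu m r).lcm d, fun j => ?_, fun p => ?_⟩
  · rw [hp.pow_dvd_iff_le_factorization hm, hp.pow_dvd_iff_le_factorization hr]
    have hrm : r.factorization p ≤ m.factorization p :=
      (Nat.factorization_le_iff_dvd hr hm).2 h.r_dvd p
    by_cases hpm : p ∣ m
    · have := (hL p hp hpm).2.2.1 k
      constructor
      · intro hk
        exact ⟨hk.trans hrm, (this (hk.trans hrm)).2 hk⟩
      · rintro ⟨h1, h2⟩
        exact (this h1).1 h2
    · have h0 := Nat.factorization_eq_zero_of_not_dvd hpm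
      constructor
      · intro hk
        have hk0 : k = 0 := by omega
        subst hk0
        exact ⟨Nat.zero_le _, Or.inl (by simp)⟩
      · rintro ⟨h1, -⟩
        omega
  · constructor
    · intro he
      obtain ⟨-, h4, -⟩ := h.neg he
      exact ⟨h4, ((hL 2 Nat.prime_two (dvd_trans (by norm_num) h4)).2.2.2.1 rfl h4).1 he⟩
    · rintro ⟨h4, ht4⟩
      exact ((hL 2 Nat.prime_two (dvd_trans (by norm_num) h4)).2.2.2.1 rfl h4).2 ht4
  · rw [piPart_int_dvd_iff hνp, Finset.lcm_dvd_iff]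
    refine forall₂_congr fun q hq => ?_
    obtain ⟨hqp, hqm, -⟩ := (mem_nu hm hr).1 hq
    rw [← (hL q hqp hqm).2.2.2.2 hq j]
    push_cast
    rfl
  · refine h.factorization_lcm ho hd ?_ p
    rw [Finset.lcm_ne_zero_iff]
    intro q hq h0
    exact hn (Nat.eq_zero_of_zero_dvd (h0 ▸ (hd q hq).1))

theorem exists_factorization (h : Admissible m n s r o ε) (hm : m ≠ 0) (hn : n ≠ 0) (hr : r ≠ 0)
    (ho : o ≠ 0) (hε : ε = 1 ∨ ε = -1) :
    ∃ (G : Type) (_ : Group G) (_ : Finite G) (F : Factorization G),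
      F.m = m ∧ F.n = n ∧ F.s = s ∧ F.r = r ∧ F.eps = ε ∧ F.o = o := by
  obtain ⟨t, htn, hts, htr, hte, k, hk, hko⟩ := h.exists_unit hm hn hr ho
  obtain ⟨G, hG, hfin, F, g, hFm, hFn, hFs, hgt⟩ := exists_group hm hn h.s_dvd htn hts
  have hFr : F.r = r := eq_of_prime_pow_dvd_iff fun p k hp => by
    rw [g.pow_dvd_r_iff hp, htr p k hp, hFm, hgt]
  have hFν : F.ν = nu m r := by
    rw [← hFm, ← hFr]
    rfl
  refine ⟨G, hG, hfin, F, hFm, hFn, hFs, hFr, ?_, ?_⟩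
  · have he := g.eps_eq_neg_one_iff
    rw [hFm, hgt, ← hte] at he
    rcases F.eps_eq with h1 | h1 <;> rcases hε with h2 | h2 <;> rw [h1, h2] at he ⊢ <;>
      revert he <;> norm_num
  · obtain ⟨l, -, hl, hlo⟩ := g.o_spec
    rw [hFν, hFm, hgt] at hl
    have hkl : k = l := Nat.dvd_antisymm ((hk l).1 ((hl l).2 dvd_rfl)) ((hl k).1 ((hk k).2 dvd_rfl))
    refine Nat.eq_of_factorization_eq F.o_ne_zero ho fun p => ?_
    rw [hlo, hko, hFν, hkl]

end Admissible

/-! ### Uniqueness of the data and assembly -/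

/-- Two minimal factorizations of the same group have the same data. -/
theorem Factorization.IsMinimal.data_eq {G : Type*} [Group G] [Finite G] {F F' : Factorization G}
    (hF : F.IsMinimal) (hF' : F'.IsMinimal) : F'.data = F.data := by
  have h1 := le_antisymm (hF F') (hF' F)
  have h2 := toLex.injective h1
  rw [Prod.mk.injEq] at h2
  obtain ⟨hm, h3⟩ := h2
  have h4 := toLex.injective h3
  rw [Prod.mk.injEq] at h4
  obtain ⟨hr, hs⟩ := h4
  have hr : F.r = F'.r := hr
  obtain ⟨g⟩ := F.exists_gen
  obtain ⟨g'⟩ := F'.exists_gen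
  have hn : F.n = F'.n := by
    have := F.m_mul_n.trans F'.m_mul_n.symm
    rw [← hm] at this
    exact Nat.eq_of_mul_eq_mul_left (Nat.pos_of_ne_zero F.m_ne_zero) this
  rw [Factorization.data_eq, Factorization.data_eq, ← hm, ← hn, ← hs, ← hr, ← Gen.o_eq g g']
  -- If one of the signs is `-1`, equality of the 2-parts of `m` forces the other to be `-1` too.
  have he : F.eps = F'.eps := by
    rcases F.eps_eq with h | h
    · rcases F'.eps_eq with h' | h'
      · rw [h, h']
      · rw [(Gen.factorization_m_le_of_eps_neg g' g h').2 (by rw [hm]), h']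
    · rw [h, (Gen.factorization_m_le_of_eps_neg g g' h).2 (by rw [hm])]
  rw [he]

/-- The numerical conditions which characterize the minimal factorizations. -/
structure ReducedData (m n s r o : ℕ) (ε : ℤ) : Prop where
  pos : ∀ p, p.Prime → p ∣ r → ε ^ (p - 1) = 1 →
    s.factorization p ≤ n.factorization p ∧ (r.factorization p ≤ s.factorization p ∨
      n.factorization p < s.factorization p + o.factorization p)
  neg : ε = -1 → s.factorization 2 ≠ n.factorization 2 + r.factorization 2 ∧
    (2 ≤ n.factorization 2 → 3 ≤ m.factorization 2 →
      o.factorization 2 < n.factorization 2 → r.factorization 2 ≤ s.factorization 2)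

theorem reduced_iff_reducedData {G : Type*} [Group G] [Finite G] {F : Factorization G} :
    F.Reduced ↔ ReducedData F.m F.n F.s F.r F.o F.eps :=
  ⟨fun h => ⟨h.pos, h.neg⟩, fun h => ⟨h.pos, h.neg⟩⟩

/-- Minimality is equivalent to reducedness, so any factorization realizing admissible reduced
parameters is automatically minimal, and every other minimal one has the same data. -/
theorem exists_hasIN_iff {m n s r o : ℕ} {ε : ℤ} (hm : m ≠ 0) (hn : n ≠ 0) (hr : r ≠ 0)
    (ho : o ≠ 0) (hε : ε = 1 ∨ ε = -1) :
    (∃ (G : Type) (_ : Group G) (_ : Finite G), HasIN G (m, n, s, r, ε, o)) ↔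
      Admissible m n s r o ε ∧ ReducedData m n s r o ε := by
  constructor
  · rintro ⟨G, hG, hfin, ⟨F, hF⟩, h⟩
    have h1 := h F hF
    rw [Factorization.data_eq] at h1
    simp only [Prod.mk.injEq] at h1
    obtain ⟨rfl, rfl, rfl, rfl, rfl, rfl⟩ := h1
    obtain ⟨g⟩ := F.exists_gen
    exact ⟨g.admissible, reduced_iff_reducedData.1 hF.reduced⟩
  · rintro ⟨h1, h2⟩
    obtain ⟨G, hG, hfin, F, rfl, rfl, rfl, rfl, rfl, rfl⟩ := h1.exists_factorization hm hn hr ho hε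
    have hF := (reduced_iff_reducedData.2 h2).isMinimal
    exact ⟨G, hG, hfin, ⟨F, hF⟩, fun F' hF' => (hF.data_eq hF').trans F.data_eq⟩

theorem reducedData_iff {m n s r o : ℕ} {ε : ℤ} (hm : m ≠ 0) (hn : n ≠ 0) (hs : s ≠ 0)
    (hr : r ≠ 0) :
    ReducedData m n s r o ε ↔
      (∀ p ∈ r.primeFactors, ε ^ (p - 1) = 1 →
        ordProj[p] s ∣ n ∧ (ordProj[p] r ∣ s ∨ ¬ ordProj[p] s * ordProj[p] o ∣ n)) ∧
      (ε = -1 → ordProj[2] s ≠ ordProj[2] n * ordProj[2] r ∧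
        (4 ∣ n ∧ 8 ∣ m ∧ ordProj[2] o < ordProj[2] n → ordProj[2] r ∣ s)) := by
  have h1 : (∀ p ∈ r.primeFactors, ε ^ (p - 1) = 1 →
        ordProj[p] s ∣ n ∧ (ordProj[p] r ∣ s ∨ ¬ ordProj[p] s * ordProj[p] o ∣ n)) ↔
      ∀ p, p.Prime → p ∣ r → ε ^ (p - 1) = 1 →
        s.factorization p ≤ n.factorization p ∧ (r.factorization p ≤ s.factorization p ∨
          n.factorization p < s.factorization p + o.factorization p) := by
    constructor
    · intro h p hp hpr he
      have := h p (Nat.mem_primeFactors.2 ⟨hp, hpr, hr⟩) he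
      rwa [← pow_add, hp.pow_dvd_iff_le_factorization hn, hp.pow_dvd_iff_le_factorization hs,
        hp.pow_dvd_iff_le_factorization hn, not_le] at this
    · intro h p hpr he
      obtain ⟨hp, hpr, -⟩ := Nat.mem_primeFactors.1 hpr
      rw [← pow_add, hp.pow_dvd_iff_le_factorization hn, hp.pow_dvd_iff_le_factorization hs,
        hp.pow_dvd_iff_le_factorization hn, not_le]
      exact h p hp hpr he
  have h4 : 4 ∣ n ↔ 2 ≤ n.factorization 2 := Nat.prime_two.pow_dvd_iff_le_factorization (k := 2) hn
  have h8 : 8 ∣ m ↔ 3 ≤ m.factorization 2 := Nat.prime_two.pow_dvd_iff_le_factorization (k := 3) hm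
  rw [h1, h4, h8, Nat.prime_two.pow_dvd_iff_le_factorization hs, ← pow_add,
    (Nat.pow_right_injective le_rfl).ne_iff, Nat.pow_lt_pow_iff_right one_lt_two, and_imp, and_imp]
  exact ⟨fun h => ⟨h.pos, h.neg⟩, fun h => ⟨h.1, h.2⟩⟩

/-- A prime outside `π` and `ν` divides neither `m` nor `n`, so conditions at the primes of `π` may
be stated for all primes outside `ν`. -/
theorem admissible_iff {m n s r o : ℕ} {ε : ℤ} (hm : m ≠ 0) (hn : n ≠ 0) (hs : s ≠ 0) (hr : r ≠ 0)
    (ho : o ≠ 0) {π : Finset ℕ} (hπ : π = (m * n).primeFactors \ nu m r) :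
    Admissible m n s r o ε ↔
      (s ∣ m ∧ r ∣ m ∧ o ∣ piPart π n ∧ piPart π m ∣ r * n ∧ piPart π m ∣ r * s ∧
        piPart (nu m r) s = piPart (nu m r) m ∧ (4 ∣ m → 4 ∣ r)) ∧
      (ε = -1 → 2 ∣ n ∧ 4 ∣ m ∧ ordProj[2] m ∣ 2 * s) ∧
      (o ∣ (nu m r).lcm (fun q => q - 1) ∧
        ∀ q ∈ nu m r, Nat.gcd o (q - 1) = 1 → ∃ p ∈ nu m r ∩ n.primeFactors, p ∣ q - 1) := by
  have hmem : ∀ p, p ∈ π ↔ p.Prime ∧ (p ∣ m ∨ p ∣ n) ∧ p ∉ nu m r := by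
    intro p
    rw [hπ, Finset.mem_sdiff, Nat.mem_primeFactors]
    constructor
    · rintro ⟨⟨hp, hd, -⟩, h⟩
      exact ⟨hp, hp.dvd_mul.1 hd, h⟩
    · rintro ⟨hp, hd, h⟩
      exact ⟨⟨hp, hp.dvd_mul.2 hd, mul_ne_zero hm hn⟩, h⟩
  have hπp : ∀ p ∈ π, p.Prime := fun p hp => ((hmem p).1 hp).1
  have ho_iff : o ∣ piPart π n ↔ ∀ p, p.Prime →
      o.factorization p ≤ if p ∈ nu m r then 0 else n.factorization p := by
    rw [dvd_piPart_iff hπp ho]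
    refine forall₂_congr fun p hp => ?_
    by_cases h1 : p ∈ nu m r
    · rw [if_pos h1, if_neg fun h => ((hmem p).1 h).2.2 h1]
    · rw [if_neg h1]
      by_cases h2 : p ∈ π
      · rw [if_pos h2]
      · rw [if_neg h2, Nat.factorization_eq_zero_of_not_dvd (n := n)]
        intro h3
        exact h2 ((hmem p).2 ⟨hp, Or.inr h3, h1⟩)
  have hm_iff : ∀ x, x ≠ 0 → (piPart π m ∣ r * x ↔ ∀ p, p.Prime → p ∉ nu m r →
      m.factorization p ≤ r.factorization p + x.factorization p) := by
    intro x hx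
    rw [piPart_dvd_iff hπp (mul_ne_zero hr hx), Nat.factorization_mul hr hx]
    constructor
    · intro h p hp hν
      by_cases hpm : p ∣ m
      · exact h p ((hmem p).2 ⟨hp, Or.inl hpm, hν⟩)
      · rw [Nat.factorization_eq_zero_of_not_dvd hpm]
        exact Nat.zero_le _
    · intro h p hp
      obtain ⟨hp, -, hν⟩ := (hmem p).1 hp
      exact h p hp hν
  have h2s : ordProj[2] m ∣ 2 * s ↔ m.factorization 2 ≤ s.factorization 2 + 1 := by
    rw [Nat.prime_two.pow_dvd_iff_le_factorization (mul_ne_zero two_ne_zero hs),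
      Nat.factorization_mul two_ne_zero hs, Finsupp.add_apply, Nat.prime_two.factorization_self,
      add_comm]
  rw [ho_iff, hm_iff n hn, hm_iff s hs, h2s, piPart_eq_iff fun q => prime_of_mem_nu]
  constructor
  · intro h
    exact ⟨⟨h.s_dvd, h.r_dvd, h.o_le, h.m_le_n, h.m_le_s, h.s_eq, h.four_dvd⟩, h.neg, h.o_dvd,
      h.exists_dvd⟩
  · rintro ⟨⟨h1, h2, h3, h4, h5, h6, h7⟩, h8, h9, h10⟩
    exact ⟨h1, h2, h3, h4, h5, h6, h7, h8, h9, h10⟩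

end Metacyclic

theorem mainTheorem8 (m n s r o : ℕ) (ε : ℤ) (hm : 0 < m) (hn : 0 < n) (hs : 0 < s) (hr : 0 < r)
    (ho : 0 < o) (hε : ε = 1 ∨ ε = -1) (π' π : Finset ℕ)
    (hπ' : π' = m.primeFactors \ r.primeFactors) (hπ : π = (m * n).primeFactors \ π') :
    (∃ (G : Type) (_ : Group G) (_ : Finite G), Metacyclic.HasIN G (m, n, s, r, ε, o)) ↔
      -- (A)
      ((s ∣ m ∧ r ∣ m ∧ o ∣ Metacyclic.piPart π n ∧ Metacyclic.piPart π m ∣ r * n ∧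
          Metacyclic.piPart π m ∣ r * s ∧ Metacyclic.piPart π' s = Metacyclic.piPart π' m ∧
          (4 ∣ m → 4 ∣ r)) ∧
      -- (B)
        (∀ p ∈ r.primeFactors, ε ^ (p - 1) = 1 →
          ordProj[p] s ∣ n ∧ (ordProj[p] r ∣ s ∨ ¬ ordProj[p] s * ordProj[p] o ∣ n)) ∧
      -- (C)
        (ε = -1 → 2 ∣ n ∧ 4 ∣ m ∧ ordProj[2] m ∣ 2 * s ∧
          ordProj[2] s ≠ ordProj[2] n * ordProj[2] r ∧
          (4 ∣ n ∧ 8 ∣ m ∧ ordProj[2] o < ordProj[2] n → ordProj[2] r ∣ s)) ∧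
      -- (D)
        (o ∣ π'.lcm (fun q => q - 1) ∧
          ∀ q ∈ π', Nat.gcd o (q - 1) = 1 → ∃ p ∈ π' ∩ n.primeFactors, p ∣ q - 1)) := by
  obtain rfl : π' = Metacyclic.nu m r := hπ'
  rw [Metacyclic.exists_hasIN_iff hm.ne' hn.ne' hr.ne' ho.ne' hε,
    Metacyclic.admissible_iff hm.ne' hn.ne' hs.ne' hr.ne' ho.ne' hπ,
    Metacyclic.reducedData_iff hm.ne' hn.ne' hs.ne' hr.ne']
  constructor
  · rintro ⟨⟨hA, hC, hD⟩, hB, hC'⟩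
    exact ⟨hA, hB, fun he => ⟨(hC he).1, (hC he).2.1, (hC he).2.2, (hC' he).1, (hC' he).2⟩, hD⟩
  · rintro ⟨hA, hB, hC, hD⟩
    exact ⟨⟨hA, fun he => ⟨(hC he).1, (hC he).2.1, (hC he).2.2.1⟩, hD⟩, hB,
      fun he => (hC he).2.2.2⟩
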